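/- Let $d,n\in\mathbb N=\{1,2,\dots\}$, $r>1/2$, $q=2n$, and let $\mu$ be the normalized Lebesgue measure $d\mu=(2\pi)^{-d}d\mathbf x$ on $[0,2\pi]^d$; write $\|f\|_p$ for the norm of $L_p([0,2\pi]^d,\mu)$. For $k\in\mathbb Z$ put $k^*:=\max(|k|,1)$ and let $F_r$ be the integrable function on $\mathbb R^d$, $2\pi$-periodic in each variable, with Fourier coefficients $$\hat F_r(\mathbf k):=(2\pi)^{-d}\int_{[0,2\pi]^d}F_r(\mathbf x)e^{-i(\mathbf k,\mathbf x)}\,d\mathbf x=\prod_{j=1}^d (k_j^*)^{-r},\qquad \mathbf k\in\mathbb Z^d.$$ Let $\mathbf W^r_2$ be the class of all functions of the form $$f(\mathbf x)=(2\pi)^{-d}\int_{[0,2\pi]^d}F_r(\mathbf x-\mathbf y)\varphi(\mathbf y)\,d\mathbf y,\qquad \varphi\in L_2,\ \|\varphi\|_2\le 1$$ (these are continuous functions), and for $m\in\mathbb N$ and a class $W$ of continuous functions define $$er_m^o(W,L_q):=\inf_{\xi^1,\dots,\xi^m\in[0,2\pi]^d;\ \lambda_1,\dots,\lambda_m\in\mathbb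 R}\ \sup_{f\in W}\left|\|f\|_q^q-\sum_{j=1}^m\lambda_j|f(\xi^j)|^q\right|.$$ Then $$er_m^o(\mathbf W^r_2,L_q)\asymp m^{-r}(\log m)^{(d-1)/2},$$ that is, there are constants $c,C>0$, depending only on $r$, $d$ and $q$, such that for all integers $m\ge 2$ $$c\,m^{-r}(\log m)^{(d-1)/2}\le er_m^o(\mathbf W^r_2,L_q)\le C\,m^{-r}(\log m)^{(d-1)/2}.$$ This holds both for the class $\mathbf W^r_2$ of complex-valued functions and for the class of the real-valued functions in it. -/

import Mathlib

open MeasureTheory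
open scoped ENNReal

noncomputable section

namespace SamplingDiscretization

/-- The cube `[0, 2π]^d`. -/
def cube (d : ℕ) : Set (Fin d → ℝ) :=
  Set.Icc (fun _ => 0) (fun _ => 2 * Real.pi)

/-- The normalized Lebesgue measure `(2π)^{-d} dx` on the cube `[0, 2π]^d`
(a probability measure). -/
def cubeMeasure (d : ℕ) : Measure (Fin d → ℝ) :=
  ENNReal.ofReal (((2 * Real.pi) ^ d)⁻¹) • (volume.restrict (cube d))

/-- `F` is `2π`-periodic in each of its `d` variables. -/
def IsPeriodic {d : ℕ} (F : (Fin d → ℝ) → ℂ) : Prop :=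
  ∀ (x : Fin d → ℝ) (j : Fin d), F (x + Pi.single j (2 * Real.pi)) = F x

/-- The Fourier coefficient `(2π)^{-d} ∫ F(x) e^{-i(k,x)} dx` over `[0, 2π]^d`. -/
def fourierCoefficient {d : ℕ} (F : (Fin d → ℝ) → ℂ) (k : Fin d → ℤ) : ℂ :=
  ∫ x, F x * Complex.exp (-(Complex.I * ((∑ j, (k j : ℝ) * x j : ℝ) : ℂ))) ∂(cubeMeasure d)

/-- `J_F(φ)(x) = (2π)^{-d} ∫ F(x - y) φ(y) dy`, the integral being over `[0, 2π]^d`. -/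
def convolve {d : ℕ} (F φ : (Fin d → ℝ) → ℂ) (x : Fin d → ℝ) : ℂ :=
  ∫ y, F (x - y) * φ y ∂(cubeMeasure d)

/-- `F` is (a representative of) the kernel `F_r`: a periodic function in `L_1` whose Fourier
coefficients are `∏_j max(|k_j|, 1)^{-r}`. Any two such functions agree almost everywhere. -/
def IsMixedKernel (d : ℕ) (r : ℝ) (F : (Fin d → ℝ) → ℂ) : Prop :=
  IsPeriodic F ∧ Integrable F (cubeMeasure d) ∧
    ∀ k : Fin d → ℤ,
      fourierCoefficient F k = ((∏ j, ((max |k j| 1 : ℤ) : ℝ) ^ (-r) : ℝ) : ℂ)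

/-- The class `W^r_2` of functions with bounded mixed derivative:
all `f = J_{F_r}(φ)` with `‖φ‖_2 ≤ 1`. -/
def mixedClass (d : ℕ) (r : ℝ) : Set ((Fin d → ℝ) → ℂ) :=
  {f | ∃ F φ : (Fin d → ℝ) → ℂ, IsMixedKernel d r F ∧ MemLp φ 2 (cubeMeasure d) ∧
    eLpNorm φ 2 (cubeMeasure d) ≤ 1 ∧ f = convolve F φ}

/-- The real-valued functions in the class `W^r_2`. -/
def realMixedClass (d : ℕ) (r : ℝ) : Set ((Fin d → ℝ) → ℂ) :=
  {f | f ∈ mixedClass d r ∧ ∀ x, (f x).im = 0}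

/-- `er(f, ξ, Λ, L_q) = | ‖f‖_q^q - ∑_j λ_j |f(ξ^j)|^q |`. -/
def weightedError {d m : ℕ} (q : ℝ) (ξ : Fin m → cube d) (lam : Fin m → ℝ)
    (f : (Fin d → ℝ) → ℂ) : ℝ :=
  |(∫ x, ‖f x‖ ^ q ∂(cubeMeasure d)) - ∑ j, lam j * ‖f (ξ j)‖ ^ q|

/-- The optimal weighted discretization error `er_m^o(W, L_q)`: the infimum over the `m` nodes
in `[0, 2π]^d` and the `m` real weights of the supremum of the error over `W`. -/
def optimalError {d : ℕ} (m : ℕ) (W : Set ((Fin d → ℝ) → ℂ)) (q : ℝ) : ℝ≥0∞ :=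
  ⨅ (ξ : Fin m → cube d) (lam : Fin m → ℝ), ⨆ f ∈ W, ENNReal.ofReal (weightedError q ξ lam f)

/-- The rate `m^{-r} (log m)^{(d-1)/2}`. -/
def rate (d : ℕ) (r : ℝ) (m : ℕ) : ℝ :=
  (m : ℝ) ^ (-r) * Real.log m ^ (((d : ℝ) - 1) / 2)

end SamplingDiscretization

end

noncomputable section

namespace SamplingDiscretization

/-! ### Transfer between the cube and the torus -/

-- Since `r > 1/2`, the class is a ball in a Hilbert space of absolutely convergent Fourier series:
-- `HasMixedSeries r R` says that `f` has coefficients `c_k w(k)^{-r}`, where `w(k) = ∏ k_j^*` and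
-- `∑ |c_k|² ≤ R`. Everything is done with these coefficients.
--
-- Upper bound. This space is an algebra (`exists_hasMixedSeries_mul`), because `w^{-2r} * w^{-2r} ≤
-- C w^{-2r}`. As `q = 2n` is even, `|f|^q = (f * conj f)^n` stays in a fixed multiple of the class,
-- so discretizing `‖f‖_q^q` reduces to linear cubature on the class. By duality the squared
-- worst-case cubature error is `∑_k w(k)^{-2r} |∑_z λ_z e^{i(k,ξ_z)} - δ_{k0}|²`
-- (`abs_integral_sub_sum_le`). The nodes come from a shifted Frolov lattice, whose dual has
-- coordinate products bounded below (`exists_frolov_matrix`), and the weights come from a smooth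
-- window. As a function of the shift, the sum at frequency `k` is a periodization whose mean is
-- exactly `δ_{k0}`. Parseval over the shift turns the averaged squared error into a sum over
-- nonzero dual lattice points, of size `M^{-2r} (log M)^{d-1}` with `M` comparable to `m`
-- (`exists_lattice_sum_le`). Some shift does at least as well as the average (`exists_cubature`).
--
-- Lower bound. Given `m` nodes and a box of at least `2m` frequencies, project the vector of
-- characters onto the orthogonal complement of its values at the nodes. The normalized squared
-- length of the projection is a nonnegative trigonometric polynomial that vanishes at the nodes,
-- has mean at least `1/2` and has `L_2` norm at most one (`exists_nonneg_trigPolynomial`). Summing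
-- over about `N^{d-1}` dyadic boxes of volume `2^N`, with `2^N` comparable to `m`, multiplies the
-- mean by their number, but the norm only by its square root (`exists_fooling_function`). This
-- gives the factor `(log m)^{(d-1)/2}`. If `g` is the rescaled sum, then `1/2` and `1/2 + g` agree
-- at the nodes, while the integrals of their `q`-th powers differ by at least a constant times `∫
-- g` (`le_optimalError_of_nonneg_vanishing`).

local instance haarMeasureSpace : MeasureSpace UnitAddCircle := ⟨AddCircle.haarAddCircle⟩

local instance haarMeasureSpace_isAddHaar :
    Measure.IsAddHaarMeasure (volume : Measure UnitAddCircle) :=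
  inferInstanceAs (Measure.IsAddHaarMeasure AddCircle.haarAddCircle)

local instance haarMeasureSpace_isProbability :
    IsProbabilityMeasure (volume : Measure UnitAddCircle) :=
  inferInstanceAs (IsProbabilityMeasure AddCircle.haarAddCircle)

/-- The exponential `e^{i(k,x)}`. -/
def character {d : ℕ} (k : Fin d → ℤ) (x : Fin d → ℝ) : ℂ :=
  Complex.exp (Complex.I * ((∑ j, (k j : ℝ) * x j : ℝ) : ℂ))

/-- The weight `∏_j max(|k_j|, 1)^r`. -/
def mixedWeight {d : ℕ} (r : ℝ) (k : Fin d → ℤ) : ℝ :=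
  ∏ j, ((max |k j| 1 : ℤ) : ℝ) ^ r

/-- The projection of `ℝ^d` onto the torus, with period `2π` in each variable. -/
def toTorus {d : ℕ} (x : Fin d → ℝ) : UnitAddTorus (Fin d) :=
  fun j => ((x j / (2 * Real.pi) : ℝ) : UnitAddCircle)

/-- The representative of a point of the torus in `(0, 1]^d`. -/
def unitRep {d : ℕ} (t : UnitAddTorus (Fin d)) : Fin d → ℝ :=
  fun j => (AddCircle.equivIoc 1 0 (t j) : ℝ)

/-- The representative of a point of the torus in `(0, 2π]^d`. -/
def fromTorus {d : ℕ} (t : UnitAddTorus (Fin d)) : Fin d → ℝ :=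
  fun j => 2 * Real.pi * unitRep t j

lemma unitRep_mem {d : ℕ} (t : UnitAddTorus (Fin d)) (j : Fin d) :
    unitRep t j ∈ Set.Ioc (0 : ℝ) 1 := by
  have := (AddCircle.equivIoc (1 : ℝ) 0 (t j)).2
  simpa [unitRep] using this

lemma coe_unitRep {d : ℕ} (t : UnitAddTorus (Fin d)) :
    (fun j => ((unitRep t j : ℝ) : UnitAddCircle)) = t := by
  funext j
  exact (AddCircle.equivIoc (1 : ℝ) 0).symm_apply_apply (t j)

lemma toTorus_fromTorus {d : ℕ} (t : UnitAddTorus (Fin d)) : toTorus (fromTorus t) = t := by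
  conv_rhs => rw [← coe_unitRep t]
  funext j
  have : (2 * Real.pi) ≠ 0 := by positivity
  simp [toTorus, fromTorus, this]

lemma toTorus_sub {d : ℕ} (x y : Fin d → ℝ) : toTorus (x - y) = toTorus x - toTorus y := by
  funext j
  simp [toTorus, sub_div]

lemma mFourier_toTorus {d : ℕ} (k : Fin d → ℤ) (x : Fin d → ℝ) :
    UnitAddTorus.mFourier k (toTorus x) = character k x := by
  have h2 : (Real.pi : ℂ) ≠ 0 := by exact_mod_cast Real.pi_ne_zero
  simp only [UnitAddTorus.mFourier, toTorus, character, ContinuousMap.coe_mk, fourier_coe_apply]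
  rw [← Complex.exp_sum]
  congr 1
  push_cast
  rw [Finset.mul_sum]
  refine Finset.sum_congr rfl fun j _ => ?_
  field_simp

lemma character_add {d : ℕ} (k l : Fin d → ℤ) (x : Fin d → ℝ) :
    character (k + l) x = character k x * character l x := by
  simp only [← mFourier_toTorus, UnitAddTorus.mFourier_add]

lemma character_neg {d : ℕ} (k : Fin d → ℤ) (x : Fin d → ℝ) :
    character (-k) x = (starRingEnd ℂ) (character k x) := by
  simp only [← mFourier_toTorus, UnitAddTorus.mFourier_neg]

lemma character_zero {d : ℕ} (x : Fin d → ℝ) : character (0 : Fin d → ℤ) x = 1 := by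
  simp [character]

lemma norm_character {d : ℕ} (k : Fin d → ℤ) (x : Fin d → ℝ) : ‖character k x‖ = 1 := by
  rw [character, mul_comm, Complex.norm_exp_ofReal_mul_I]

lemma continuous_character {d : ℕ} (k : Fin d → ℤ) : Continuous (character k) := by
  unfold character
  fun_prop

lemma measurable_unitRep {d : ℕ} : Measurable (unitRep (d := d)) :=
  measurable_subtype_coe.comp (UnitAddTorus.measurableEquivPiIoc (fun _ => (0 : ℝ))).measurable

lemma measurePreserving_unitRep {d : ℕ} :
    MeasurePreserving (unitRep (d := d)) volume
      (volume.restrict {x | ∀ i, x i ∈ Set.Ioc (0 : ℝ) 1}) := by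
  have h := UnitAddTorus.measurePreserving_equivPiIoc (d := Fin d) (fun _ => (0 : ℝ))
  have hm : MeasurableSet {x : Fin d → ℝ | ∀ i, x i ∈ Set.Ioc (0 : ℝ) (0 + 1)} :=
    MeasurableSet.univ_pi' (fun i => measurableSet_Ioc)
  have h2 : MeasurePreserving
      (Subtype.val : {x : Fin d → ℝ // ∀ i, x i ∈ Set.Ioc (0 : ℝ) (0 + 1)} → (Fin d → ℝ))
      (Measure.comap Subtype.val volume)
      (volume.restrict {x : Fin d → ℝ | ∀ i, x i ∈ Set.Ioc (0 : ℝ) (0 + 1)}) :=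
    ⟨measurable_subtype_coe, map_comap_subtype_coe hm volume⟩
  have h3 := h2.comp h
  simp only [zero_add] at h3
  exact h3

lemma cubeMeasure_eq_map {d : ℕ} :
    (volume.restrict {x : Fin d → ℝ | ∀ i, x i ∈ Set.Ioc (0 : ℝ) 1}).map
      (fun x => (2 * Real.pi) • x) = cubeMeasure d := by
  have hpi : (0 : ℝ) < 2 * Real.pi := by positivity
  have hme : MeasurableEmbedding (fun x : Fin d → ℝ => (2 * Real.pi) • x) :=
    (Homeomorph.smulOfNeZero (2 * Real.pi) hpi.ne').measurableEmbedding
  have hs : {x : Fin d → ℝ | ∀ i, x i ∈ Set.Ioc (0 : ℝ) 1} =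
      (fun x : Fin d → ℝ => (2 * Real.pi) • x) ⁻¹'
        (Set.univ.pi fun _ => Set.Ioc (0 : ℝ) (2 * Real.pi)) := by
    ext x
    simp only [Set.mem_ofPred_eq, Set.mem_Ioc, Set.mem_preimage, Set.mem_univ_pi, Pi.smul_apply,
      smul_eq_mul]
    refine forall_congr' fun i => and_congr ?_ ?_
    · simp [hpi]
    · exact (mul_le_iff_le_one_right hpi).symm
  rw [hs, ← hme.restrict_map, Measure.map_addHaar_smul _ hpi.ne', cubeMeasure, Measure.restrict_smul]
  have h1 : (volume.restrict (Set.univ.pi fun _ : Fin d => Set.Ioc (0 : ℝ) (2 * Real.pi))) =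
      volume.restrict (cube d) := by
    apply Measure.restrict_congr_set
    exact Measure.univ_pi_Ioc_ae_eq_Icc
  rw [h1]
  congr 2
  rw [Module.finrank_fin_fun, abs_of_pos (by positivity)]

lemma measurePreserving_fromTorus {d : ℕ} :
    MeasurePreserving (fromTorus (d := d)) volume (cubeMeasure d) := by
  have h : MeasurePreserving (fun x : Fin d → ℝ => (2 * Real.pi) • x)
      (volume.restrict {x : Fin d → ℝ | ∀ i, x i ∈ Set.Ioc (0 : ℝ) 1}) (cubeMeasure d) :=
    ⟨by fun_prop, cubeMeasure_eq_map⟩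
  exact h.comp measurePreserving_unitRep

lemma measurable_toTorus {d : ℕ} : Measurable (toTorus (d := d)) :=
  measurable_pi_lambda _ fun j =>
    AddCircle.measurable_mk'.comp ((measurable_pi_apply j).div_const _)

lemma measurePreserving_toTorus {d : ℕ} :
    MeasurePreserving (toTorus (d := d)) (cubeMeasure d) volume := by
  refine ⟨measurable_toTorus, ?_⟩
  rw [← measurePreserving_fromTorus.map_eq,
    Measure.map_map measurable_toTorus measurePreserving_fromTorus.measurable]
  have : toTorus (d := d) ∘ fromTorus = id := funext toTorus_fromTorus
  rw [this, Measure.map_id]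

instance {d : ℕ} : IsProbabilityMeasure (cubeMeasure d) :=
  ⟨by rw [← measurePreserving_fromTorus.measure_preimage MeasurableSet.univ.nullMeasurableSet,
    Set.preimage_univ, measure_univ]⟩

lemma integral_cube_eq {d : ℕ} {E : Type*} [NormedAddCommGroup E] [NormedSpace ℝ E]
    (f : (Fin d → ℝ) → E) :
    ∫ x, f x ∂(cubeMeasure d) = ∫ t : UnitAddTorus (Fin d), f (fromTorus t) := by
  have hemb : MeasurableEmbedding (fromTorus (d := d)) := by
    have h1 : MeasurableEmbedding (unitRep (d := d)) :=
      (MeasurableEmbedding.subtype_coe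
        (MeasurableSet.univ_pi' (fun i => measurableSet_Ioc))).comp
        (UnitAddTorus.measurableEquivPiIoc (fun _ => (0 : ℝ))).measurableEmbedding
    exact (Homeomorph.smulOfNeZero (2 * Real.pi)
      (by positivity : (2 * Real.pi) ≠ 0)).measurableEmbedding.comp h1
  exact (measurePreserving_fromTorus.integral_comp hemb f).symm

/-! ### Fourier series of integrable functions on the torus -/

/-- All the weights used below are products over coordinates; this reduces their sums over `ℤ^d` or
`ℕ^d` to one variable. Values in `ℝ≥0∞` avoid summability side conditions. -/
lemma tsum_pi_prod {α : Type*} {d : ℕ} (f : Fin d → α → ℝ≥0∞) :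
    ∑' k : Fin d → α, ∏ j, f j (k j) = ∏ j, ∑' a, f j a := by
  induction d with
  | zero => simp
  | succ d ih =>
    rw [← (Fin.consEquiv fun _ => α).tsum_eq, ENNReal.tsum_prod']
    simp only [Fin.consEquiv_apply, Fin.prod_univ_succ, Fin.cons_zero, Fin.cons_succ]
    simp_rw [ENNReal.tsum_mul_left, ih fun j => f j.succ, ENNReal.tsum_mul_right]

/-- Pairing with `f` is a continuous functional on `C(T^d)`; it kills the characters, whose span is
dense. -/
lemma integral_continuous_mul_eq_zero {d : ℕ} {f : UnitAddTorus (Fin d) → ℂ}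
    (hf : Integrable f volume) (h0 : ∀ k, UnitAddTorus.mFourierCoeff f k = 0)
    (g : C(UnitAddTorus (Fin d), ℂ)) : ∫ t, g t * f t = 0 := by
  have hint : ∀ g : C(UnitAddTorus (Fin d), ℂ), Integrable (fun t => g t * f t) volume := fun g =>
    hf.bdd_mul (c := ‖g‖) g.continuous.aestronglyMeasurable
      (Filter.Eventually.of_forall fun t => g.norm_coe_le_norm t)
  let L : C(UnitAddTorus (Fin d), ℂ) →ₗ[ℂ] ℂ :=
    { toFun := fun g => ∫ t, g t * f t
      map_add' := fun g₁ g₂ => by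
        simp only [ContinuousMap.add_apply, add_mul]
        exact integral_add (hint g₁) (hint g₂)
      map_smul' := fun c g => by
        simp only [ContinuousMap.smul_apply, smul_eq_mul, mul_assoc, RingHom.id_apply]
        exact integral_const_mul c _ }
  have hL : Continuous L := by
    refine (L.mkContinuous (∫ t, ‖f t‖) fun g => ?_).continuous
    refine (norm_integral_le_integral_norm _).trans ?_
    rw [mul_comm, ← integral_const_mul]
    refine integral_mono (hint g).norm (hf.norm.const_mul _) fun t => ?_
    rw [norm_mul]
    exact mul_le_mul_of_nonneg_right (g.norm_coe_le_norm t) (norm_nonneg _)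
  have hker : (⊤ : Submodule ℂ C(UnitAddTorus (Fin d), ℂ)) ≤ LinearMap.ker L := by
    rw [← UnitAddTorus.span_mFourier_closure_eq_top]
    refine Submodule.topologicalClosure_minimal _ ?_ ?_
    · rw [Submodule.span_le]
      rintro _ ⟨k, rfl⟩
      have := h0 (-k)
      simp only [UnitAddTorus.mFourierCoeff, neg_neg, smul_eq_mul] at this
      exact this
    · exact isClosed_singleton.preimage hL
  exact hker (Submodule.mem_top (x := g))

/-- Uniqueness of Fourier coefficients is needed in `L_1`, since the kernel is only assumed
integrable. Indicators of closed sets are bounded pointwise limits of continuous functions, so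
dominated convergence reduces to the previous lemma. -/
lemma ae_eq_zero_of_mFourierCoeff_eq_zero {d : ℕ} {f : UnitAddTorus (Fin d) → ℂ}
    (hf : Integrable f volume) (h0 : ∀ k, UnitAddTorus.mFourierCoeff f k = 0) : f =ᵐ[volume] 0 := by
  refine ae_eq_zero_of_forall_setIntegral_isClosed_eq_zero hf fun s hs => ?_
  have hz : ∀ n, ∫ t, ((hs.apprSeq n t : ℝ) : ℂ) * f t = 0 := fun n => by
    have := integral_continuous_mul_eq_zero hf h0
      ⟨fun t => ((hs.apprSeq n t : ℝ) : ℂ), by fun_prop⟩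
    exact this
  have hlim : Filter.Tendsto (fun n => ∫ t, ((hs.apprSeq n t : ℝ) : ℂ) * f t) Filter.atTop
      (nhds (∫ t, s.indicator f t)) := by
    refine tendsto_integral_of_dominated_convergence (fun t => ‖f t‖) (fun n => ?_) hf.norm
      (fun n => Filter.Eventually.of_forall fun t => ?_) (Filter.Eventually.of_forall fun t => ?_)
    · refine AEStronglyMeasurable.mul (Continuous.aestronglyMeasurable ?_) hf.aestronglyMeasurable
      fun_prop
    · rw [norm_mul]
      refine mul_le_of_le_one_left (norm_nonneg _) ?_
      have h1 := HasOuterApproxClosed.apprSeq_apply_le_one hs n t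
      rw [Complex.norm_real, Real.norm_of_nonneg (NNReal.coe_nonneg _)]
      exact_mod_cast h1
    · have h1 := tendsto_pi_nhds.mp (HasOuterApproxClosed.tendsto_apprSeq hs) t
      have h2 : Filter.Tendsto (fun n => ((hs.apprSeq n t : ℝ) : ℂ) * f t) Filter.atTop
          (nhds ((((s.indicator (fun _ => (1 : NNReal)) t : NNReal) : ℝ) : ℂ) * f t)) := by
        refine Filter.Tendsto.mul_const _ ?_
        exact (Complex.continuous_ofReal.tendsto _).comp ((NNReal.continuous_coe.tendsto _).comp h1)
      convert h2 using 2
      by_cases ht : t ∈ s <;> simp [ht]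
  simp only [hz] at hlim
  rw [← integral_indicator hs.measurableSet]
  exact (tendsto_nhds_unique hlim tendsto_const_nhds)

lemma exists_memLp_mFourierCoeff {d : ℕ} {a : (Fin d → ℤ) → ℂ} (ha : Summable fun k => ‖a k‖ ^ 2) :
    ∃ f : UnitAddTorus (Fin d) → ℂ, MemLp f 2 volume ∧
      ∀ k, UnitAddTorus.mFourierCoeff f k = a k := by
  have hmem : Memℓp a 2 := memℓp_gen (by simpa using ha)
  let f := (UnitAddTorus.mFourierBasis (d := Fin d)).repr.symm ⟨a, hmem⟩
  refine ⟨f, Lp.memLp f, fun k => ?_⟩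
  rw [← UnitAddTorus.mFourierBasis_repr]
  simp [f]

lemma mFourierCoeff_congr_ae {d : ℕ} {f g : UnitAddTorus (Fin d) → ℂ} (h : f =ᵐ[volume] g)
    (k : Fin d → ℤ) : UnitAddTorus.mFourierCoeff f k = UnitAddTorus.mFourierCoeff g k := by
  refine integral_congr_ae ?_
  filter_upwards [h] with t ht
  rw [ht]

lemma integrable_mFourier_mul {d : ℕ} {f : UnitAddTorus (Fin d) → ℂ} (hf : Integrable f volume)
    (k : Fin d → ℤ) : Integrable (fun t => UnitAddTorus.mFourier k t * f t) volume :=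
  hf.bdd_mul (c := 1) (UnitAddTorus.mFourier k).continuous.aestronglyMeasurable
    (Filter.Eventually.of_forall fun t => (ContinuousMap.norm_coe_le_norm _ t).trans
      UnitAddTorus.mFourier_norm.le)

lemma ae_eq_of_mFourierCoeff_eq {d : ℕ} {f g : UnitAddTorus (Fin d) → ℂ}
    (hf : Integrable f volume) (hg : Integrable g volume)
    (h : ∀ k, UnitAddTorus.mFourierCoeff f k = UnitAddTorus.mFourierCoeff g k) :
    f =ᵐ[volume] g := by
  have := ae_eq_zero_of_mFourierCoeff_eq_zero (hf.sub hg) fun k => by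
    have h1 : UnitAddTorus.mFourierCoeff (f - g) k =
        UnitAddTorus.mFourierCoeff f k - UnitAddTorus.mFourierCoeff g k := by
      simp only [UnitAddTorus.mFourierCoeff, Pi.sub_apply, smul_eq_mul, mul_sub]
      exact integral_sub (integrable_mFourier_mul hf _) (integrable_mFourier_mul hg _)
    rw [h1, h k, sub_self]
  filter_upwards [this] with t ht
  exact sub_eq_zero.mp ht

lemma hasSum_sq_mFourierCoeff_of_memLp {d : ℕ} {f : UnitAddTorus (Fin d) → ℂ}
    (hf : MemLp f 2 volume) :
    HasSum (fun k => ‖UnitAddTorus.mFourierCoeff f k‖ ^ 2) (∫ t, ‖f t‖ ^ 2) := by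
  have h := UnitAddTorus.hasSum_sq_mFourierCoeff (hf.toLp f)
  have hae := hf.coeFn_toLp
  convert! h using 1
  · funext k
    rw [mFourierCoeff_congr_ae hae]
  · refine integral_congr_ae ?_
    filter_upwards [hae] with t ht
    rw [ht]

instance : (volume : Measure UnitAddCircle).IsNegInvariant :=
  Measure.IsAddHaarMeasure.isNegInvariant_of_regular _

instance {d : ℕ} : (volume : Measure (UnitAddTorus (Fin d))).IsNegInvariant :=
  Measure.pi.isNegInvariant _

/-- Parseval for the inner product of `g` with `t ↦ conj (f (p - t))`. It holds at every point `p`,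
not just almost everywhere, which matters because the class is sampled pointwise. -/
lemma hasSum_convolution {d : ℕ} {f g : UnitAddTorus (Fin d) → ℂ} (hf : MemLp f 2 volume)
    (hg : MemLp g 2 volume) (p : UnitAddTorus (Fin d)) :
    HasSum (fun k => UnitAddTorus.mFourierCoeff f k * UnitAddTorus.mFourierCoeff g k *
      UnitAddTorus.mFourier k p) (∫ t, f (p - t) * g t) := by
  let u : UnitAddTorus (Fin d) → ℂ := fun t => (starRingEnd ℂ) (f (p - t))
  have hmp : MeasurePreserving (fun t : UnitAddTorus (Fin d) => p - t) volume volume :=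
    Measure.measurePreserving_sub_left volume p
  have hu : MemLp u 2 volume := by
    have h1 : MemLp (fun t => f (p - t)) 2 volume := hf.comp_measurePreserving hmp
    exact h1.star
  have h := UnitAddTorus.hasSum_prod_mFourierCoeff (hu.toLp u) (hg.toLp g)
  have hcoef : ∀ k, (starRingEnd ℂ) (UnitAddTorus.mFourierCoeff u k) =
      UnitAddTorus.mFourierCoeff f k * UnitAddTorus.mFourier k p := fun k => by
    simp only [UnitAddTorus.mFourierCoeff, u, smul_eq_mul]
    rw [← integral_conj, ← integral_mul_const,
      ← integral_sub_left_eq_self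
        (fun t => UnitAddTorus.mFourier (-k) t * f t * UnitAddTorus.mFourier k p) volume p]
    refine integral_congr_ae (Filter.Eventually.of_forall fun t => ?_)
    simp only [map_mul, Complex.conj_conj, ← UnitAddTorus.mFourier_neg, neg_neg]
    have h2 : UnitAddTorus.mFourier (-k) (p - t) * UnitAddTorus.mFourier k p =
        UnitAddTorus.mFourier k t := by
      have h3 : ∀ (k : Fin d → ℤ) (x y : UnitAddTorus (Fin d)), UnitAddTorus.mFourier k (x + y) =
          UnitAddTorus.mFourier k x * UnitAddTorus.mFourier k y := fun k x y => by
        simp [UnitAddTorus.mFourier, Finset.prod_mul_distrib, fourier_apply, AddCircle.toCircle_add,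
          smul_add]
      have h4 : UnitAddTorus.mFourier k p = UnitAddTorus.mFourier k (p - t) *
          UnitAddTorus.mFourier k t := by rw [← h3, sub_add_cancel]
      have h5 : UnitAddTorus.mFourier (-k) (p - t) * UnitAddTorus.mFourier k (p - t) = 1 := by
        rw [← UnitAddTorus.mFourier_add, neg_add_cancel, UnitAddTorus.mFourier_zero]; rfl
      rw [h4, ← mul_assoc, h5, one_mul]
    rw [mul_right_comm, h2]
  convert! h using 1
  · funext k
    rw [mFourierCoeff_congr_ae hu.coeFn_toLp, mFourierCoeff_congr_ae hg.coeFn_toLp, hcoef]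
    ring
  · refine integral_congr_ae ?_
    filter_upwards [hu.coeFn_toLp, hg.coeFn_toLp] with t h1 h2
    rw [h1, h2]
    simp [u]

/-! ### The class `W^r_2` through Fourier series -/

lemma one_le_starAbs (k : ℤ) : (1 : ℝ) ≤ ((max |k| 1 : ℤ) : ℝ) := by
  exact_mod_cast le_max_right _ _

lemma mixedWeight_pos {d : ℕ} (r : ℝ) (k : Fin d → ℤ) : 0 < mixedWeight r k :=
  Finset.prod_pos fun _ _ => Real.rpow_pos_of_pos (zero_lt_one.trans_le (one_le_starAbs _)) _

lemma mixedWeight_mul {d : ℕ} (r s : ℝ) (k : Fin d → ℤ) :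
    mixedWeight r k * mixedWeight s k = mixedWeight (r + s) k := by
  rw [mixedWeight, mixedWeight, mixedWeight, ← Finset.prod_mul_distrib]
  exact Finset.prod_congr rfl fun j _ =>
    (Real.rpow_add (zero_lt_one.trans_le (one_le_starAbs _)) _ _).symm

lemma mixedWeight_neg {d : ℕ} (r : ℝ) (k : Fin d → ℤ) :
    mixedWeight (-r) k = (mixedWeight r k)⁻¹ := by
  refine eq_inv_of_mul_eq_one_left ?_
  rw [mixedWeight_mul, neg_add_cancel]
  simp [mixedWeight]

lemma mixedWeight_sq {d : ℕ} (r : ℝ) (k : Fin d → ℤ) :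
    mixedWeight r k ^ 2 = mixedWeight (2 * r) k := by
  rw [sq, mixedWeight_mul, two_mul]

lemma mixedWeight_zero {d : ℕ} (r : ℝ) : mixedWeight r (0 : Fin d → ℤ) = 1 := by
  simp [mixedWeight]

lemma summable_starAbs_rpow {s : ℝ} (hs : 1 < s) :
    Summable fun k : ℤ => ((max |k| 1 : ℤ) : ℝ) ^ (-s) := by
  have h := (Real.summable_abs_int_rpow hs)
  refine (Summable.of_norm_bounded_eventually h ?_)
  have : ({0} : Set ℤ).Finite := Set.finite_singleton 0
  filter_upwards [this.compl_mem_cofinite] with k hk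
  have hk : k ≠ 0 := hk
  have h1 : max |k| 1 = |k| := max_eq_left (Int.one_le_abs hk)
  rw [h1, Real.norm_of_nonneg (by positivity)]
  simp

lemma ofReal_mixedWeight {d : ℕ} (r : ℝ) (k : Fin d → ℤ) :
    ENNReal.ofReal (mixedWeight r k) =
      ∏ j, ENNReal.ofReal (((max |k j| 1 : ℤ) : ℝ) ^ r) :=
  ENNReal.ofReal_prod_of_nonneg fun _ _ =>
    (Real.rpow_pos_of_pos (zero_lt_one.trans_le (one_le_starAbs _)) _).le

lemma summable_mixedWeight {d : ℕ} {s : ℝ} (hs : 1 < s) :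
    Summable fun k : Fin d → ℤ => mixedWeight (-s) k := by
  have h : ∑' k : Fin d → ℤ, ENNReal.ofReal (mixedWeight (-s) k) ≠ ⊤ := by
    simp_rw [ofReal_mixedWeight]
    rw [tsum_pi_prod fun (_ : Fin d) (a : ℤ) => ENNReal.ofReal (((max |a| 1 : ℤ) : ℝ) ^ (-s))]
    exact ENNReal.prod_ne_top fun _ _ => (summable_starAbs_rpow hs).tsum_ofReal_ne_top
  have h2 := ENNReal.summable_toReal h
  simpa [ENNReal.toReal_ofReal (mixedWeight_pos _ _).le] using h2

/-- `f` is the sum of a Fourier series `∑ c_k (∏ k_j^*)^{-r} e^{i(k,x)}` with `∑ |c_k|² ≤ R`. -/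
def HasMixedSeries {d : ℕ} (r R : ℝ) (f : (Fin d → ℝ) → ℂ) : Prop :=
  ∃ c : (Fin d → ℤ) → ℂ, Summable (fun k => ‖c k‖ ^ 2) ∧ ∑' k, ‖c k‖ ^ 2 ≤ R ∧
    ∀ x, HasSum (fun k => c k * (mixedWeight (-r) k : ℂ) * character k x) (f x)

lemma toTorus_eq_iff {d : ℕ} {x y : Fin d → ℝ} (h : toTorus x = toTorus y) :
    ∃ n : Fin d → ℤ, x = y + fun j => n j * (2 * Real.pi) := by
  have h1 : ∀ j, ∃ n : ℤ, x j = y j + n * (2 * Real.pi) := fun j => by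
    have h2 := congrFun h j
    simp only [toTorus] at h2
    rw [← sub_eq_zero, ← AddCircle.coe_sub, AddCircle.coe_eq_zero_iff] at h2
    obtain ⟨n, hn⟩ := h2
    refine ⟨n, ?_⟩
    have : (2 * Real.pi) ≠ 0 := by positivity
    simp only [zsmul_eq_mul, mul_one] at hn
    field_simp at hn
    linarith
  choose n hn using h1
  exact ⟨n, funext hn⟩

lemma IsPeriodic.add_int {d : ℕ} {F : (Fin d → ℝ) → ℂ} (hF : IsPeriodic F) (n : Fin d → ℤ)
    (x : Fin d → ℝ) : F (x + fun j => n j * (2 * Real.pi)) = F x := by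
  have h1 : ∀ (j : Fin d) (m : ℤ) (x : Fin d → ℝ),
      F (x + Pi.single j (m * (2 * Real.pi))) = F x := fun j m => by
    induction m using Int.induction_on with
    | zero => simp
    | succ i ih =>
      intro x
      have := hF (x + Pi.single j ((i : ℤ) * (2 * Real.pi))) j
      rw [ih, add_assoc, ← Pi.single_add] at this
      rw [← this]
      push_cast
      congr 3
      ring
    | pred i ih =>
      intro x
      have := hF (x + Pi.single j (((-i - 1 : ℤ) : ℝ) * (2 * Real.pi))) j
      rw [add_assoc, ← Pi.single_add] at this
      rw [← this, ← ih x]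
      congr 3
      push_cast
      ring
  have h2 : ∀ s : Finset (Fin d), F (x + ∑ j ∈ s, Pi.single j (n j * (2 * Real.pi))) = F x := by
    intro s
    induction s using Finset.induction_on with
    | empty => simp
    | insert a s ha ih =>
      rw [Finset.sum_insert ha, add_comm (Pi.single a _), ← add_assoc, h1, ih]
  have h3 := h2 Finset.univ
  rwa [Finset.univ_sum_single (fun j => (n j : ℝ) * (2 * Real.pi))] at h3

lemma IsPeriodic.eq_of_toTorus {d : ℕ} {F : (Fin d → ℝ) → ℂ} (hF : IsPeriodic F)
    {x y : Fin d → ℝ} (h : toTorus x = toTorus y) : F x = F y := by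
  obtain ⟨n, rfl⟩ := toTorus_eq_iff h
  exact hF.add_int n y

lemma fourierCoefficient_eq {d : ℕ} (F : (Fin d → ℝ) → ℂ) (k : Fin d → ℤ) :
    fourierCoefficient F k = UnitAddTorus.mFourierCoeff (fun t => F (fromTorus t)) k := by
  rw [fourierCoefficient, integral_cube_eq, UnitAddTorus.mFourierCoeff]
  refine integral_congr_ae (Filter.Eventually.of_forall fun t => ?_)
  have h1 : Complex.exp (-(Complex.I * ((∑ j, (k j : ℝ) * fromTorus t j : ℝ) : ℂ))) =
      UnitAddTorus.mFourier (-k) t := by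
    conv_rhs => rw [← toTorus_fromTorus t, mFourier_toTorus, character]
    congr 1
    simp
  simp only [h1, smul_eq_mul, mul_comm]

lemma integrable_comp_fromTorus {d : ℕ} {F : (Fin d → ℝ) → ℂ}
    (hF : Integrable F (cubeMeasure d)) :
    Integrable (fun t : UnitAddTorus (Fin d) => F (fromTorus t)) volume :=
  measurePreserving_fromTorus.integrable_comp_of_integrable hF

lemma summable_kernel_sq {d : ℕ} {r : ℝ} (hr : 1 / 2 < r) :
    Summable fun k : Fin d → ℤ => ‖((mixedWeight (-r) k : ℝ) : ℂ)‖ ^ 2 := by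
  have h := summable_mixedWeight (d := d) (s := 2 * r) (by linarith)
  refine h.congr fun k => ?_
  rw [Complex.norm_real, Real.norm_of_nonneg (mixedWeight_pos _ _).le, mixedWeight_sq]
  congr 1
  ring

lemma convolve_hasSum {d : ℕ} {F φ : (Fin d → ℝ) → ℂ} (hF : IsPeriodic F)
    (hF2 : MemLp (fun t : UnitAddTorus (Fin d) => F (fromTorus t)) 2 volume)
    (hφ : MemLp (fun t : UnitAddTorus (Fin d) => φ (fromTorus t)) 2 volume) (x : Fin d → ℝ) :
    HasSum (fun k => fourierCoefficient F k * fourierCoefficient φ k * character k x)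
      (convolve F φ x) := by
  have h := hasSum_convolution hF2 hφ (toTorus x)
  convert! h using 1
  · funext k
    rw [fourierCoefficient_eq, fourierCoefficient_eq, mFourier_toTorus]
  · rw [convolve, integral_cube_eq]
    refine integral_congr_ae (Filter.Eventually.of_forall fun t => ?_)
    simp only
    congr 1
    refine hF.eq_of_toTorus ?_
    rw [toTorus_sub, toTorus_fromTorus, toTorus_fromTorus]

/-- The coefficients of the kernel are square summable because `2r > 1`, so by uniqueness in `L_1`
the kernel agrees almost everywhere with an `L_2` function, and the convolution formula applies. -/
lemma hasMixedSeries_of_mem_mixedClass {d : ℕ} {r : ℝ} (hr : 1 / 2 < r)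
    {f : (Fin d → ℝ) → ℂ} (hf : f ∈ mixedClass d r) : HasMixedSeries r 1 f := by
  obtain ⟨F, φ, ⟨hper, hint, hcoef⟩, hφ, hφ1, rfl⟩ := hf
  obtain ⟨F₀, hF₀, hF₀c⟩ := exists_memLp_mFourierCoeff (summable_kernel_sq (d := d) hr)
  have hae : (fun t : UnitAddTorus (Fin d) => F (fromTorus t)) =ᵐ[volume] F₀ := by
    refine ae_eq_of_mFourierCoeff_eq (integrable_comp_fromTorus hint)
      (hF₀.integrable (by norm_num)) fun k => ?_
    rw [← fourierCoefficient_eq, hcoef, hF₀c]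
    rfl
  have hF2 := (memLp_congr_ae hae).mpr hF₀
  have hφ2 : MemLp (fun t : UnitAddTorus (Fin d) => φ (fromTorus t)) 2 volume :=
    hφ.comp_measurePreserving measurePreserving_fromTorus
  have hsum := hasSum_sq_mFourierCoeff_of_memLp hφ2
  simp only [← fourierCoefficient_eq] at hsum
  refine ⟨fourierCoefficient φ, hsum.summable, ?_, fun x => ?_⟩
  · rw [hsum.tsum_eq, ← integral_cube_eq (fun x => ‖φ x‖ ^ 2)]
    have h1 := hφ.eLpNorm_eq_integral_rpow_norm (by norm_num) (by norm_num)
    rw [h1] at hφ1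
    simp only [ENNReal.toReal_ofNat, Real.rpow_ofNat] at hφ1
    rw [ENNReal.ofReal_le_one] at hφ1
    have h2 : 0 ≤ ∫ x, ‖φ x‖ ^ 2 ∂(cubeMeasure d) := integral_nonneg fun x => by positivity
    by_contra hcon
    exact absurd hφ1 (not_le.mpr (Real.one_lt_rpow (not_le.mp hcon) (by norm_num)))
  · have h := convolve_hasSum hper hF2 hφ2 x
    refine h.congr_fun fun k => ?_
    rw [hcoef]
    rw [mul_comm (fourierCoefficient φ k)]
    rfl

/-- Riesz–Fischer supplies a kernel and a density on the torus; pulling them back along `toTorus`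
makes the kernel periodic at every point. -/
lemma mem_mixedClass_of_hasMixedSeries {d : ℕ} {r : ℝ} (hr : 1 / 2 < r)
    {f : (Fin d → ℝ) → ℂ} (hf : HasMixedSeries r 1 f) : f ∈ mixedClass d r := by
  obtain ⟨c, hc, hc1, hsum⟩ := hf
  obtain ⟨F₀, hF₀, hF₀c⟩ := exists_memLp_mFourierCoeff (summable_kernel_sq (d := d) hr)
  obtain ⟨φ₀, hφ₀, hφ₀c⟩ := exists_memLp_mFourierCoeff hc
  have hF : IsPeriodic fun x : Fin d → ℝ => F₀ (toTorus x) := fun x j => by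
    refine congrArg F₀ (funext fun i => ?_)
    by_cases hi : i = j
    · subst hi
      have : (2 * Real.pi) ≠ 0 := by positivity
      simp only [toTorus, Pi.add_apply, Pi.single_eq_same, add_div, div_self this]
      rw [AddCircle.coe_add, AddCircle.coe_period, add_zero]
    · simp [toTorus, hi]
  have hF2 : MemLp (fun x : Fin d → ℝ => F₀ (toTorus x)) 2 (cubeMeasure d) :=
    hF₀.comp_measurePreserving measurePreserving_toTorus
  have hφ2 : MemLp (fun x : Fin d → ℝ => φ₀ (toTorus x)) 2 (cubeMeasure d) :=
    hφ₀.comp_measurePreserving measurePreserving_toTorus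
  have hcF : ∀ k, fourierCoefficient (fun x : Fin d → ℝ => F₀ (toTorus x)) k =
      (mixedWeight (-r) k : ℝ) := fun k => by
    rw [fourierCoefficient_eq]
    simp only [toTorus_fromTorus]
    exact hF₀c k
  have hcφ : ∀ k, fourierCoefficient (fun x : Fin d → ℝ => φ₀ (toTorus x)) k = c k := fun k => by
    rw [fourierCoefficient_eq]
    simp only [toTorus_fromTorus]
    exact hφ₀c k
  refine ⟨fun x => F₀ (toTorus x), fun x => φ₀ (toTorus x),
    ⟨hF, hF2.integrable (by norm_num), hcF⟩, hφ2, ?_, funext fun x => ?_⟩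
  · rw [hφ2.eLpNorm_eq_integral_rpow_norm (by norm_num) (by norm_num), ENNReal.ofReal_le_one]
    simp only [ENNReal.toReal_ofNat, Real.rpow_ofNat]
    refine Real.rpow_le_one (integral_nonneg fun x => by positivity) ?_ (by norm_num)
    rw [integral_cube_eq]
    simp only [toTorus_fromTorus]
    rw [← (hasSum_sq_mFourierCoeff_of_memLp hφ₀).tsum_eq]
    simpa only [hφ₀c] using hc1
  · refine (hsum x).unique ((convolve_hasSum hF (by simpa only [toTorus_fromTorus] using hF₀)
      (by simpa only [toTorus_fromTorus] using hφ₀) x).congr_fun fun k => ?_)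
    rw [hcF, hcφ, mul_comm (c k)]

/-! ### The algebra property -/

lemma summable_mul_of_sq {ι : Type*} {u v : ι → ℝ} (hu : Summable fun i => u i ^ 2)
    (hv : Summable fun i => v i ^ 2) : Summable fun i => u i * v i := by
  refine Summable.of_norm_bounded (hu.add hv) fun i => ?_
  rw [Real.norm_eq_abs, abs_le]
  constructor <;> nlinarith [sq_nonneg (u i + v i), sq_nonneg (u i - v i), sq_nonneg (u i),
    sq_nonneg (v i)]

lemma sq_tsum_mul_le {ι : Type*} {u v : ι → ℝ} (hu : Summable fun i => u i ^ 2)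
    (hv : Summable fun i => v i ^ 2) :
    (∑' i, u i * v i) ^ 2 ≤ (∑' i, u i ^ 2) * ∑' i, v i ^ 2 := by
  have h1 := (summable_mul_of_sq hu hv).hasSum
  have h2 : Filter.Tendsto (fun s : Finset ι => (∑ i ∈ s, u i * v i) ^ 2) Filter.atTop
      (nhds ((∑' i, u i * v i) ^ 2)) := Filter.Tendsto.pow h1 2
  refine le_of_tendsto h2 (Filter.Eventually.of_forall fun s => ?_)
  refine (Finset.sum_mul_sq_le_sq_mul_sq s u v).trans ?_
  exact mul_le_mul (hu.sum_le_tsum s fun i _ => sq_nonneg _) (hv.sum_le_tsum s fun i _ => sq_nonneg _)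
    (Finset.sum_nonneg fun i _ => sq_nonneg _) (tsum_nonneg fun i => sq_nonneg _)

lemma starAbs_sub_rpow_mul_le {s : ℝ} (hs : 0 ≤ s) (h l : ℤ) :
    ((max |h - l| 1 : ℤ) : ℝ) ^ (-s) * ((max |l| 1 : ℤ) : ℝ) ^ (-s) ≤
      (2 : ℝ) ^ s * ((max |h| 1 : ℤ) : ℝ) ^ (-s) *
        (((max |h - l| 1 : ℤ) : ℝ) ^ (-s) + ((max |l| 1 : ℤ) : ℝ) ^ (-s)) := by
  have key : ∀ a b c : ℤ, max |c| 1 ≤ 2 * max |b| 1 →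
      ((max |b| 1 : ℤ) : ℝ) ^ (-s) ≤ (2 : ℝ) ^ s * ((max |c| 1 : ℤ) : ℝ) ^ (-s) := by
    intro a b c hbc
    have hb := zero_lt_one.trans_le (one_le_starAbs b)
    have hc := zero_lt_one.trans_le (one_le_starAbs c)
    have hbc' : ((max |c| 1 : ℤ) : ℝ) ≤ 2 * ((max |b| 1 : ℤ) : ℝ) := by exact_mod_cast hbc
    rw [Real.rpow_neg hb.le, Real.rpow_neg hc.le, ← div_eq_mul_inv, inv_eq_one_div,
      div_le_div_iff₀ (by positivity) (by positivity), one_mul, ← Real.mul_rpow (by norm_num) hb.le]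
    exact Real.rpow_le_rpow hc.le hbc' hs
  have h1 := Real.rpow_pos_of_pos (zero_lt_one.trans_le (one_le_starAbs (h - l))) (-s)
  have h2 := Real.rpow_pos_of_pos (zero_lt_one.trans_le (one_le_starAbs l)) (-s)
  have h3 := Real.rpow_pos_of_pos (zero_lt_one.trans_le (one_le_starAbs h)) (-s)
  have h4 : (0 : ℝ) < 2 ^ s := by positivity
  rw [mul_add]
  -- The larger of `|h - l|` and `|l|` is at least `|h| / 2`, so its factor is the one replaced.
  rcases le_total |l| |h - l| with hl | hl
  · have := key 0 (h - l) h (by grind)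
    nlinarith [mul_pos (mul_pos h4 h3) h1]
  · have := key 0 l h (by grind)
    nlinarith [mul_pos (mul_pos h4 h3) h2]

/-- This inequality is what makes the class an algebra. It factors over coordinates; in one
variable, one of the two weights is at most `2^s` times the weight of `h`, and the other is summable
because `s > 1`. -/
lemma exists_mixedWeight_convolution_le (d : ℕ) {s : ℝ} (hs : 1 < s) :
    ∃ C : ℝ, 0 < C ∧ ∀ h : Fin d → ℤ,
      Summable (fun l => mixedWeight (-s) (h - l) * mixedWeight (-s) l) ∧
        ∑' l, mixedWeight (-s) (h - l) * mixedWeight (-s) l ≤ C * mixedWeight (-s) h := by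
  set S := ∑' l : ℤ, ENNReal.ofReal (((max |l| 1 : ℤ) : ℝ) ^ (-s)) with hS
  have hStop : S ≠ ⊤ := (summable_starAbs_rpow hs).tsum_ofReal_ne_top
  set D := ENNReal.ofReal (2 ^ s) * (2 * S) with hD
  have hDtop : D ≠ ⊤ := by finiteness
  have hpos : ∀ k : ℤ, 0 ≤ ((max |k| 1 : ℤ) : ℝ) ^ (-s) := fun k =>
    (Real.rpow_pos_of_pos (zero_lt_one.trans_le (one_le_starAbs _)) _).le
  have h1 : ∀ h : ℤ, ∑' l : ℤ, ENNReal.ofReal (((max |h - l| 1 : ℤ) : ℝ) ^ (-s) *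
      ((max |l| 1 : ℤ) : ℝ) ^ (-s)) ≤ D * ENNReal.ofReal (((max |h| 1 : ℤ) : ℝ) ^ (-s)) := by
    intro h
    calc _ ≤ ∑' l : ℤ, ENNReal.ofReal ((2 : ℝ) ^ s * ((max |h| 1 : ℤ) : ℝ) ^ (-s)) *
          (ENNReal.ofReal (((max |h - l| 1 : ℤ) : ℝ) ^ (-s)) +
            ENNReal.ofReal (((max |l| 1 : ℤ) : ℝ) ^ (-s))) := by
          refine ENNReal.tsum_le_tsum fun l => ?_
          rw [← ENNReal.ofReal_add (hpos _) (hpos _), ← ENNReal.ofReal_mul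
            (mul_nonneg (by positivity) (hpos _))]
          exact ENNReal.ofReal_le_ofReal (starAbs_sub_rpow_mul_le (by linarith) h l)
      _ = _ := by
          rw [ENNReal.tsum_mul_left, ENNReal.tsum_add,
            show ∑' l : ℤ, ENNReal.ofReal (((max |h - l| 1 : ℤ) : ℝ) ^ (-s)) = S from
              (Equiv.subLeft h).tsum_eq fun l : ℤ => ENNReal.ofReal (((max |l| 1 : ℤ) : ℝ) ^ (-s)),
            ← hS, ENNReal.ofReal_mul (by positivity), hD]
          ring
  have h2 : ∀ h : Fin d → ℤ, ∑' l, ENNReal.ofReal (mixedWeight (-s) (h - l) * mixedWeight (-s) l) ≤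
      D ^ d * ENNReal.ofReal (mixedWeight (-s) h) := by
    intro h
    have h3 : ∀ l : Fin d → ℤ, ENNReal.ofReal (mixedWeight (-s) (h - l) * mixedWeight (-s) l) =
        ∏ j, ENNReal.ofReal (((max |h j - l j| 1 : ℤ) : ℝ) ^ (-s) *
          ((max |l j| 1 : ℤ) : ℝ) ^ (-s)) := fun l => by
      rw [← ENNReal.ofReal_prod_of_nonneg fun j _ => mul_nonneg (hpos _) (hpos _),
        Finset.prod_mul_distrib]
      rfl
    simp_rw [h3]
    rw [tsum_pi_prod fun (j : Fin d) (a : ℤ) => ENNReal.ofReal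
      (((max |h j - a| 1 : ℤ) : ℝ) ^ (-s) * ((max |a| 1 : ℤ) : ℝ) ^ (-s)), ofReal_mixedWeight]
    calc _ ≤ ∏ j, (D * ENNReal.ofReal (((max |h j| 1 : ℤ) : ℝ) ^ (-s))) :=
          Finset.prod_le_prod' fun j _ => h1 (h j)
      _ = _ := by rw [Finset.prod_mul_distrib]; simp
  refine ⟨(D ^ d).toReal + 1, by positivity, fun h => ?_⟩
  have hnn : ∀ l, 0 ≤ mixedWeight (-s) (h - l) * mixedWeight (-s) l := fun l =>
    (mul_pos (mixedWeight_pos _ _) (mixedWeight_pos _ _)).le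
  have htop : D ^ d * ENNReal.ofReal (mixedWeight (-s) h) ≠ ⊤ := by finiteness
  have hne := ne_top_of_le_ne_top htop (h2 h)
  have hsum : Summable fun l => mixedWeight (-s) (h - l) * mixedWeight (-s) l := by
    have := ENNReal.summable_toReal hne
    simpa [ENNReal.toReal_ofReal (hnn _)] using this
  refine ⟨hsum, ?_⟩
  have h4 := ENNReal.toReal_mono htop (h2 h)
  rw [← ENNReal.ofReal_tsum_of_nonneg hnn hsum, ENNReal.toReal_ofReal (tsum_nonneg hnn),
    ENNReal.toReal_mul, ENNReal.toReal_ofReal (mixedWeight_pos _ _).le] at h4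
  exact h4.trans (mul_le_mul_of_nonneg_right (by linarith) (mixedWeight_pos _ _).le)

/-- The bijection `(h, l) ↦ (h - l, l)`. -/
def shearEquiv (G : Type*) [AddGroup G] : G × G ≃ G × G where
  toFun p := (p.1 - p.2, p.2)
  invFun p := (p.1 + p.2, p.2)
  left_inv p := by simp
  right_inv p := by simp

lemma summable_shear {G E : Type*} [AddGroup G] [AddCommGroup E] [TopologicalSpace E]
    {f : G → G → E} (hf : Summable fun p : G × G => f p.1 p.2) :
    Summable fun p : G × G => f (p.1 - p.2) p.2 :=
  (shearEquiv G).summable_iff.mpr hf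

lemma hasSum_shear {G E : Type*} [AddGroup G] [AddCommGroup E] [TopologicalSpace E]
    {f : G → G → E} {s : E} (hf : HasSum (fun p : G × G => f p.1 p.2) s) :
    HasSum (fun p : G × G => f (p.1 - p.2) p.2) s :=
  (shearEquiv G).hasSum_iff.mpr hf

lemma summable_norm_mixedSeries {d : ℕ} {r : ℝ} (hr : 1 / 2 < r) {c : (Fin d → ℤ) → ℂ}
    (hc : Summable fun k => ‖c k‖ ^ 2) :
    Summable fun k => ‖c k * (mixedWeight (-r) k : ℂ)‖ := by
  simp_rw [norm_mul]
  exact summable_mul_of_sq hc (summable_kernel_sq hr)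

/-- The coefficients of the product are a convolution. Cauchy–Schwarz separates `α`, `β` from the
weights, and the convolution inequality at exponent `2r` bounds the weights by `w(h)^{-2r}`. The
radii are squared norms, so they multiply. -/
lemma exists_hasMixedSeries_mul (d : ℕ) {r : ℝ} (hr : 1 / 2 < r) :
    ∃ C : ℝ, 0 < C ∧ ∀ (A B : ℝ) (f g : (Fin d → ℝ) → ℂ), HasMixedSeries r A f →
      HasMixedSeries r B g → HasMixedSeries r (C * (A * B)) fun x => f x * g x := by
  obtain ⟨C, hC, hconv⟩ := exists_mixedWeight_convolution_le d (s := 2 * r) (by linarith)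
  refine ⟨C, hC, ?_⟩
  rintro A B f g ⟨α, hα, hαA, hf⟩ ⟨β, hβ, hβB, hg⟩
  set a : (Fin d → ℤ) → ℂ := fun k => α k * (mixedWeight (-r) k : ℂ) with ha
  set b : (Fin d → ℤ) → ℂ := fun k => β k * (mixedWeight (-r) k : ℂ) with hb
  have hasum : Summable fun k => ‖a k‖ := summable_norm_mixedSeries hr hα
  have hbsum : Summable fun k => ‖b k‖ := summable_norm_mixedSeries hr hβ
  have hpair : Summable fun p : (Fin d → ℤ) × (Fin d → ℤ) => a (p.1 - p.2) * b p.2 := by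
    have := (summable_mul_of_summable_norm hasum hbsum)
    exact summable_shear (f := fun k l => a k * b l) this
  have hsq₀ : Summable fun p : (Fin d → ℤ) × (Fin d → ℤ) => ‖α p.1‖ ^ 2 * ‖β p.2‖ ^ 2 :=
    Summable.mul_of_nonneg (f := fun k => ‖α k‖ ^ 2) (g := fun k => ‖β k‖ ^ 2) hα hβ
      (fun _ => sq_nonneg _) (fun _ => sq_nonneg _)
  have hsq : Summable fun p : (Fin d → ℤ) × (Fin d → ℤ) => ‖α (p.1 - p.2)‖ ^ 2 * ‖β p.2‖ ^ 2 := by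
    exact summable_shear (f := fun k l => ‖α k‖ ^ 2 * ‖β l‖ ^ 2) hsq₀
  have hsqsum : ∑' p : (Fin d → ℤ) × (Fin d → ℤ), ‖α (p.1 - p.2)‖ ^ 2 * ‖β p.2‖ ^ 2 =
      (∑' k, ‖α k‖ ^ 2) * ∑' k, ‖β k‖ ^ 2 := by
    rw [hα.tsum_mul_tsum hβ hsq₀]
    exact (hasSum_shear (f := fun k l => ‖α k‖ ^ 2 * ‖β l‖ ^ 2) hsq₀.hasSum).tsum_eq
  -- The `h`-th Fourier coefficient of the product, divided by `w(h)^{-r}`.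
  set γ : (Fin d → ℤ) → ℂ := fun h => (mixedWeight r h : ℂ) * ∑' l, a (h - l) * b l with hγ
  have hγle : ∀ h, ‖γ h‖ ^ 2 ≤ C * ∑' l, ‖α (h - l)‖ ^ 2 * ‖β l‖ ^ 2 := by
    intro h
    have hu : Summable fun l => (‖α (h - l)‖ * ‖β l‖) ^ 2 := by
      simpa only [mul_pow] using hsq.prod_factor h
    have hv : Summable fun l => (mixedWeight (-r) (h - l) * mixedWeight (-r) l) ^ 2 := by
      refine (hconv h).1.congr fun l => ?_
      rw [mul_pow, mixedWeight_sq, mixedWeight_sq, mul_neg]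
    have h1 : ‖∑' l, a (h - l) * b l‖ ≤ ∑' l, ‖α (h - l)‖ * ‖β l‖ *
        (mixedWeight (-r) (h - l) * mixedWeight (-r) l) := by
      refine (norm_tsum_le_tsum_norm (hpair.norm.prod_factor h)).trans_eq (tsum_congr fun l => ?_)
      simp only [ha, hb, norm_mul, Complex.norm_real,
        Real.norm_of_nonneg (mixedWeight_pos _ _).le]
      ring
    have h2 := sq_tsum_mul_le hu hv
    have h3 : ∑' l, (mixedWeight (-r) (h - l) * mixedWeight (-r) l) ^ 2 ≤
        C * mixedWeight (-(2 * r)) h := by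
      refine le_of_eq_of_le (tsum_congr fun l => ?_) (hconv h).2
      rw [mul_pow, mixedWeight_sq, mixedWeight_sq, mul_neg]
    rw [hγ, norm_mul, mul_pow, Complex.norm_real, Real.norm_of_nonneg (mixedWeight_pos _ _).le]
    calc _ ≤ mixedWeight r h ^ 2 * ((∑' l, (‖α (h - l)‖ * ‖β l‖) ^ 2) *
          (C * mixedWeight (-(2 * r)) h)) := by
          refine mul_le_mul_of_nonneg_left ?_ (sq_nonneg _)
          refine (pow_le_pow_left₀ (norm_nonneg _) h1 2).trans (h2.trans ?_)
          exact mul_le_mul_of_nonneg_left h3 (tsum_nonneg fun _ => sq_nonneg _)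
      _ = (mixedWeight (2 * r) h * mixedWeight (-(2 * r)) h) *
          (C * ∑' l, (‖α (h - l)‖ * ‖β l‖) ^ 2) := by rw [mixedWeight_sq]; ring
      _ = _ := by
          rw [mixedWeight_neg, mul_inv_cancel₀ (mixedWeight_pos _ _).ne', one_mul]
          simp only [mul_pow]
  have hmaj : Summable fun h => C * ∑' l, ‖α (h - l)‖ ^ 2 * ‖β l‖ ^ 2 := hsq.prod.mul_left C
  have hγsum : Summable fun h => ‖γ h‖ ^ 2 :=
    Summable.of_nonneg_of_le (fun _ => sq_nonneg _) hγle hmaj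
  refine ⟨γ, hγsum, ?_, fun x => ?_⟩
  · calc _ ≤ ∑' h, C * ∑' l, ‖α (h - l)‖ ^ 2 * ‖β l‖ ^ 2 := hγsum.tsum_le_tsum hγle hmaj
      _ = C * ((∑' k, ‖α k‖ ^ 2) * ∑' k, ‖β k‖ ^ 2) := by
          rw [tsum_mul_left, ← hsq.tsum_prod, hsqsum]
      _ ≤ _ := by
          refine mul_le_mul_of_nonneg_left ?_ hC.le
          exact mul_le_mul hαA hβB (tsum_nonneg fun _ => sq_nonneg _)
            ((tsum_nonneg fun _ => sq_nonneg _).trans hαA)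
  · have h1 : Summable fun p : (Fin d → ℤ) × (Fin d → ℤ) =>
        (a p.1 * character p.1 x) * (b p.2 * character p.2 x) := by
      refine summable_mul_of_summable_norm (f := fun k => a k * character k x)
        (g := fun k => b k * character k x) ?_ ?_
      · simpa only [norm_mul, norm_character, mul_one] using hasum
      · simpa only [norm_mul, norm_character, mul_one] using hbsum
    have h2 := (hf x).mul (hg x) h1
    have h3 := hasSum_shear (f := fun k l =>
      (α k * (mixedWeight (-r) k : ℂ) * character k x) *
        (β l * (mixedWeight (-r) l : ℂ) * character l x)) h2
    have h4 : HasSum (fun p : (Fin d → ℤ) × (Fin d → ℤ) =>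
        a (p.1 - p.2) * b p.2 * character p.1 x) (f x * g x) := by
      refine h3.congr_fun fun p => ?_
      have : character p.1 x = character (p.1 - p.2) x * character p.2 x := by
        rw [← character_add, sub_add_cancel]
      simp only [this, ha, hb]
      ring
    have h5 := h4.prod_fiberwise fun h => ((hpair.prod_factor h).hasSum.mul_right (character h x))
    refine h5.congr_fun fun h => ?_
    simp only [hγ]
    have : (mixedWeight r h : ℂ) * (mixedWeight (-r) h : ℂ) = 1 := by
      rw [← Complex.ofReal_mul, mixedWeight_neg, mul_inv_cancel₀ (mixedWeight_pos _ _).ne',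
        Complex.ofReal_one]
    linear_combination (∑' l, a (h - l) * b l) * character h x * this

lemma HasMixedSeries.conj {d : ℕ} {r R : ℝ} {f : (Fin d → ℝ) → ℂ} (hf : HasMixedSeries r R f) :
    HasMixedSeries r R fun x => (starRingEnd ℂ) (f x) := by
  obtain ⟨c, hc, hcR, hsum⟩ := hf
  refine ⟨fun k => (starRingEnd ℂ) (c (-k)), ?_, ?_, fun x => ?_⟩
  · simp only [RCLike.norm_conj]
    exact (Equiv.neg (Fin d → ℤ)).summable_iff.mpr hc
  · simp only [RCLike.norm_conj]
    exact ((Equiv.neg (Fin d → ℤ)).tsum_eq fun k => ‖c k‖ ^ 2).trans_le hcR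
  · have h := Complex.hasSum_conj'.mpr (hsum x)
    refine ((Equiv.neg (Fin d → ℤ)).hasSum_iff.mpr h).congr_fun fun k => ?_
    have hw : mixedWeight (-r) (-k) = mixedWeight (-r) k := by simp [mixedWeight]
    simp [character_neg, hw]

lemma hasMixedSeries_const {d : ℕ} (r : ℝ) (a : ℂ) :
    HasMixedSeries r (‖a‖ ^ 2) fun _ : Fin d → ℝ => a := by
  refine ⟨Pi.single 0 a, ?_, ?_, fun x => ?_⟩
  · refine summable_of_ne_finset_zero (s := {0}) fun k hk => ?_
    rw [Pi.single_eq_of_ne (by simpa using hk)]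
    simp
  · rw [tsum_eq_single 0 fun k hk => by rw [Pi.single_eq_of_ne hk]; simp]
    simp
  · have := hasSum_single (f := fun k => (Pi.single 0 a : (Fin d → ℤ) → ℂ) k *
      (mixedWeight (-r) k : ℂ) * character k x) 0 fun k hk => by rw [Pi.single_eq_of_ne hk]; simp
    simpa [mixedWeight_zero, character_zero] using this

/-- This is where the evenness of `q` enters: `|f|^{2n}` is a polynomial in `f` and its conjugate,
and the class is closed under conjugation and, up to constants, products. -/
lemma exists_hasMixedSeries_norm_pow (d : ℕ) {r : ℝ} (hr : 1 / 2 < r) (n : ℕ) :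
    ∃ C : ℝ, 0 < C ∧ ∀ f : (Fin d → ℝ) → ℂ, HasMixedSeries r 1 f →
      HasMixedSeries r C fun x => ((‖f x‖ ^ (2 * n) : ℝ) : ℂ) := by
  obtain ⟨C, hC, hmul⟩ := exists_hasMixedSeries_mul d hr
  induction n with
  | zero => exact ⟨1, one_pos, fun f _ => by simpa using hasMixedSeries_const (d := d) r 1⟩
  | succ n ih =>
    obtain ⟨D, hD, h⟩ := ih
    refine ⟨C * (D * (C * (1 * 1))), by positivity, fun f hf => ?_⟩
    have := hmul _ _ _ _ (h f hf) (hmul _ _ _ _ hf hf.conj)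
    convert! this using 2 with x
    rw [Complex.mul_conj, ← Complex.ofReal_mul, Complex.normSq_eq_norm_sq]
    congr 1
    ring

lemma integral_character {d : ℕ} (k : Fin d → ℤ) :
    ∫ x, character k x ∂(cubeMeasure d) = if k = 0 then 1 else 0 := by
  rw [integral_cube_eq]
  simp only [← mFourier_toTorus, toTorus_fromTorus]
  have h := (orthonormal_iff_ite.mp (UnitAddTorus.orthonormal_mFourier (d := Fin d))) 0 k
  simp only [ContinuousMap.inner_toLp, UnitAddTorus.mFourier_zero] at h
  simpa [eq_comm] using h

lemma hasSum_integral_mixedSeries {d : ℕ} {a : (Fin d → ℤ) → ℂ} (ha : Summable fun k => ‖a k‖)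
    {f : (Fin d → ℝ) → ℂ} (hf : ∀ x, HasSum (fun k => a k * character k x) (f x)) :
    ∫ x, f x ∂(cubeMeasure d) = a 0 := by
  have h := hasSum_integral_of_summable_integral_norm (μ := cubeMeasure d)
    (F := fun k x => a k * character k x) (fun k => ?_) ?_
  · simp_rw [integral_const_mul, integral_character] at h
    have h1 := h.unique (hasSum_single 0 fun k hk => by simp [hk])
    simp only [if_true, mul_one] at h1
    rw [← h1]
    exact integral_congr_ae (Filter.Eventually.of_forall fun x => (hf x).tsum_eq.symm)
  · refine Integrable.const_mul ?_ _
    exact Integrable.of_bound (continuous_character k).aestronglyMeasurable 1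
      (Filter.Eventually.of_forall fun x => (norm_character k x).le)
  · simpa [norm_mul, norm_character] using ha

/-! ### Nonnegative trigonometric polynomials vanishing at given points -/

/-- The rows of `B` are the conjugates of an orthonormal basis of the orthogonal complement of the
span of the `u j`, so that `B v` lists the inner products of `v` with that basis. -/
lemma exists_coisometry_annihilating {κ : Type*} [Fintype κ] [DecidableEq κ] {m : ℕ}
    (u : Fin m → κ → ℂ) : ∃ (D : ℕ) (B : Matrix (Fin D) κ ℂ), Fintype.card κ ≤ D + m ∧
      B * B.conjTranspose = 1 ∧ ∀ j, B.mulVec (u j) = 0 := by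
  let U : Submodule ℂ (EuclideanSpace ℂ κ) :=
    Submodule.span ℂ (Set.range fun j => WithLp.toLp 2 (u j))
  let c := stdOrthonormalBasis ℂ Uᗮ
  refine ⟨Module.finrank ℂ Uᗮ,
    Matrix.of fun i l => (starRingEnd ℂ) ((c i : EuclideanSpace ℂ κ) l), ?_, ?_, ?_⟩
  · have h1 := U.finrank_add_finrank_orthogonal
    have h2 : Module.finrank ℂ U ≤ m := by
      have := finrank_range_le_card (R := ℂ) fun j => WithLp.toLp 2 (u j)
      rwa [Fintype.card_fin] at this
    rw [finrank_euclideanSpace] at h1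
    omega
  · ext i i'
    have h := orthonormal_iff_ite.mp c.orthonormal i i'
    rw [Submodule.coe_inner, PiLp.inner_apply] at h
    simp only [RCLike.inner_apply] at h
    rw [Matrix.mul_apply, Matrix.one_apply, ← h]
    refine Finset.sum_congr rfl fun l _ => ?_
    simp [Matrix.conjTranspose_apply, Matrix.of_apply, mul_comm]
  · intro j
    funext i
    have h := Submodule.inner_left_of_mem_orthogonal
      (Submodule.subset_span (Set.mem_range_self j) : WithLp.toLp 2 (u j) ∈ U) (c i).2
    rw [PiLp.inner_apply] at h
    simp only [RCLike.inner_apply] at h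
    simp only [Matrix.mulVec, dotProduct, Matrix.of_apply, Pi.zero_apply]
    rw [← h]
    exact Finset.sum_congr rfl fun l _ => mul_comm _ _

/-- `B* B` is an orthogonal projection of rank `D`; its squared Hilbert–Schmidt norm is its trace.
-/
lemma sum_sq_norm_conjTranspose_mul_self {κ : Type*} [Fintype κ] {D : ℕ}
    {B : Matrix (Fin D) κ ℂ} (hB : B * B.conjTranspose = 1) :
    ∑ p : κ × κ, ‖(B.conjTranspose * B) p.1 p.2‖ ^ 2 = D := by
  have h : Matrix.trace ((B.conjTranspose * B) * (B.conjTranspose * B).conjTranspose) = D := by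
    rw [Matrix.conjTranspose_mul, Matrix.conjTranspose_conjTranspose, ← Matrix.mul_assoc,
      Matrix.mul_assoc B.conjTranspose B, hB, Matrix.mul_one, Matrix.trace_mul_comm, hB]
    simp
  have h2 : Matrix.trace ((B.conjTranspose * B) * (B.conjTranspose * B).conjTranspose) =
      ((∑ p : κ × κ, ‖(B.conjTranspose * B) p.1 p.2‖ ^ 2 : ℝ) : ℂ) := by
    rw [Matrix.trace, Fintype.sum_prod_type]
    push_cast
    refine Finset.sum_congr rfl fun k _ => ?_
    rw [Matrix.diag_apply, Matrix.mul_apply]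
    refine Finset.sum_congr rfl fun l _ => ?_
    rw [Matrix.conjTranspose_apply]
    exact Complex.mul_conj' _
  rw [h2] at h
  exact_mod_cast h

/-- Take `G = ‖B u(x)‖² / Q`, where `u(x)` lists `Q = 2^{∑ s_j}` characters and `B` annihilates
every `u(ξ_j)`. The mean is `tr (B* B) / Q = D / Q`, and `D ≥ Q - m ≥ Q / 2`. The frequencies of `G`
are differences of frequencies in the box. -/
lemma exists_nonneg_trigPolynomial {d m : ℕ} (ξ : Fin m → Fin d → ℝ) (s : Fin d → ℕ)
    (hs : 2 * m ≤ 2 ^ ∑ j, s j) :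
    ∃ (G : (Fin d → ℝ) → ℝ) (γ : (Fin d → ℤ) → ℂ) (a : ℝ),
      Continuous G ∧ (∀ x, 0 ≤ G x) ∧ (∀ j, G (ξ j) = 0) ∧ γ 0 = a ∧ 1 / 2 ≤ a ∧
      γ.support.Finite ∧ (∀ h, γ h ≠ 0 → ∀ j, max |h j| 1 ≤ 2 ^ s j) ∧
      (∑' h, ‖γ h‖ ^ 2 ≤ 1) ∧
      ∀ x, HasSum (fun h => γ h * character h x) (G x : ℂ) := by
  classical
  let κ := (j : Fin d) → Fin (2 ^ s j)
  let freq : κ → Fin d → ℤ := fun k j => (k j : ℕ)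
  have hfreq : Function.Injective freq := fun k l h => by
    funext j
    have := congrFun h j
    simp only [freq, Nat.cast_inj] at this
    exact Fin.ext this
  have hcard : Fintype.card κ = 2 ^ ∑ j, s j := by
    simp [κ, Finset.prod_pow_eq_pow_sum]
  have hcpos : 0 < Fintype.card κ := by rw [hcard]; positivity
  -- With the minus sign, `conj (u_k) * u_l` is the character of frequency `freq k - freq l`.
  let u : (Fin d → ℝ) → κ → ℂ := fun x k => character (-freq k) x
  obtain ⟨D, B, hD, hB, hBu⟩ := exists_coisometry_annihilating fun j => u (ξ j)
  set M := B.conjTranspose * B with hM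
  set Q : ℝ := (Fintype.card κ : ℝ) with hQ
  have hQpos : 0 < Q := Nat.cast_pos.mpr hcpos
  let diff : κ × κ → Fin d → ℤ := fun p => freq p.1 - freq p.2
  let γ : (Fin d → ℤ) → ℂ := fun h => ∑ p, if diff p = h then M p.1 p.2 / Q else 0
  let G : (Fin d → ℝ) → ℝ := fun x => (∑ i, ‖B.mulVec (u x) i‖ ^ 2) / Q
  have hG : ∀ x, (G x : ℂ) = ∑ p, M p.1 p.2 / Q * character (diff p) x := fun x => by
    have h1 : ((∑ i, ‖B.mulVec (u x) i‖ ^ 2 : ℝ) : ℂ) =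
        ∑ p : κ × κ, M p.1 p.2 * character (diff p) x := by
      have h2 : ((∑ i, ‖B.mulVec (u x) i‖ ^ 2 : ℝ) : ℂ) =
          star (B.mulVec (u x)) ⬝ᵥ B.mulVec (u x) := by
        push_cast
        refine Finset.sum_congr rfl fun i _ => ?_
        exact (Complex.conj_mul' _).symm
      rw [h2, Matrix.star_mulVec, ← Matrix.dotProduct_mulVec, Matrix.mulVec_mulVec, ← hM,
        dotProduct, Fintype.sum_prod_type]
      refine Finset.sum_congr rfl fun k _ => ?_
      rw [Matrix.mulVec, dotProduct, Finset.mul_sum]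
      refine Finset.sum_congr rfl fun l _ => ?_
      have h3 : character (diff (k, l)) x = star (u x k) * u x l := by
        simp only [diff, u, sub_eq_add_neg, character_add]
        rw [character_neg (freq k)]
        simp
      rw [h3, Pi.star_apply]
      ring
    have h4 : (G x : ℂ) = ((∑ i, ‖B.mulVec (u x) i‖ ^ 2 : ℝ) : ℂ) / (Q : ℂ) := by
      simp [G]
    rw [h4, h1, Finset.sum_div]
    exact Finset.sum_congr rfl fun p _ => by ring
  have hdiff0 : ∀ p : κ × κ, diff p = 0 ↔ p.1 = p.2 := fun p => by
    simp only [diff, sub_eq_zero]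
    exact hfreq.eq_iff
  have hγne : ∀ h, γ h ≠ 0 → ∃ p, diff p = h := fun h hh => by
    by_contra! hcon
    exact hh (Finset.sum_eq_zero fun p _ => by simp [hcon p])
  have hDle : (Q : ℝ) / 2 ≤ D := by
    have h1 : Fintype.card κ ≤ 2 * D := by omega
    have h2 : Q ≤ 2 * D := by rw [hQ]; exact_mod_cast h1
    linarith
  have hfin : γ.support ⊆ (Finset.univ.image diff : Finset (Fin d → ℤ)) := fun h hh => by
    obtain ⟨p, hp⟩ := hγne h hh
    simp [← hp]
  refine ⟨G, γ, D / Q, ?_, fun x => by positivity, fun j => ?_, ?_, ?_, ?_, ?_, ?_, fun x => ?_⟩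
  · refine Continuous.div_const (continuous_finsetSum _ fun i _ => Continuous.pow ?_ 2) _
    refine Continuous.norm ?_
    unfold Matrix.mulVec dotProduct
    exact continuous_finsetSum _ fun k _ => continuous_const.mul (continuous_character _)
  · simp [G, hBu]
  · have h1 : ∑ k, M k k = D := by
      have : Matrix.trace M = D := by
        rw [hM, Matrix.trace_mul_comm, hB]
        simp
      simpa [Matrix.trace] using this
    have h2 : γ 0 = ∑ p : κ × κ, if p.1 = p.2 then M p.1 p.2 / (Q : ℂ) else 0 :=
      Finset.sum_congr rfl fun p _ => if_congr (hdiff0 p) rfl rfl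
    have h3 : γ 0 = ∑ k, M k k / (Q : ℂ) := by
      rw [h2, Fintype.sum_prod_type]
      exact Finset.sum_congr rfl fun k _ =>
        (Finset.sum_eq_single k (fun l _ hl => if_neg hl.symm)
          fun hk => absurd (Finset.mem_univ k) hk).trans (if_pos rfl)
    rw [h3, ← Finset.sum_div, h1]
    simp
  · rw [le_div_iff₀ hQpos]
    linarith
  · exact (Finset.finite_toSet _).subset hfin
  · intro h hh j
    obtain ⟨p, rfl⟩ := hγne h hh
    have h1 := (p.1 j).isLt
    have h2 := (p.2 j).isLt
    have h3 : (1 : ℤ) ≤ 2 ^ s j := one_le_pow₀ (by norm_num)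
    refine max_le ?_ h3
    simp only [diff, freq, Pi.sub_apply]
    zify at h1 h2
    rw [abs_le]
    omega
  · rw [tsum_eq_sum (s := Finset.univ.image diff) fun h hh => by
      have : γ h = 0 := by
        by_contra hne
        exact hh (hfin hne)
      simp [this]]
    -- Given the difference `h`, the first entry of a pair determines the second, so a fibre has at
    -- most `Q` elements; Cauchy–Schwarz on it costs a factor `Q`. The total is then `Q * D / Q² = D
    -- / Q ≤ 1`.
    have h1 : ∀ h ∈ Finset.univ.image diff, ‖γ h‖ ^ 2 ≤
        Q * ∑ p ∈ Finset.univ.filter (fun p => diff p = h), ‖M p.1 p.2 / Q‖ ^ 2 := by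
      intro h _
      simp only [γ]
      rw [← Finset.sum_filter]
      refine (pow_le_pow_left₀ (norm_nonneg _) (norm_sum_le _ _) 2).trans ?_
      refine sq_sum_le_card_mul_sum_sq.trans ?_
      refine mul_le_mul_of_nonneg_right ?_ (Finset.sum_nonneg fun _ _ => by positivity)
      rw [hQ, Nat.cast_le]
      refine Finset.card_le_card_of_injOn (t := Finset.univ) Prod.fst (fun _ _ => Finset.mem_univ _) ?_
      intro p hp q hq hpq
      simp only [Finset.coe_filter, Finset.mem_univ, true_and, Set.mem_ofPred_eq] at hp hq
      refine Prod.ext hpq (hfreq ?_)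
      have h5 := hp.trans hq.symm
      simp only [diff] at h5
      rw [show p.1 = q.1 from hpq] at h5
      exact sub_right_injective h5
    refine (Finset.sum_le_sum h1).trans ?_
    rw [← Finset.mul_sum, Finset.sum_fiberwise_of_maps_to (fun p _ => Finset.mem_image_of_mem _
      (Finset.mem_univ p))]
    simp only [norm_div, div_pow]
    rw [← Finset.sum_div, sum_sq_norm_conjTranspose_mul_self hB, Complex.norm_real,
      Real.norm_of_nonneg hQpos.le]
    have h6 : (D : ℝ) ≤ Q := by
      have h7 : Matrix.rank (1 : Matrix (Fin D) (Fin D) ℂ) ≤ B.rank := by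
        rw [← hB]; exact Matrix.rank_mul_le_left _ _
      rw [Matrix.rank_one, Fintype.card_fin] at h7
      have h8 := h7.trans (Matrix.rank_le_card_width B)
      rw [hQ]
      exact_mod_cast h8
    rw [show Q * (D / Q ^ 2) = D / Q by field_simp]
    exact (div_le_one hQpos).mpr h6
  · rw [hG]
    have h1 : ∀ p : κ × κ, HasSum (fun h => if diff p = h then M p.1 p.2 / Q * character h x else 0)
        (M p.1 p.2 / Q * character (diff p) x) := fun p => by
      have := hasSum_single (f := fun h => if diff p = h then M p.1 p.2 / Q * character h x else 0)
        (diff p) fun h hh => if_neg (Ne.symm hh)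
      simpa using this
    refine (hasSum_sum fun p (_ : p ∈ Finset.univ) => h1 p).congr_fun fun h => ?_
    rw [Finset.sum_mul]
    exact Finset.sum_congr rfl fun p _ => by split_ifs <;> simp

/-! ### The weighted count of the dyadic boxes containing a frequency -/

/-- A geometric series that starts at the first `a` with `c ≤ 2^a`, where the ratio `c / 2^a` is at
most one; hence the bound is uniform in `c`. -/
lemma exists_sum_rpow_dyadic_le {β : ℝ} (hβ : 0 < β) :
    ∃ K : ℝ≥0∞, K ≠ ⊤ ∧ ∀ c : ℝ, 1 ≤ c →
      ∑' a : ℕ, (if c ≤ 2 ^ a then ENNReal.ofReal ((c / 2 ^ a) ^ β) else 0) ≤ K := by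
  have hq : (2 : ℝ) ^ (-β) < 1 := Real.rpow_lt_one_of_one_lt_of_neg (by norm_num) (by linarith)
  have hq0 : (0 : ℝ) < 2 ^ (-β) := by positivity
  refine ⟨∑' i : ℕ, ENNReal.ofReal (((2 : ℝ) ^ (-β)) ^ i),
    (summable_geometric_of_lt_one hq0.le hq).tsum_ofReal_ne_top, fun c hc => ?_⟩
  have hex : ∃ a : ℕ, c ≤ 2 ^ a := pow_unbounded_of_one_lt c (by norm_num) |>.imp fun _ => le_of_lt
  classical
  set a₀ := Nat.find hex with ha₀
  have hinj : Function.Injective fun i : ℕ => a₀ + i := fun i j h => by simpa using h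
  rw [← hinj.tsum_eq (f := fun a : ℕ =>
    (if c ≤ 2 ^ a then ENNReal.ofReal ((c / 2 ^ a) ^ β) else 0))]
  · refine ENNReal.tsum_le_tsum fun i => ?_
    have h1 : c ≤ 2 ^ a₀ := Nat.find_spec hex
    have h2 : (2 : ℝ) ^ a₀ ≤ 2 ^ (a₀ + i) := pow_le_pow_right₀ (by norm_num) (Nat.le_add_right _ _)
    rw [if_pos (h1.trans h2)]
    refine ENNReal.ofReal_le_ofReal ?_
    have h3 : c / 2 ^ (a₀ + i) ≤ (2 ^ i)⁻¹ := by
      rw [pow_add, div_le_iff₀ (by positivity), mul_comm ((2 : ℝ) ^ a₀), inv_mul_cancel_left₀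
        (by positivity)]
      exact h1
    calc (c / 2 ^ (a₀ + i)) ^ β ≤ ((2 ^ i)⁻¹ : ℝ) ^ β :=
          Real.rpow_le_rpow (by positivity) h3 hβ.le
      _ = (2 ^ (-β)) ^ i := by
          rw [← Real.rpow_natCast 2 i, ← Real.rpow_neg (by norm_num), ← Real.rpow_mul (by norm_num),
            ← Real.rpow_natCast (2 ^ (-β)), ← Real.rpow_mul (by norm_num)]
          congr 1
          ring
  · intro a ha
    have h1 : c ≤ 2 ^ a := by
      by_contra hcon
      simp [hcon] at ha
    exact ⟨a - a₀, Nat.add_sub_cancel' (Nat.find_min' hex h1)⟩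

/-- Frequencies lying in many of the boxes have small weight. On `∑ s_j = N` the product `∏ (h_j^* /
2^{s_j})^β` equals `w(h)^β / 2^{Nβ}` for every `s`, so the count times this value is dominated by
the sum over all `s`, which factors into convergent one-variable series. -/
lemma exists_mixedWeight_mul_card_le (d : ℕ) {β : ℝ} (hβ : 0 < β) :
    ∃ C : ℝ, 0 < C ∧ ∀ (N : ℕ) (S : Finset (Fin d → ℕ)), (∀ s ∈ S, ∑ j, s j = N) →
      ∀ h : Fin d → ℤ, mixedWeight β h *
        ((S.filter fun s => ∀ j, max |h j| 1 ≤ 2 ^ s j).card : ℝ) ≤ C * (2 ^ N) ^ β := by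
  obtain ⟨K, hK, hle⟩ := exists_sum_rpow_dyadic_le hβ
  refine ⟨(K ^ d).toReal + 1, by positivity, fun N S hS h => ?_⟩
  set T := S.filter fun s => ∀ j, max |h j| 1 ≤ 2 ^ s j with hT
  have h1 : ∑ s ∈ T, ENNReal.ofReal (∏ j, (((max |h j| 1 : ℤ) : ℝ) / 2 ^ s j) ^ β) ≤ K ^ d := by
    calc _ ≤ ∑ s ∈ T, ∏ j, (if ((max |h j| 1 : ℤ) : ℝ) ≤ 2 ^ s j then
            ENNReal.ofReal ((((max |h j| 1 : ℤ) : ℝ) / 2 ^ s j) ^ β) else 0) := by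
          refine Finset.sum_le_sum fun s hs => ?_
          rw [ENNReal.ofReal_prod_of_nonneg fun j _ => Real.rpow_nonneg
            (div_nonneg (zero_le_one.trans (one_le_starAbs _)) (by positivity)) _]
          refine Finset.prod_le_prod' fun j _ => ?_
          have : ((max |h j| 1 : ℤ) : ℝ) ≤ 2 ^ s j := by
            exact_mod_cast (Finset.mem_filter.mp hs).2 j
          rw [if_pos this]
      _ ≤ ∑' s : Fin d → ℕ, ∏ j, (if ((max |h j| 1 : ℤ) : ℝ) ≤ 2 ^ s j then
            ENNReal.ofReal ((((max |h j| 1 : ℤ) : ℝ) / 2 ^ s j) ^ β) else 0) :=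
          ENNReal.sum_le_tsum T
      _ = ∏ j, ∑' a : ℕ, (if ((max |h j| 1 : ℤ) : ℝ) ≤ 2 ^ a then
            ENNReal.ofReal ((((max |h j| 1 : ℤ) : ℝ) / 2 ^ a) ^ β) else 0) :=
          tsum_pi_prod fun (j : Fin d) (a : ℕ) => (if ((max |h j| 1 : ℤ) : ℝ) ≤ 2 ^ a then
            ENNReal.ofReal ((((max |h j| 1 : ℤ) : ℝ) / 2 ^ a) ^ β) else 0)
      _ ≤ ∏ _j : Fin d, K := Finset.prod_le_prod' fun j _ => hle _ (one_le_starAbs _)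
      _ = K ^ d := by simp
  have h2 : ∀ s ∈ T, ∏ j, (((max |h j| 1 : ℤ) : ℝ) / 2 ^ s j) ^ β =
      mixedWeight β h / (2 ^ N) ^ β := by
    intro s hs
    have hN := hS s (Finset.mem_filter.mp hs).1
    simp_rw [Real.div_rpow (zero_le_one.trans (one_le_starAbs _))
      (pow_nonneg zero_le_two _), Finset.prod_div_distrib]
    rw [mixedWeight, Real.finsetProd_rpow _ (fun j => (2 : ℝ) ^ s j) fun j _ => by positivity,
      Finset.prod_pow_eq_pow_sum, hN]
  rw [Finset.sum_congr rfl fun s hs => by rw [h2 s hs], Finset.sum_const, nsmul_eq_mul] at h1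
  have h3 := ENNReal.toReal_mono (ENNReal.pow_ne_top hK) h1
  have h4 : (0 : ℝ) < (2 ^ N) ^ β := by positivity
  rw [ENNReal.toReal_mul, ENNReal.toReal_natCast, ENNReal.toReal_ofReal
    (div_nonneg (mixedWeight_pos _ _).le h4.le), mul_div_assoc', div_le_iff₀ h4] at h3
  rw [mul_comm]
  exact h3.trans (mul_le_mul_of_nonneg_right (by linarith) h4.le)

/-! ### The lower bound -/

lemma HasMixedSeries.add {d : ℕ} {r A B : ℝ} {f g : (Fin d → ℝ) → ℂ} (hf : HasMixedSeries r A f)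
    (hg : HasMixedSeries r B g) : HasMixedSeries r (2 * A + 2 * B) fun x => f x + g x := by
  obtain ⟨a, ha, haA, hfa⟩ := hf
  obtain ⟨b, hb, hbB, hgb⟩ := hg
  have hle : ∀ k, ‖a k + b k‖ ^ 2 ≤ 2 * ‖a k‖ ^ 2 + 2 * ‖b k‖ ^ 2 := fun k => by
    have h1 := pow_le_pow_left₀ (norm_nonneg _) (norm_add_le (a k) (b k)) 2
    nlinarith [sq_nonneg (‖a k‖ - ‖b k‖)]
  have hmaj := (ha.mul_left 2).add (hb.mul_left 2)
  have hsum := Summable.of_nonneg_of_le (fun k => sq_nonneg ‖a k + b k‖) hle hmaj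
  refine ⟨fun k => a k + b k, hsum, ?_, fun x => ?_⟩
  · refine (hsum.tsum_le_tsum hle hmaj).trans ?_
    rw [(ha.mul_left 2).tsum_add (hb.mul_left 2), tsum_mul_left, tsum_mul_left]
    linarith
  · refine ((hfa x).add (hgb x)).congr_fun fun k => ?_
    ring

lemma HasMixedSeries.mono {d : ℕ} {r A B : ℝ} {f : (Fin d → ℝ) → ℂ} (hf : HasMixedSeries r A f)
    (h : A ≤ B) : HasMixedSeries r B f := by
  obtain ⟨a, ha, haA, hfa⟩ := hf
  exact ⟨a, ha, haA.trans h, hfa⟩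

lemma HasMixedSeries.const_mul {d : ℕ} {r A : ℝ} {f : (Fin d → ℝ) → ℂ} (hf : HasMixedSeries r A f)
    (b : ℂ) : HasMixedSeries r (‖b‖ ^ 2 * A) fun x => b * f x := by
  obtain ⟨a, ha, haA, hfa⟩ := hf
  refine ⟨fun k => b * a k, ?_, ?_, fun x => ?_⟩
  · simpa only [norm_mul, mul_pow] using ha.mul_left _
  · simp only [norm_mul, mul_pow]
    rw [tsum_mul_left]
    exact mul_le_mul_of_nonneg_left haA (sq_nonneg _)
  · refine ((hfa x).mul_left b).congr_fun fun k => ?_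
    ring

lemma integrable_cube_of_continuous {d : ℕ} {E : Type*} [NormedAddCommGroup E]
    {f : (Fin d → ℝ) → E} (hf : Continuous f) : Integrable f (cubeMeasure d) := by
  refine Integrable.smul_measure ?_ ENNReal.ofReal_ne_top
  exact hf.continuousOn.integrableOn_compact isCompact_Icc

/-- A fooling function: nonnegative, zero at the given nodes, with a large mean, built from a
family of anisotropic trigonometric polynomials. -/
lemma exists_fooling_function (d : ℕ) {r : ℝ} (hr : 0 < r) :
    ∃ C : ℝ, 0 < C ∧ ∀ (m N : ℕ) (ξ : Fin m → Fin d → ℝ) (S : Finset (Fin d → ℕ)),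
      2 * m ≤ 2 ^ N → (∀ s ∈ S, ∑ j, s j = N) →
      ∃ g : (Fin d → ℝ) → ℝ, Continuous g ∧ (∀ x, 0 ≤ g x) ∧ (∀ j, g (ξ j) = 0) ∧
        (S.card : ℝ) / 2 ≤ ∫ x, g x ∂(cubeMeasure d) ∧
        HasMixedSeries r (C * (2 ^ N) ^ (2 * r) * S.card) fun x => (g x : ℂ) := by
  classical
  obtain ⟨C, hC, hcount⟩ := exists_mixedWeight_mul_card_le d (β := 2 * r) (by linarith)
  refine ⟨C, hC, fun m N ξ S hN hS => ?_⟩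
  have hex : ∀ s : S, _ := fun s => exists_nonneg_trigPolynomial ξ s.1 (by rw [hS s.1 s.2]; exact hN)
  choose G γ a hGc hG0 hGξ hγ0 ha hfin hsupp hsq hsum using hex
  let Γ : (Fin d → ℤ) → ℂ := fun h => ∑ s, γ s h
  let g : (Fin d → ℝ) → ℝ := fun x => ∑ s, G s x
  have hΓsum : ∀ x, HasSum (fun h => Γ h * character h x) (g x : ℂ) := fun x => by
    have h1 := hasSum_sum fun s (_ : s ∈ Finset.univ) => hsum s x
    have h2 : (g x : ℂ) = ∑ s, (G s x : ℂ) := by simp [g]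
    rw [h2]
    exact h1.congr_fun fun h => by rw [Finset.sum_mul]
  have hΓfin : Γ.support.Finite := by
    refine (Set.finite_iUnion hfin).subset fun h hh => ?_
    obtain ⟨s, -, hs⟩ := Finset.exists_ne_zero_of_sum_ne_zero hh
    exact Set.mem_iUnion.mpr ⟨s, hs⟩
  have hγsq : ∀ s, Summable fun h => ‖γ s h‖ ^ 2 := fun s =>
    summable_of_hasFiniteSupport ((hfin s).subset fun h hh => by
      contrapose! hh
      have h0 : γ s h = 0 := by simpa using hh
      simp [h0])
  have hgc : Continuous g := continuous_finsetSum _ fun s _ => hGc s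
  have hweight : ∀ h, ‖Γ h * (mixedWeight r h : ℂ)‖ ^ 2 ≤
      C * (2 ^ N) ^ (2 * r) * ∑ s, ‖γ s h‖ ^ 2 := by
    intro h
    -- Cauchy–Schwarz is applied only over the boxes that contain `h`. Their number times
    -- `w(h)^{2r}` is at most `C 2^{2rN}`, so the squared norm grows like `|S|` and not `|S|²`.
    let T := Finset.univ.filter fun s : S => γ s h ≠ 0
    have h1 : Γ h = ∑ s ∈ T, γ s h := (Finset.sum_filter_ne_zero _).symm
    have h2 : ‖Γ h‖ ^ 2 ≤ T.card * ∑ s, ‖γ s h‖ ^ 2 := by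
      rw [h1]
      refine (pow_le_pow_left₀ (norm_nonneg _) (norm_sum_le _ _) 2).trans ?_
      refine sq_sum_le_card_mul_sum_sq.trans (mul_le_mul_of_nonneg_left ?_ (Nat.cast_nonneg _))
      exact Finset.sum_le_univ_sum_of_nonneg fun s => sq_nonneg _
    have h3 : T.card ≤ (S.filter fun s => ∀ j, max |h j| 1 ≤ 2 ^ s j).card := by
      refine Finset.card_le_card_of_injOn Subtype.val (fun s hs => ?_) Subtype.val_injective.injOn
      simp only [T, Finset.coe_filter, Finset.mem_univ, true_and, Set.mem_ofPred_eq] at hs ⊢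
      exact ⟨s.2, hsupp s h hs⟩
    have h4 := hcount N S hS h
    have h5 : 0 ≤ ∑ s, ‖γ s h‖ ^ 2 := Finset.sum_nonneg fun s _ => sq_nonneg _
    have hw := mixedWeight_pos (2 * r) h
    rw [norm_mul, mul_pow, Complex.norm_real, Real.norm_of_nonneg (mixedWeight_pos _ _).le,
      mixedWeight_sq, mul_comm]
    calc _ ≤ mixedWeight (2 * r) h * (T.card * ∑ s, ‖γ s h‖ ^ 2) :=
          mul_le_mul_of_nonneg_left h2 hw.le
      _ = mixedWeight (2 * r) h * T.card * ∑ s, ‖γ s h‖ ^ 2 := by ring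
      _ ≤ _ := by
          refine mul_le_mul_of_nonneg_right (le_trans ?_ h4) h5
          exact mul_le_mul_of_nonneg_left (by exact_mod_cast h3) hw.le
  have hmaj : Summable fun h => C * (2 ^ N) ^ (2 * r) * ∑ s, ‖γ s h‖ ^ 2 :=
    (summable_sum fun s _ => hγsq s).mul_left _
  have hΓw : Summable fun h => ‖Γ h * (mixedWeight r h : ℂ)‖ ^ 2 :=
    Summable.of_nonneg_of_le (fun _ => sq_nonneg _) hweight hmaj
  refine ⟨g, hgc, fun x => Finset.sum_nonneg fun s _ => hG0 s x, fun j => ?_, ?_, ?_⟩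
  · exact Finset.sum_eq_zero fun s _ => hGξ s j
  · have h1 : Summable fun h => ‖Γ h‖ := summable_of_hasFiniteSupport (hΓfin.subset fun h hh => by
      simpa using hh)
    have h2 := hasSum_integral_mixedSeries h1 hΓsum
    have h3 : Γ 0 = ((∑ s, a s : ℝ) : ℂ) := by simp [Γ, hγ0]
    rw [h3, integral_complex_ofReal, Complex.ofReal_inj] at h2
    rw [h2]
    have h4 : ∑ _s : S, (1 / 2 : ℝ) ≤ ∑ s, a s := Finset.sum_le_sum fun s _ => ha s
    simpa [div_eq_mul_inv] using h4
  · refine ⟨fun h => Γ h * (mixedWeight r h : ℂ), hΓw, ?_, fun x => ?_⟩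
    · refine (hΓw.tsum_le_tsum hweight hmaj).trans ?_
      rw [tsum_mul_left, Summable.tsum_finsetSum fun s _ => hγsq s]
      refine mul_le_mul_of_nonneg_left ?_ (by positivity)
      calc _ ≤ ∑ _s : S, (1 : ℝ) := Finset.sum_le_sum fun s _ => hsq s
        _ = S.card := by simp
    · refine (hΓsum x).congr_fun fun h => ?_
      have : (mixedWeight r h : ℂ) * (mixedWeight (-r) h : ℂ) = 1 := by
        rw [← Complex.ofReal_mul, mixedWeight_neg, mul_inv_cancel₀ (mixedWeight_pos _ _).ne',
          Complex.ofReal_one]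
      rw [mul_assoc (Γ h), this, mul_one]

/-- The last `e` entries range freely over `[0, N / (e + 1)]`, and the first one makes up the sum
`N`. -/
lemma exists_dyadic_indices (e N : ℕ) : ∃ S : Finset (Fin (e + 1) → ℕ),
    (∀ s ∈ S, ∑ j, s j = N) ∧ (N / (e + 1 : ℝ)) ^ e ≤ S.card := by
  classical
  set Q := N / (e + 1) with hQ
  let φ : (Fin e → Fin (Q + 1)) → Fin (e + 1) → ℕ := fun t =>
    Fin.cons (N - ∑ j, (t j : ℕ)) fun j => t j
  have hφ : Function.Injective φ := fun t t' h => by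
    funext j
    have := congrFun h j.succ
    simp only [φ, Fin.cons_succ] at this
    exact Fin.ext this
  refine ⟨Finset.univ.image φ, fun s hs => ?_, ?_⟩
  · obtain ⟨t, -, rfl⟩ := Finset.mem_image.mp hs
    have h1 : ∑ j, (t j : ℕ) ≤ N := by
      calc ∑ j, (t j : ℕ) ≤ ∑ _j : Fin e, Q := Finset.sum_le_sum fun j _ => Nat.lt_succ_iff.mp (t j).2
        _ = e * Q := by simp
        _ ≤ (e + 1) * Q := Nat.mul_le_mul_right _ (Nat.le_succ _)
        _ ≤ N := Nat.mul_div_le _ _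
    simp only [φ, Fin.sum_univ_succ, Fin.cons_zero, Fin.cons_succ]
    omega
  · rw [Finset.card_image_of_injective _ hφ]
    simp only [Finset.card_univ, Fintype.card_fun, Fintype.card_fin]
    push_cast
    refine pow_le_pow_left₀ (by positivity) ?_ e
    rw [div_le_iff₀ (by positivity)]
    have h1 : N < (Q + 1) * (e + 1) := by
      rw [hQ, mul_comm]
      exact Nat.lt_mul_div_succ N (Nat.succ_pos e)
    exact_mod_cast h1.le

/-- The `q`-th power of `g` alone would be of order `q` in `g`; adding the constant `1/2` makes the
gain linear. The functions `1/2` and `1/2 + g` give the same weighted sum `Λ`, whatever the weights,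
so the larger of the two errors is at least half the difference of the integrals. That half is the
extra `1` in the exponent `2 * n + 1`. -/
lemma le_optimalError_of_nonneg_vanishing {d m n : ℕ} (hn : 1 ≤ n) {r : ℝ} (hr : 1 / 2 < r)
    {b : ℝ} (H : ∀ ξ : Fin m → Fin d → ℝ, ∃ g : (Fin d → ℝ) → ℝ, Continuous g ∧ (∀ x, 0 ≤ g x) ∧
      (∀ j, g (ξ j) = 0) ∧ b ≤ ∫ x, g x ∂(cubeMeasure d) ∧
      HasMixedSeries r (1 / 4) fun x => (g x : ℂ)) :
    ENNReal.ofReal ((1 / 2) ^ (2 * n + 1) * b) ≤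
      optimalError m (realMixedClass d r) ((2 * n : ℕ) : ℝ) := by
  refine le_iInf₂ fun ξ lam => ?_
  obtain ⟨g, hgc, hg0, hgξ, hgb, hgs⟩ := H fun j => ξ j
  set W := realMixedClass d r
  have hconst : HasMixedSeries r (1 / 4) fun _ : Fin d → ℝ => ((1 / 2 : ℝ) : ℂ) := by
    have := hasMixedSeries_const (d := d) r ((1 / 2 : ℝ) : ℂ)
    convert! this using 1
    norm_num
  have h₁ : (fun x : Fin d → ℝ => ((1 / 2 + g x : ℝ) : ℂ)) ∈ W := by
    refine ⟨mem_mixedClass_of_hasMixedSeries hr ?_, fun x => Complex.ofReal_im _⟩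
    -- Two squared radii `1/4` add up to `2 * (1/4) + 2 * (1/4) = 1`.
    have := (hconst.add hgs).mono (B := 1) (by norm_num)
    simpa only [Complex.ofReal_add] using this
  have h₂ : (fun _ : Fin d → ℝ => ((1 / 2 : ℝ) : ℂ)) ∈ W :=
    ⟨mem_mixedClass_of_hasMixedSeries hr (hconst.mono (by norm_num)), fun x => Complex.ofReal_im _⟩
  have e₁ := le_iSup₂ (f := fun f (_ : f ∈ W) =>
    ENNReal.ofReal (weightedError ((2 * n : ℕ) : ℝ) ξ lam f)) _ h₁
  have e₂ := le_iSup₂ (f := fun f (_ : f ∈ W) =>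
    ENNReal.ofReal (weightedError ((2 * n : ℕ) : ℝ) ξ lam f)) _ h₂
  set E₁ := weightedError ((2 * n : ℕ) : ℝ) ξ lam fun x => ((1 / 2 + g x : ℝ) : ℂ) with hE₁
  set E₂ := weightedError ((2 * n : ℕ) : ℝ) ξ lam fun _ => ((1 / 2 : ℝ) : ℂ) with hE₂
  suffices hmax : (1 / 2) ^ (2 * n + 1) * b ≤ max E₁ E₂ by
    rcases le_total E₁ E₂ with h | h
    · rw [max_eq_right h] at hmax
      exact (ENNReal.ofReal_le_ofReal hmax).trans e₂
    · rw [max_eq_left h] at hmax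
      exact (ENNReal.ofReal_le_ofReal hmax).trans e₁
  set Λ := ∑ j, lam j * (1 / 2 : ℝ) ^ (2 * n) with hΛ
  have hnorm : ∀ x, ‖((1 / 2 + g x : ℝ) : ℂ)‖ = 1 / 2 + g x := fun x => by
    rw [Complex.norm_real, Real.norm_of_nonneg (by linarith [hg0 x])]
  have hhalf : ‖((1 / 2 : ℝ) : ℂ)‖ = 1 / 2 := by
    rw [Complex.norm_real, Real.norm_of_nonneg (by norm_num)]
  have v₁ : E₁ = |(∫ x, (1 / 2 + g x) ^ (2 * n) ∂(cubeMeasure d)) - Λ| := by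
    simp only [hE₁, weightedError, hnorm, Real.rpow_natCast, hgξ, add_zero, hΛ, hhalf]
  have v₂ : E₂ = |(1 / 2) ^ (2 * n) - Λ| := by
    simp only [hE₂, weightedError, hhalf, Real.rpow_natCast, hΛ]
    simp
  have hint : (1 / 2) ^ (2 * n) + (1 / 2) ^ (2 * n) * b ≤
      ∫ x, (1 / 2 + g x) ^ (2 * n) ∂(cubeMeasure d) := by
    have hi1 : Integrable (fun x => (1 / 2 : ℝ) ^ (2 * n) + (1 / 2) ^ (2 * n) * g x)
        (cubeMeasure d) := integrable_cube_of_continuous (by fun_prop)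
    have hi2 : Integrable (fun x => (1 / 2 + g x) ^ (2 * n)) (cubeMeasure d) :=
      integrable_cube_of_continuous (by fun_prop)
    have h1 := integral_mono hi1 hi2 fun x => by
      have hx := hg0 x
      -- Bernoulli's inequality: `(1 + 2g)^{2n} ≥ 1 + 4ng ≥ 1 + g`.
      have hb := one_add_mul_le_pow (a := 2 * g x) (by linarith) (2 * n)
      have hn' : (1 : ℝ) ≤ n := by exact_mod_cast hn
      have h2 : (1 / 2 + g x) ^ (2 * n) = (1 / 2) ^ (2 * n) * (1 + 2 * g x) ^ (2 * n) := by
        rw [← mul_pow]; congr 1; ring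
      simp only
      rw [h2]
      have h3 : 1 + g x ≤ (1 + 2 * g x) ^ (2 * n) := by
        refine le_trans ?_ hb
        push_cast
        nlinarith
      calc _ = (1 / 2 : ℝ) ^ (2 * n) * (1 + g x) := by ring
        _ ≤ _ := mul_le_mul_of_nonneg_left h3 (by positivity)
    rw [integral_add (integrable_const _) ((integrable_cube_of_continuous hgc).const_mul _),
      integral_const_mul] at h1
    simp only [integral_const, probReal_univ, one_smul] at h1
    have h4 := mul_le_mul_of_nonneg_left hgb (by positivity : (0 : ℝ) ≤ (1 / 2) ^ (2 * n))
    linarith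
  have s₁ := (le_abs_self _).trans v₁.ge
  have s₂ := (neg_le_abs _).trans v₂.ge
  have s₃ : E₁ + E₂ ≤ 2 * max E₁ E₂ := by linarith [le_max_left E₁ E₂, le_max_right E₁ E₂]
  rw [pow_succ]
  linarith

theorem exists_le_optimalError (d : ℕ) (hd : 1 ≤ d) {r : ℝ} (hr : 1 / 2 < r) (n : ℕ) (hn : 1 ≤ n) :
    ∃ c : ℝ, 0 < c ∧ ∀ m : ℕ, 2 ≤ m → ENNReal.ofReal (c * rate d r m) ≤
      optimalError m (realMixedClass d r) ((2 * n : ℕ) : ℝ) := by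
  obtain ⟨e, rfl⟩ : ∃ e, d = e + 1 := ⟨d - 1, by omega⟩
  obtain ⟨C, hC, hfool⟩ := exists_fooling_function (e + 1) (r := r) (by linarith)
  -- One factor `1/2` comes from the normalization `t` and one from the mean `|S| / 2`; `4^r` comes
  -- from `2^N ≤ 4m`, and `(e + 1)^{e/2}` from the lower bound for `√|S|`.
  set c₀ : ℝ := (1 / 4) * (Real.sqrt C)⁻¹ * (4 ^ r)⁻¹ * ((e + 1 : ℝ) ^ ((e : ℝ) / 2))⁻¹ with hc₀
  have hc₀pos : 0 < c₀ := by positivity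
  refine ⟨(1 / 2) ^ (2 * n + 1) * c₀, by positivity, fun m hm => ?_⟩
  rw [mul_assoc]
  refine le_optimalError_of_nonneg_vanishing hn hr fun ξ => ?_
  set N := Nat.clog 2 (2 * m) with hN
  have hN1 : 2 * m ≤ 2 ^ N := Nat.le_pow_clog (by norm_num) _
  have hN2 : (2 : ℝ) ^ N ≤ 4 * m := by
    have h1 : 2 ^ (N - 1) < 2 * m := Nat.pow_pred_clog_lt_self (by norm_num) (by omega)
    have h2 : 2 ^ N = 2 * 2 ^ (N - 1) := by
      rw [← pow_succ']
      congr 1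
      have : 0 < N := Nat.clog_pos (by norm_num) (by omega)
      omega
    have h3 : 2 ^ N ≤ 4 * m := by omega
    exact_mod_cast h3
  have hm0 : (0 : ℝ) < m := by exact_mod_cast (by omega : 0 < m)
  have hm1 : (1 : ℝ) < m := by exact_mod_cast (by omega : 1 < m)
  have hlog : Real.log m ≤ N := by
    have h1 : (m : ℝ) ≤ 2 ^ N := by
      have : m ≤ 2 ^ N := by omega
      exact_mod_cast this
    have h2 := Real.log_le_log hm0 h1
    rw [Real.log_pow] at h2
    have h3 : Real.log 2 ≤ 1 := by linarith [Real.log_two_lt_d9]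
    nlinarith [Nat.cast_nonneg (α := ℝ) N]
  have hlogpos : 0 < Real.log m := Real.log_pos hm1
  obtain ⟨S, hS, hScard⟩ := exists_dyadic_indices e N
  have hScard' : (Real.log m / (e + 1)) ^ e ≤ S.card := by
    refine le_trans ?_ hScard
    gcongr
  have hSpos : (0 : ℝ) < S.card := lt_of_lt_of_le (by positivity) hScard'
  obtain ⟨g, hgc, hg0, hgξ, hgm, hgs⟩ := hfool m N ξ S hN1 hS
  set V : ℝ := C * (2 ^ N) ^ (2 * r) * S.card with hV
  have hVpos : 0 < V := by positivity
  -- Scales the squared radius `V` to the required `1/4`.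
  set t : ℝ := (1 / 2) * (Real.sqrt V)⁻¹ with ht
  have htpos : 0 < t := by positivity
  refine ⟨fun x => t * g x, by fun_prop, fun x => mul_nonneg htpos.le (hg0 x), fun j => by simp [hgξ],
    ?_, ?_⟩
  · rw [integral_const_mul]
    refine le_trans ?_ (mul_le_mul_of_nonneg_left hgm htpos.le)
    have h2N : ((2 : ℝ) ^ N) ^ (2 * r) = (((2 : ℝ) ^ N) ^ r) ^ 2 := by
      rw [← Real.rpow_natCast (((2 : ℝ) ^ N) ^ r), ← Real.rpow_mul (by positivity)]
      congr 1
      push_cast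
      ring
    have hsqrt : Real.sqrt V = Real.sqrt C * (2 ^ N) ^ r * Real.sqrt S.card := by
      rw [hV, Real.sqrt_mul (by positivity), Real.sqrt_mul hC.le, h2N,
        Real.sqrt_sq (by positivity)]
    have hval : t * (S.card / 2) = (1 / 4) * (Real.sqrt C)⁻¹ * (((2 : ℝ) ^ N) ^ r)⁻¹ *
        Real.sqrt S.card := by
      rw [ht, hsqrt]
      have h2 : Real.sqrt S.card ≠ 0 := (Real.sqrt_pos.mpr hSpos).ne'
      have h3 : Real.sqrt C ≠ 0 := (Real.sqrt_pos.mpr hC).ne'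
      have h4 : (((2 : ℝ) ^ N) ^ r) ≠ 0 := by positivity
      field_simp
      rw [Real.sq_sqrt hSpos.le]
      ring
    rw [hval, rate, hc₀]
    have p1 : (4 ^ r)⁻¹ * (m : ℝ) ^ (-r) ≤ (((2 : ℝ) ^ N) ^ r)⁻¹ := by
      rw [Real.rpow_neg hm0.le, ← mul_inv, ← Real.mul_rpow (by norm_num) hm0.le]
      exact inv_anti₀ (by positivity) (Real.rpow_le_rpow (by positivity) hN2 (by linarith))
    have p2 : ((e + 1 : ℝ) ^ ((e : ℝ) / 2))⁻¹ *
        Real.log m ^ ((((e + 1 : ℕ) : ℝ) - 1) / 2) ≤ Real.sqrt S.card := by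
      refine Real.le_sqrt_of_sq_le (le_of_eq_of_le ?_ hScard')
      have h1 : (((e + 1 : ℕ) : ℝ) - 1) / 2 = (e : ℝ) / 2 := by push_cast; ring
      rw [h1, inv_mul_eq_div, ← Real.div_rpow hlogpos.le (by positivity), ← Real.rpow_natCast _ 2,
        ← Real.rpow_mul (by positivity), ← Real.rpow_natCast _ e]
      congr 1
      push_cast
      ring
    calc _ = (1 / 4) * (Real.sqrt C)⁻¹ * ((4 ^ r)⁻¹ * (m : ℝ) ^ (-r)) *
          (((e + 1 : ℝ) ^ ((e : ℝ) / 2))⁻¹ * Real.log m ^ ((((e + 1 : ℕ) : ℝ) - 1) / 2)) := by ring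
      _ ≤ _ := by gcongr
  · have h1 := hgs.const_mul (t : ℂ)
    have h2 : ‖(t : ℂ)‖ ^ 2 * V = 1 / 4 := by
      rw [Complex.norm_real, Real.norm_of_nonneg htpos.le, ht, mul_pow, inv_pow,
        Real.sq_sqrt hVpos.le]
      field_simp
      norm_num
    rw [h2] at h1
    simpa only [Complex.ofReal_mul] using h1

/-! ### A lattice with norms bounded below -/

/-- The polynomial `∏_{j<d} (X - 4j) - 1`. -/
def frolovPolynomial (d : ℕ) : Polynomial ℤ :=
  ∏ j : Fin d, (Polynomial.X - Polynomial.C (4 * (j : ℤ))) - 1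

lemma degree_frolovProd (d : ℕ) :
    (∏ j : Fin d, (Polynomial.X - Polynomial.C (4 * (j : ℤ)))).degree = (d : WithBot ℕ) := by
  rw [Polynomial.degree_prod]
  simp only [Polynomial.degree_X_sub_C]
  simp

lemma monic_frolovProd (d : ℕ) :
    (∏ j : Fin d, (Polynomial.X - Polynomial.C (4 * (j : ℤ)))).Monic :=
  Polynomial.monic_prod_of_monic _ _ fun _ _ => Polynomial.monic_X_sub_C _

lemma degree_one_lt_frolovProd {d : ℕ} (hd : 1 ≤ d) : (1 : Polynomial ℤ).degree <
    (∏ j : Fin d, (Polynomial.X - Polynomial.C (4 * (j : ℤ)))).degree := by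
  rw [degree_frolovProd, Polynomial.degree_one]
  exact_mod_cast hd

lemma monic_frolovPolynomial {d : ℕ} (hd : 1 ≤ d) : (frolovPolynomial d).Monic :=
  (monic_frolovProd d).sub_of_left (degree_one_lt_frolovProd hd)

lemma natDegree_frolovPolynomial {d : ℕ} (hd : 1 ≤ d) : (frolovPolynomial d).natDegree = d := by
  rw [frolovPolynomial, Polynomial.natDegree_eq_of_degree_eq
    (Polynomial.degree_sub_eq_left_of_degree_lt (degree_one_lt_frolovProd hd))]
  exact Polynomial.natDegree_eq_of_degree_eq_some (degree_frolovProd d)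

lemma eval_frolovPolynomial {d : ℕ} (j : Fin d) :
    (frolovPolynomial d).eval (4 * (j : ℤ)) = -1 := by
  rw [frolovPolynomial, Polynomial.eval_sub, Polynomial.eval_prod,
    Finset.prod_eq_zero (Finset.mem_univ j) (by simp)]
  simp

/-- If it is `f g` with monic factors of lower degree, then at each point `4j` the integers `f` and
`g` have product `-1`, so `f + g` vanishes at `d` points. Its degree is less than `d`, so `f = -g`,
which is impossible for monic polynomials. -/
lemma irreducible_frolovPolynomial {d : ℕ} (hd : 1 ≤ d) : Irreducible (frolovPolynomial d) := by
  have hdeg := natDegree_frolovPolynomial hd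
  rw [(monic_frolovPolynomial hd).irreducible_iff_natDegree']
  refine ⟨fun h => ?_, fun f g hf hg hfg hmem => ?_⟩
  · rw [h, Polynomial.natDegree_one] at hdeg
    omega
  · rw [Finset.mem_Ioc, hdeg] at hmem
    have hsum : f.natDegree + g.natDegree = d := by
      rw [← hf.natDegree_mul hg, hfg, hdeg]
    have heval : ∀ j : Fin d, (f + g).eval (4 * (j : ℤ)) = 0 := fun j => by
      have h1 := eval_frolovPolynomial j
      rw [← hfg, Polynomial.eval_mul] at h1
      rw [Polynomial.eval_add]
      rcases Int.mul_eq_neg_one_iff_eq_one_or_neg_one.mp h1 with h | h <;> omega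
    have hzero : f + g = 0 := by
      refine Polynomial.eq_zero_of_natDegree_lt_card_of_eval_eq_zero (f + g)
        (f := fun j : Fin d => 4 * (j : ℤ)) (fun i j h => ?_) heval ?_
      · simp only at h
        exact Fin.ext (by omega)
      · rw [Fintype.card_fin]
        exact lt_of_le_of_lt (Polynomial.natDegree_add_le f g) (by omega)
    have h2 : f.leadingCoeff = -g.leadingCoeff := by
      rw [eq_neg_of_add_eq_zero_left hzero, Polynomial.leadingCoeff_neg]
    rw [hf.leadingCoeff, hg.leadingCoeff] at h2
    omega

/-- At distance `2` on either side of `4j` every factor of the product has absolute value at least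
`2`, and only the `j`-th one changes sign. So the product minus one changes sign in between; the
open intervals are disjoint, giving `d` distinct real roots. -/
lemma exists_root_frolovPolynomial {d : ℕ} (j : Fin d) :
    ∃ θ : ℝ, 4 * (j : ℝ) - 2 < θ ∧ θ < 4 * j + 2 ∧
      ((frolovPolynomial d).map (Int.castRingHom ℝ)).eval θ = 0 := by
  set q : ℝ → ℝ := fun x => ∏ i : Fin d, (x - 4 * (i : ℝ)) with hq
  have heval : ∀ x : ℝ, ((frolovPolynomial d).map (Int.castRingHom ℝ)).eval x = q x - 1 := fun x => by
    simp [frolovPolynomial, Polynomial.eval_prod, Polynomial.map_sub, Polynomial.map_prod, hq]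
  have hgap : ∀ i : Fin d, i ≠ j → 1 ≤ |(j : ℝ) - i| := fun i hij => by
    have h1 : (1 : ℤ) ≤ |(j : ℤ) - i| := Int.one_le_abs (sub_ne_zero.mpr fun h => hij
      (Fin.ext (by exact_mod_cast h.symm)))
    exact_mod_cast h1
  have habs : ∀ (ε : ℝ), |ε| = 2 → 2 ≤ |q (4 * j + ε)| := fun ε hε => by
    rw [hq, Finset.abs_prod]
    have h1 : ∀ i ∈ (Finset.univ : Finset (Fin d)), (2 : ℝ) ≤ |4 * (j : ℝ) + ε - 4 * i| := fun i _ => by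
      by_cases hij : i = j
      · subst hij
        simp [hε]
      · have h2 := hgap i hij
        have h3 : |4 * ((j : ℝ) - i)| = 4 * |(j : ℝ) - i| := by rw [abs_mul]; norm_num
        have h4 := abs_sub_abs_le_abs_sub (4 * ((j : ℝ) - i)) (-ε)
        rw [abs_neg] at h4
        have h5 : 4 * ((j : ℝ) - i) - -ε = 4 * (j : ℝ) + ε - 4 * i := by ring
        rw [h5] at h4
        linarith
    calc (2 : ℝ) ≤ 2 ^ d := le_self_pow₀ (by norm_num) (by have := j.2; omega)
      _ = ∏ _i : Fin d, (2 : ℝ) := by simp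
      _ ≤ _ := Finset.prod_le_prod (fun _ _ => by norm_num) h1
  have hneg : q (4 * j + -2) * q (4 * j + 2) < 0 := by
    rw [hq, ← Finset.prod_mul_distrib, ← Finset.mul_prod_erase _ _ (Finset.mem_univ j)]
    refine mul_neg_of_neg_of_pos (by ring_nf; norm_num) (Finset.prod_pos fun i hi => ?_)
    have h2 := hgap i (Finset.ne_of_mem_erase hi)
    have h3 : 1 ≤ ((j : ℝ) - i) ^ 2 := by
      rw [← sq_abs]
      exact one_le_pow₀ h2
    nlinarith
  have ha := habs (-2) (by norm_num)
  have hb := habs 2 (by norm_num)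
  have hcont : Continuous fun x => q x - 1 := by
    rw [hq]
    fun_prop
  have hle : 4 * (j : ℝ) + -2 ≤ 4 * j + 2 := by linarith
  have hroot : ∃ θ ∈ Set.Icc (4 * (j : ℝ) + -2) (4 * j + 2), q θ - 1 = 0 := by
    rcases mul_neg_iff.mp hneg with ⟨h1, h2⟩ | ⟨h1, h2⟩
    · rw [abs_of_pos h1] at ha
      exact intermediate_value_Icc' hle hcont.continuousOn ⟨by linarith, by linarith⟩
    · rw [abs_of_pos h2] at hb
      exact intermediate_value_Icc hle hcont.continuousOn ⟨by linarith, by linarith⟩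
  obtain ⟨θ, ⟨h1, h2⟩, h3⟩ := hroot
  have hone : q θ = 1 := by linarith
  refine ⟨θ, lt_of_le_of_ne (by linarith) fun h => ?_, lt_of_le_of_ne h2 fun h => ?_, ?_⟩
  · rw [show 4 * (j : ℝ) + -2 = θ by linarith, hone] at ha
    norm_num at ha
  · rw [← h, hone] at hb
    norm_num at hb
  · rw [heval, h3]

/-- The product over all roots of a monic integer polynomial is a resultant of integer polynomials.
-/
lemma prod_eval_roots_eq_int {d : ℕ} (hd : 1 ≤ d) {θ : Fin d → ℝ} (hθ : Function.Injective θ)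
    (hroot : ∀ j, ((frolovPolynomial d).map (Int.castRingHom ℝ)).eval (θ j) = 0)
    (g : Polynomial ℤ) :
    ∃ N : ℤ, ∏ j, (g.map (Int.castRingHom ℝ)).eval (θ j) = N := by
  set P := (frolovPolynomial d).map (Int.castRingHom ℝ) with hP
  have hmonic : P.Monic := (monic_frolovPolynomial hd).map _
  have hdeg : P.natDegree = d := by
    rw [hP, (monic_frolovPolynomial hd).natDegree_map, natDegree_frolovPolynomial hd]
  have hroots : P.roots = Finset.univ.val.map θ := by
    symm
    refine Multiset.eq_of_le_of_card_le ?_ ?_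
    · rw [Multiset.le_iff_subset (Multiset.Nodup.map hθ Finset.univ.nodup)]
      intro x hx
      obtain ⟨j, -, rfl⟩ := Multiset.mem_map.mp hx
      exact (Polynomial.mem_roots hmonic.ne_zero).mpr (hroot j)
    · refine (Polynomial.card_roots' P).trans ?_
      rw [hdeg]
      simp
  have hsplit : P.Splits := by
    rw [Polynomial.splits_iff_card_roots, hroots, hdeg]
    simp
  have h := Polynomial.resultant_eq_prod_eval P (g.map (Int.castRingHom ℝ)) g.natDegree
    Polynomial.natDegree_map_le hsplit
  rw [hmonic.leadingCoeff, one_pow, one_mul, hroots, hdeg, hP, Polynomial.resultant_map_map] at h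
  refine ⟨(frolovPolynomial d).resultant g d g.natDegree, ?_⟩
  rw [← eq_intCast (Int.castRingHom ℝ), h, Multiset.map_map]
  rfl

/-- For the Vandermonde matrix of the roots `θ_j`, the coordinates of the image of `h` are `g(θ_j)`
with `g = ∑ h_i X^i`. Their product is an integer, a norm; it is nonzero because each `θ_j` has
degree `d` over `ℚ`, whereas `g ≠ 0` has degree less than `d`. -/
theorem exists_frolov_matrix {d : ℕ} (hd : 1 ≤ d) :
    ∃ B : Matrix (Fin d) (Fin d) ℝ, B.det ≠ 0 ∧
      ∀ h : Fin d → ℤ, h ≠ 0 → 1 ≤ ∏ j, |B.mulVec (fun i => (h i : ℝ)) j| := by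
  choose θ hθl hθr hroot using fun j : Fin d => exists_root_frolovPolynomial j
  have hmono : StrictMono θ := fun i j hij => by
    have h1 : (i : ℝ) + 1 ≤ j := by exact_mod_cast (Fin.lt_def.mp hij)
    have := hθr i
    have := hθl j
    linarith
  refine ⟨Matrix.vandermonde θ, Matrix.det_vandermonde_ne_zero_iff.mpr hmono.injective,
    fun h hh => ?_⟩
  set g : Polynomial ℤ := ∑ i : Fin d, Polynomial.C (h i) * Polynomial.X ^ (i : ℕ) with hg
  have hgdeg : g.degree < d := Polynomial.degree_sum_fin_lt _
  have hgne : g ≠ 0 := fun h0 => hh (funext fun i => by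
    have h1 : g.coeff i = h i := by
      simp only [hg, Polynomial.finsetSum_coeff, Polynomial.coeff_C_mul, Polynomial.coeff_X_pow]
      rw [Finset.sum_eq_single i (fun b _ hb => by
        rw [if_neg fun hc => hb (Fin.ext hc.symm), mul_zero]) (by simp)]
      simp
    rw [← h1, h0]
    simp)
  have heval : ∀ j, (Matrix.vandermonde θ).mulVec (fun i => (h i : ℝ)) j =
      (g.map (Int.castRingHom ℝ)).eval (θ j) := fun j => by
    simp [Matrix.mulVec, dotProduct, hg, Polynomial.map_sum, Polynomial.eval_finsetSum,
      Matrix.vandermonde_apply, mul_comm]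
  obtain ⟨N, hN⟩ := prod_eval_roots_eq_int hd hmono.injective hroot g
  simp_rw [heval]
  rw [← Finset.abs_prod, hN]
  have hne : ∀ j, (g.map (Int.castRingHom ℝ)).eval (θ j) ≠ 0 := fun j hj => by
    have hirr : Irreducible ((frolovPolynomial d).map (algebraMap ℤ ℚ)) :=
      ((monic_frolovPolynomial hd).irreducible_iff_irreducible_map_fraction_map).mp
        (irreducible_frolovPolynomial hd)
    have haev : ∀ p : Polynomial ℤ, Polynomial.aeval (θ j) (p.map (algebraMap ℤ ℚ)) =
        (p.map (Int.castRingHom ℝ)).eval (θ j) := fun p => by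
      rw [Polynomial.aeval_map_algebraMap, Polynomial.eval_map, Polynomial.aeval_def]
      rfl
    have hmin := minpoly.eq_of_irreducible_of_monic hirr (by rw [haev]; exact hroot j)
      ((monic_frolovPolynomial hd).map _)
    have hgq : g.map (algebraMap ℤ ℚ) ≠ 0 :=
      (Polynomial.map_ne_zero_iff (algebraMap ℤ ℚ).injective_int).mpr hgne
    have hle := minpoly.degree_le_of_ne_zero ℚ (θ j) hgq (by rw [haev]; exact hj)
    rw [← hmin, (monic_frolovPolynomial hd).degree_map,
      Polynomial.degree_eq_natDegree (monic_frolovPolynomial hd).ne_zero,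
      natDegree_frolovPolynomial hd] at hle
    exact absurd (hle.trans Polynomial.degree_map_le) (not_le.mpr hgdeg)
  have hN0 : N ≠ 0 := fun h0 => by
    rw [h0, Int.cast_zero, Finset.prod_eq_zero_iff] at hN
    obtain ⟨j, -, hj⟩ := hN
    exact hne j hj
  exact_mod_cast Int.one_le_abs hN0

/-! ### Summation over a lattice with norms bounded below -/

/-- At most `(S + 1)^e` tuples have sum `S`, since the last `e` entries determine the first. What
remains is a geometric series with a polynomial factor; starting it `e + 1` below `S₀` costs `2^{δ(e
+ 1)}`. -/
lemma exists_tsum_tail_le (e : ℕ) {δ : ℝ} (hδ : 0 < δ) :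
    ∃ C : ℝ, 0 < C ∧ ∀ S₀ : ℕ,
      ∑' s : Fin (e + 1) → ℕ, (if S₀ - (e + 1) ≤ ∑ j, s j then
        ENNReal.ofReal ((2 : ℝ) ^ (-δ * (∑ j, s j : ℕ))) else 0) ≤
      ENNReal.ofReal (C * ((S₀ + 1 : ℝ) ^ e * 2 ^ (-δ * S₀))) := by
  have hq0 : (0 : ℝ) < 2 ^ (-δ) := by positivity
  have hq1 : (2 : ℝ) ^ (-δ) < 1 := Real.rpow_lt_one_of_one_lt_of_neg (by norm_num) (by linarith)
  have hgsum : Summable fun i : ℕ => ((i : ℝ) + 1) ^ e * ((2 : ℝ) ^ (-δ)) ^ i := by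
    have h1 := (summable_nat_add_iff 1).mpr (summable_pow_mul_geometric_of_norm_lt_one e
      (r := (2 : ℝ) ^ (-δ)) (by rwa [Real.norm_of_nonneg hq0.le]))
    refine (h1.mul_left ((2 : ℝ) ^ (-δ))⁻¹).congr fun i => ?_
    push_cast
    rw [pow_succ]
    field_simp
  set g : ℕ → ℝ := fun i => ((i : ℝ) + 1) ^ e * ((2 : ℝ) ^ (-δ)) ^ i with hg
  have hg0 : ∀ i, 0 ≤ g i := fun i => by positivity
  refine ⟨2 ^ (δ * (e + 1)) * (∑' i, g i + 1), by
    have : 0 ≤ ∑' i, g i := tsum_nonneg hg0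
    positivity, fun S₀ => ?_⟩
  set T := S₀ - (e + 1) with hT
  set F : ℕ → ℝ≥0∞ := fun S => if T ≤ S then ENNReal.ofReal ((2 : ℝ) ^ (-δ * S)) else 0 with hF
  have h1 : ∑' s : Fin (e + 1) → ℕ, F (∑ j, s j) ≤ ∑' S : ℕ, ((S : ℝ≥0∞) + 1) ^ e * F S := by
    let ι : (Fin (e + 1) → ℕ) → (Σ S : ℕ, (Fin e → Fin (S + 1))) := fun s =>
      ⟨∑ j, s j, fun j => ⟨s j.succ, Nat.lt_succ_iff.mpr
        (Finset.single_le_sum (f := s) (fun _ _ => Nat.zero_le _) (Finset.mem_univ j.succ))⟩⟩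
    have hι : Function.Injective ι := by
      intro s s' h
      have hsum : ∑ j, s j = ∑ j, s' j := congrArg Sigma.fst h
      have htail : ∀ j : Fin e, s j.succ = s' j.succ := fun j => by
        have h2 : ∀ p p' : (Σ S : ℕ, (Fin e → Fin (S + 1))), p = p' →
            ((p.2 j : ℕ)) = p'.2 j := fun p p' hp => by rw [hp]
        exact h2 _ _ h
      funext j
      refine Fin.cases ?_ htail j
      rw [Fin.sum_univ_succ, Fin.sum_univ_succ, Finset.sum_congr rfl fun j _ => htail j] at hsum
      omega
    calc ∑' s : Fin (e + 1) → ℕ, F (∑ j, s j)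
        = ∑' s, (fun p : (Σ S : ℕ, (Fin e → Fin (S + 1))) => F p.1) (ι s) := rfl
      _ ≤ ∑' p : (Σ S : ℕ, (Fin e → Fin (S + 1))), F p.1 :=
          ENNReal.tsum_comp_le_tsum_of_injective hι _
      _ = ∑' S : ℕ, ((S : ℝ≥0∞) + 1) ^ e * F S := by
          rw [ENNReal.tsum_sigma']
          refine tsum_congr fun S => ?_
          rw [tsum_fintype]
          simp
  have h2 : ∑' S : ℕ, ((S : ℝ≥0∞) + 1) ^ e * F S ≤
      ∑' i : ℕ, ENNReal.ofReal (2 ^ (δ * (e + 1)) * ((S₀ + 1 : ℝ) ^ e * 2 ^ (-δ * S₀)) * g i) := by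
    have hinj : Function.Injective fun i : ℕ => T + i := fun i j h => by simpa using h
    rw [← hinj.tsum_eq (f := fun S : ℕ => ((S : ℝ≥0∞) + 1) ^ e * F S)]
    · refine ENNReal.tsum_le_tsum fun i => ?_
      simp only [hF, Nat.le_add_right, if_true]
      have h3 : (((T + i : ℕ) : ℝ≥0∞) + 1) ^ e = ENNReal.ofReal ((((T + i : ℕ) : ℝ) + 1) ^ e) := by
        rw [ENNReal.ofReal_pow (by positivity), ENNReal.ofReal_add (by positivity) zero_le_one,
          ENNReal.ofReal_natCast, ENNReal.ofReal_one]
      rw [h3, ← ENNReal.ofReal_mul (by positivity)]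
      refine ENNReal.ofReal_le_ofReal ?_
      have hTS : (T : ℝ) ≤ S₀ := by exact_mod_cast Nat.sub_le _ _
      have hTS' : (S₀ : ℝ) - (e + 1) ≤ T := by
        have : S₀ ≤ T + (e + 1) := by omega
        have h5 : (S₀ : ℝ) ≤ T + (e + 1) := by exact_mod_cast this
        linarith
      have hp1 : (((T + i : ℕ) : ℝ) + 1) ^ e ≤ (S₀ + 1 : ℝ) ^ e * ((i : ℝ) + 1) ^ e := by
        rw [← mul_pow]
        refine pow_le_pow_left₀ (by positivity) ?_ e
        push_cast
        nlinarith [Nat.cast_nonneg (α := ℝ) i, Nat.cast_nonneg (α := ℝ) S₀]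
      have hp2 : (2 : ℝ) ^ (-δ * ((T + i : ℕ) : ℝ)) ≤
          2 ^ (δ * (e + 1)) * 2 ^ (-δ * S₀) * ((2 : ℝ) ^ (-δ)) ^ i := by
        rw [← Real.rpow_natCast ((2 : ℝ) ^ (-δ)), ← Real.rpow_mul (by norm_num),
          ← Real.rpow_add (by norm_num), ← Real.rpow_add (by norm_num)]
        refine Real.rpow_le_rpow_of_exponent_le (by norm_num) ?_
        push_cast
        nlinarith
      calc _ ≤ ((S₀ + 1 : ℝ) ^ e * ((i : ℝ) + 1) ^ e) *
            (2 ^ (δ * (e + 1)) * 2 ^ (-δ * S₀) * ((2 : ℝ) ^ (-δ)) ^ i) :=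
            mul_le_mul hp1 hp2 (by positivity) (by positivity)
        _ = _ := by rw [hg]; ring
    · intro S hS
      have : T ≤ S := by
        by_contra hcon
        simp [hF, hcon] at hS
      exact ⟨S - T, Nat.add_sub_cancel' this⟩
  refine h1.trans (h2.trans ?_)
  rw [← ENNReal.ofReal_tsum_of_nonneg (fun i => mul_nonneg (by positivity) (hg0 i))
    (hgsum.mul_left _), tsum_mul_left]
  refine ENNReal.ofReal_le_ofReal ?_
  have : 0 ≤ (2 : ℝ) ^ (δ * (e + 1)) * ((S₀ + 1 : ℝ) ^ e * 2 ^ (-δ * S₀)) := by positivity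
  nlinarith

/-- Pigeonhole: cut the box into cells with sides `2^{s_j + 1} τ`, where `τ` makes the volume of a
cell exactly `M`. Two points in one cell would differ by a vector whose coordinate product is less
than `M`, so each cell holds at most one. With `n ≤ 2 / τ` there are at most `(4 / τ)^d` cells. -/
lemma lattice_box_card_le {d : ℕ} (hd : 1 ≤ d) {L : (Fin d → ℤ) →+ (Fin d → ℝ)} {M : ℝ}
    (hM : 0 < M) (hL : ∀ h, h ≠ 0 → M ≤ ∏ j, |L h j|) (s : Fin d → ℕ)
    (hs : M < 2 ^ (∑ j, s j + d)) (A : Finset (Fin d → ℤ))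
    (hA : ∀ h ∈ A, ∀ j, |L h j| < 2 ^ (s j + 1)) :
    (A.card : ℝ) ≤ 8 ^ d * 2 ^ (∑ j, s j) / M := by
  classical
  have hd0 : (d : ℝ) ≠ 0 := by exact_mod_cast (by omega : d ≠ 0)
  set τ : ℝ := (M / 2 ^ (∑ j, s j + d)) ^ ((d : ℝ)⁻¹) with hτ
  have hτ0 : 0 < τ := by positivity
  have hτ1 : τ ≤ 1 := Real.rpow_le_one (by positivity) ((div_le_one (by positivity)).mpr hs.le)
    (by positivity)
  have hτd : τ ^ d = M / 2 ^ (∑ j, s j + d) := by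
    rw [hτ, ← Real.rpow_natCast, ← Real.rpow_mul (by positivity), inv_mul_cancel₀ hd0,
      Real.rpow_one]
  set l : Fin d → ℝ := fun j => 2 ^ (s j + 1) * τ with hl
  have hl0 : ∀ j, 0 < l j := fun j => by positivity
  have hlM : ∏ j, l j = M := by
    rw [hl, Finset.prod_mul_distrib, Finset.prod_pow_eq_pow_sum, Finset.sum_add_distrib]
    simp only [Finset.prod_const, Finset.sum_const, Finset.card_univ, Fintype.card_fin, smul_eq_mul,
      mul_one]
    rw [hτd]
    field_simp
  set n := ⌈τ⁻¹⌉₊ with hn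
  have hnle : (n : ℝ) ≤ 2 * τ⁻¹ := by
    have h1 := Nat.ceil_lt_add_one (inv_pos.mpr hτ0).le
    have h2 : 1 ≤ τ⁻¹ := (one_le_inv₀ hτ0).mpr hτ1
    linarith
  let φ : (Fin d → ℤ) → (Fin d → ℤ) := fun h j => ⌊L h j / l j⌋
  have hmaps : ∀ h ∈ A, φ h ∈ Fintype.piFinset fun _ : Fin d => Finset.Ico (-(n : ℤ)) n := by
    intro h hh
    rw [Fintype.mem_piFinset]
    intro j
    have h1 : |L h j / l j| < n := by
      rw [abs_div, abs_of_pos (hl0 j), div_lt_iff₀ (hl0 j)]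
      refine (hA h hh j).trans_le ?_
      have h2 : τ⁻¹ ≤ n := Nat.le_ceil _
      calc (2 : ℝ) ^ (s j + 1) = τ⁻¹ * (2 ^ (s j + 1) * τ) := by field_simp
        _ ≤ n * (2 ^ (s j + 1) * τ) := mul_le_mul_of_nonneg_right h2 (hl0 j).le
    rw [abs_lt] at h1
    rw [Finset.mem_Ico]
    refine ⟨Int.le_floor.mpr ?_, Int.floor_lt.mpr ?_⟩
    · push_cast
      exact h1.1.le
    · exact_mod_cast h1.2
  have hinj : Set.InjOn φ A := by
    intro h hh h' hh' heq
    by_contra hne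
    have h1 := hL (h - h') (sub_ne_zero.mpr hne)
    have h2 : ∏ j, |L (h - h') j| < ∏ j, l j := by
      rw [map_sub]
      by_cases hz : ∃ j, L h j - L h' j = 0
      · obtain ⟨j, hj⟩ := hz
        rw [Finset.prod_eq_zero (Finset.mem_univ j) (by simp [hj])]
        exact Finset.prod_pos fun j _ => hl0 j
      · push Not at hz
        refine Finset.prod_lt_prod_of_nonempty (fun j _ => abs_pos.mpr (hz j)) (fun j _ => ?_)
          ⟨⟨0, by omega⟩, Finset.mem_univ _⟩
        have h3 := Int.abs_sub_lt_one_of_floor_eq_floor (congrFun heq j)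
        rw [← sub_div, abs_div, abs_of_pos (hl0 j), div_lt_one (hl0 j)] at h3
        exact h3
    rw [hlM] at h2
    exact absurd h1 (not_le.mpr h2)
  have hcard := Finset.card_le_card_of_injOn φ hmaps hinj
  rw [Fintype.card_piFinset_const, Int.card_Ico] at hcard
  have h4 : (A.card : ℝ) ≤ (2 * n) ^ d := by
    have : A.card ≤ (2 * n) ^ d := by
      refine hcard.trans_eq ?_
      congr 1
      omega
    exact_mod_cast this
  refine h4.trans ?_
  calc (2 * (n : ℝ)) ^ d ≤ (4 * τ⁻¹) ^ d := pow_le_pow_left₀ (by positivity) (by linarith) d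
    _ = 8 ^ d * 2 ^ (∑ j, s j) / M := by
        rw [mul_pow, inv_pow, hτd, pow_add, inv_div, show (8 : ℝ) = 4 * 2 by norm_num, mul_pow]
        ring

/-- Sort the points by the dyadic sizes `2^{s_j}` of `1 + |L h j|`. A nonempty block has `2^{∑ s_j}`
at least of order `M`; it contains `O(2^{∑ s_j} / M)` points, each contributing at most `2^{-β ∑
s_j}`. The tail sum with `δ = β - 1` gives `M^{-1} M^{-δ}` and the power of the logarithm. -/
lemma exists_lattice_sum_le (e : ℕ) {β : ℝ} (hβ : 1 < β) :
    ∃ C : ℝ, 0 < C ∧ ∀ (L : (Fin (e + 1) → ℤ) →+ (Fin (e + 1) → ℝ)) (M : ℝ), 1 ≤ M →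
      (∀ h, h ≠ 0 → M ≤ ∏ j, |L h j|) →
      ∑' h : Fin (e + 1) → ℤ, (if h = 0 then 0 else
        ENNReal.ofReal (∏ j, (1 + |L h j|) ^ (-β))) ≤
      ENNReal.ofReal (C * (M ^ (-β) * (1 + Real.log M) ^ e)) := by
  classical
  set δ := β - 1 with hδ
  have hδ0 : 0 < δ := by linarith
  obtain ⟨C, hC, htail⟩ := exists_tsum_tail_le e hδ0
  refine ⟨8 ^ (e + 1) * C * (2 ^ e * 2 ^ δ), by positivity, fun L M hM hL => ?_⟩
  have hM0 : 0 < M := by linarith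
  -- `2^{S₀} ≤ M < 2^{S₀ + 1}`: the lower half locates the first nonempty block, the upper half
  -- converts `2^{-δ S₀}` back into `M^{-δ}`.
  obtain ⟨S₀, hS₀, hS₀'⟩ := exists_nat_pow_near hM (one_lt_two)
  set T := S₀ - (e + 1) with hT
  let P : (Fin (e + 1) → ℤ) → (Fin (e + 1) → ℕ) → Prop := fun h s =>
    h ≠ 0 ∧ ∀ j, (2 : ℝ) ^ s j ≤ 1 + |L h j| ∧ 1 + |L h j| < 2 ^ (s j + 1)
  have hPT : ∀ h s, P h s → M < 2 ^ (∑ j, s j + (e + 1)) := by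
    rintro h s ⟨hne, hs⟩
    have hpos : 0 < ∏ j, |L h j| := hM0.trans_le (hL h hne)
    refine (hL h hne).trans_lt ?_
    have h1 : ∏ j, |L h j| < ∏ j, (2 : ℝ) ^ (s j + 1) := by
      refine Finset.prod_lt_prod_of_nonempty (fun j _ => ?_) (fun j _ => by linarith [(hs j).2])
        ⟨0, Finset.mem_univ _⟩
      refine lt_of_le_of_ne (abs_nonneg _) fun h0 => ?_
      rw [Finset.prod_eq_zero (Finset.mem_univ j) h0.symm] at hpos
      exact lt_irrefl _ hpos
    rw [Finset.prod_pow_eq_pow_sum, Finset.sum_add_distrib] at h1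
    simpa using h1
  have hterm : ∀ h, (if h = 0 then 0 else ENNReal.ofReal (∏ j, (1 + |L h j|) ^ (-β))) ≤
      ∑' s, if P h s then ENNReal.ofReal ((2 : ℝ) ^ (-β * (∑ j, s j : ℕ))) else 0 := by
    intro h
    split_ifs with hh
    · exact zero_le
    · choose s hs hs' using fun j => exists_nat_pow_near (x := 1 + |L h j|) (y := (2 : ℝ))
        (by linarith [abs_nonneg (L h j)]) one_lt_two
      have hPs : P h s := ⟨hh, fun j => ⟨hs j, hs' j⟩⟩
      refine le_trans ?_ (ENNReal.le_tsum s)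
      rw [if_pos hPs]
      refine ENNReal.ofReal_le_ofReal ?_
      calc ∏ j, (1 + |L h j|) ^ (-β) ≤ ∏ j, ((2 : ℝ) ^ s j) ^ (-β) :=
            Finset.prod_le_prod (fun j _ => by positivity) fun j _ =>
              Real.rpow_le_rpow_of_nonpos (by positivity) (hs j) (by linarith)
        _ = _ := by
            rw [Real.finsetProd_rpow _ _ fun j _ => by positivity, Finset.prod_pow_eq_pow_sum,
              ← Real.rpow_natCast, ← Real.rpow_mul (by norm_num), mul_comm]
  have hinner : ∀ s : Fin (e + 1) → ℕ,
      ∑' h, (if P h s then ENNReal.ofReal ((2 : ℝ) ^ (-β * (∑ j, s j : ℕ))) else 0) ≤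
        ENNReal.ofReal (8 ^ (e + 1) / M) * (if T ≤ ∑ j, s j then
          ENNReal.ofReal ((2 : ℝ) ^ (-δ * (∑ j, s j : ℕ))) else 0) := by
    intro s
    by_cases hex : ∃ h, P h s
    · obtain ⟨h₀, hh₀⟩ := hex
      have hMs := hPT h₀ s hh₀
      have hTs : T ≤ ∑ j, s j := by
        have h1 : (2 : ℝ) ^ S₀ < 2 ^ (∑ j, s j + (e + 1)) := hS₀.trans_lt hMs
        have h2 := (pow_lt_pow_iff_right₀ (one_lt_two)).mp h1
        omega
      rw [if_pos hTs, ENNReal.tsum_eq_iSup_sum]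
      refine iSup_le fun A => ?_
      rw [← Finset.sum_filter, Finset.sum_const, nsmul_eq_mul]
      have hcard := lattice_box_card_le (by omega) hM0 hL s hMs (A.filter fun h => P h s)
        fun h hh j => by linarith [((Finset.mem_filter.mp hh).2.2 j).2]
      rw [← ENNReal.ofReal_natCast, ← ENNReal.ofReal_mul (by positivity),
        ← ENNReal.ofReal_mul (by positivity)]
      refine ENNReal.ofReal_le_ofReal ?_
      calc _ ≤ 8 ^ (e + 1) * 2 ^ (∑ j, s j) / M * (2 : ℝ) ^ (-β * (∑ j, s j : ℕ)) :=
            mul_le_mul_of_nonneg_right hcard (by positivity)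
        _ = 8 ^ (e + 1) / M * ((2 : ℝ) ^ ((∑ j, s j : ℕ) : ℝ) * (2 : ℝ) ^ (-β * (∑ j, s j : ℕ))) := by
            rw [Real.rpow_natCast]
            ring
        _ = _ := by
            rw [← Real.rpow_add (by norm_num)]
            congr 2
            rw [hδ]
            ring
    · push Not at hex
      simp [hex]
  calc _ ≤ ∑' h, ∑' s, (if P h s then ENNReal.ofReal ((2 : ℝ) ^ (-β * (∑ j, s j : ℕ))) else 0) :=
        ENNReal.tsum_le_tsum hterm
    _ = ∑' s, ∑' h, (if P h s then ENNReal.ofReal ((2 : ℝ) ^ (-β * (∑ j, s j : ℕ))) else 0) :=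
        ENNReal.tsum_comm
    _ ≤ ∑' s : Fin (e + 1) → ℕ, ENNReal.ofReal (8 ^ (e + 1) / M) * (if T ≤ ∑ j, s j then
          ENNReal.ofReal ((2 : ℝ) ^ (-δ * (∑ j, s j : ℕ))) else 0) := ENNReal.tsum_le_tsum hinner
    _ ≤ ENNReal.ofReal (8 ^ (e + 1) / M) *
          ENNReal.ofReal (C * ((S₀ + 1 : ℝ) ^ e * 2 ^ (-δ * S₀))) := by
        rw [ENNReal.tsum_mul_left]
        exact mul_le_mul_right (htail S₀) _
    _ ≤ _ := by
        rw [← ENNReal.ofReal_mul (by positivity)]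
        refine ENNReal.ofReal_le_ofReal ?_
        have hlogM : 0 ≤ Real.log M := Real.log_nonneg hM
        have h1 : (S₀ + 1 : ℝ) ≤ 2 * (1 + Real.log M) := by
          have h2 := Real.log_le_log (by positivity) hS₀
          rw [Real.log_pow] at h2
          have h3 := Real.log_two_gt_d9
          nlinarith [Nat.cast_nonneg (α := ℝ) S₀]
        have h2 : (2 : ℝ) ^ (-δ * S₀) ≤ 2 ^ δ * M ^ (-δ) := by
          have h3 : M ≤ 2 ^ ((S₀ : ℝ) + 1) := by
            have : (2 : ℝ) ^ ((S₀ : ℝ) + 1) = 2 ^ (S₀ + 1) := by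
              rw [← Real.rpow_natCast]; push_cast; rfl
            rw [this]; exact hS₀'.le
          have h4 := Real.rpow_le_rpow_of_nonpos hM0 h3 (by linarith : -δ ≤ 0)
          rw [← Real.rpow_mul (by norm_num)] at h4
          calc (2 : ℝ) ^ (-δ * S₀) = 2 ^ δ * 2 ^ (((S₀ : ℝ) + 1) * -δ) := by
                rw [← Real.rpow_add (by norm_num)]; congr 1; ring
            _ ≤ _ := mul_le_mul_of_nonneg_left h4 (by positivity)
        have h5 : M ^ (-β) = M⁻¹ * M ^ (-δ) := by
          rw [← Real.rpow_neg_one, ← Real.rpow_add hM0]; congr 1; rw [hδ]; ring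
        calc 8 ^ (e + 1) / M * (C * ((S₀ + 1 : ℝ) ^ e * 2 ^ (-δ * S₀)))
            ≤ 8 ^ (e + 1) / M * (C * ((2 * (1 + Real.log M)) ^ e * (2 ^ δ * M ^ (-δ)))) := by gcongr
          _ = _ := by
              rw [h5, mul_pow]
              ring

/-! ### A smooth window whose integer translates sum to one -/

/-- A smooth window supported in `[-1, 1]` whose integer translates sum to one. -/
def window (t : ℝ) : ℝ := Real.smoothTransition (t + 1) - Real.smoothTransition t

lemma continuous_window : Continuous window :=
  (Real.smoothTransition.continuous.comp (continuous_add_const 1)).sub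
    Real.smoothTransition.continuous

lemma contDiff_window : ContDiff ℝ (⊤ : ℕ∞) window :=
  (Real.smoothTransition.contDiff.comp (contDiff_id.add contDiff_const)).sub
    Real.smoothTransition.contDiff

lemma window_nonneg (t : ℝ) : 0 ≤ window t :=
  sub_nonneg.mpr (Real.smoothTransition.monotone (by linarith))

lemma window_le_one (t : ℝ) : window t ≤ 1 := by
  have h1 := Real.smoothTransition.le_one (t + 1)
  have h2 := Real.smoothTransition.nonneg t
  unfold window
  linarith

lemma window_eq_zero {t : ℝ} (h : 1 ≤ |t|) : window t = 0 := by
  unfold window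
  rcases le_abs.mp h with h | h
  · rw [Real.smoothTransition.one_of_one_le h, Real.smoothTransition.one_of_one_le (by linarith),
      sub_self]
  · rw [Real.smoothTransition.zero_of_nonpos (by linarith),
      Real.smoothTransition.zero_of_nonpos (by linarith), sub_self]

lemma window_add_window_sub_one {t : ℝ} (h0 : 0 ≤ t) (h1 : t ≤ 1) :
    window t + window (t - 1) = 1 := by
  unfold window
  rw [Real.smoothTransition.one_of_one_le (by linarith : 1 ≤ t + 1), sub_add_cancel,
    Real.smoothTransition.zero_of_nonpos (by linarith : t - 1 ≤ 0)]
  ring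

lemma hasCompactSupport_window : HasCompactSupport window :=
  HasCompactSupport.intro (isCompact_Icc (a := (-1 : ℝ)) (b := 1)) fun t ht => by
    refine window_eq_zero ?_
    by_contra hcon
    exact ht (abs_le.mp (not_le.mp hcon).le)

/-- The Fourier transform of the window. -/
def windowFourier (η : ℝ) : ℂ :=
  ∫ t : ℝ, (window t : ℂ) * Complex.exp (-(2 * Real.pi * Complex.I * (η * t : ℝ)))

/-- The window is smooth with compact support, hence a Schwartz function, and so is its Fourier
transform. -/
lemma exists_windowFourier_le (p : ℕ) :
    ∃ C : ℝ, 0 < C ∧ ∀ η, ‖windowFourier η‖ ≤ C * ((1 + |η|) ^ p)⁻¹ := by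
  have hc : HasCompactSupport fun t : ℝ => (window t : ℂ) :=
    hasCompactSupport_window.comp_left Complex.ofReal_zero
  have hd : ContDiff ℝ (⊤ : ℕ∞) fun t : ℝ => (window t : ℂ) :=
    Complex.ofRealCLM.contDiff.comp contDiff_window
  let f : SchwartzMap ℝ ℂ := hc.toSchwartzMap hd
  have hf : ∀ η, windowFourier η = FourierTransform.fourier f η := fun η => by
    rw [SchwartzMap.fourier_coe, Real.fourier_real_eq_integral_exp_smul, windowFourier]
    refine integral_congr_ae (Filter.Eventually.of_forall fun t => ?_)
    simp only [smul_eq_mul, f, HasCompactSupport.toSchwartzMap_toFun]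
    rw [mul_comm]
    congr 2
    push_cast
    ring
  have hsem := fun η => SchwartzMap.one_add_le_sup_seminorm_apply (𝕜 := ℝ) (m := (p, 0))
    (k := p) (n := 0) le_rfl le_rfl (FourierTransform.fourier f) η
  set D := 2 ^ p * ((Finset.Iic (p, 0)).sup fun m => SchwartzMap.seminorm ℝ m.1 m.2)
    (FourierTransform.fourier f) with hD
  have hD0 : 0 ≤ D := by positivity
  refine ⟨D + 1, by linarith, fun η => ?_⟩
  have h := hsem η
  rw [norm_iteratedFDeriv_zero, ← hf, Real.norm_eq_abs] at h
  have hpos : 0 < (1 + |η|) ^ p := by positivity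
  rw [← div_eq_mul_inv, le_div_iff₀ hpos, mul_comm]
  linarith

/-- Folding the integral onto `[0, 1]` replaces the window by the sum of its translates, which is
one. This is what makes the cubature sums exact on average over the shift. -/
lemma windowFourier_intCast (k : ℤ) : windowFourier k = if k = 0 then 1 else 0 := by
  set u : ℝ → ℂ := fun t => Complex.exp (-(2 * Real.pi * Complex.I * ((k : ℝ) * t : ℝ))) with hu
  have hucont : Continuous u := by
    rw [hu]
    fun_prop
  have hper : ∀ t, u (t - 1) = u t := fun t => by
    simp only [hu]
    rw [Complex.exp_eq_exp_iff_exists_int]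
    exact ⟨k, by push_cast; ring⟩
  have hw : Continuous fun t : ℝ => (window t : ℂ) := Complex.continuous_ofReal.comp continuous_window
  have hcont : Continuous fun t : ℝ => (window t : ℂ) * u t := hw.mul hucont
  have hcont' : Continuous fun t : ℝ => (window (t - 1) : ℂ) * u t :=
    (hw.comp (continuous_sub_right 1)).mul hucont
  have h1 : windowFourier k = ∫ t in (-1 : ℝ)..1, (window t : ℂ) * u t := by
    rw [windowFourier, intervalIntegral.integral_of_le (by norm_num)]
    symm
    refine setIntegral_eq_integral_of_forall_compl_eq_zero fun t ht => ?_
    rw [window_eq_zero, Complex.ofReal_zero, zero_mul]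
    by_contra hcon
    have := abs_lt.mp (not_le.mp hcon)
    exact ht ⟨this.1, this.2.le⟩
  have h2 : ∫ t in (-1 : ℝ)..0, (window t : ℂ) * u t =
      ∫ t in (0 : ℝ)..1, (window (t - 1) : ℂ) * u t := by
    have h3 := intervalIntegral.integral_comp_sub_right (a := 0) (b := 1)
      (fun t => (window t : ℂ) * u t) 1
    simp only [hper] at h3
    rw [h3]
    norm_num
  have h4 : windowFourier k = ∫ t in (0 : ℝ)..1, u t := by
    rw [h1, ← intervalIntegral.integral_add_adjacent_intervals (hcont.intervalIntegrable (-1) 0)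
      (hcont.intervalIntegrable 0 1), h2, ← intervalIntegral.integral_add
        (hcont'.intervalIntegrable 0 1) (hcont.intervalIntegrable 0 1)]
    refine intervalIntegral.integral_congr fun t ht => ?_
    rw [Set.uIcc_of_le zero_le_one] at ht
    have h5 := window_add_window_sub_one ht.1 ht.2
    rw [← add_mul, ← Complex.ofReal_add, add_comm (window (t - 1)), h5, Complex.ofReal_one, one_mul]
  rw [h4]
  split_ifs with hk
  · simp [hu, hk]
  · have hc : (-(2 * Real.pi * Complex.I * k) : ℂ) ≠ 0 := by
      simp [Real.pi_ne_zero, hk]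
    have h6 : ∀ t : ℝ, u t = Complex.exp (-(2 * Real.pi * Complex.I * k) * t) := fun t => by
      simp only [hu]
      congr 1
      push_cast
      ring
    simp only [h6]
    rw [integral_exp_mul_complex hc]
    have h7 : Complex.exp (-(2 * Real.pi * Complex.I * k) * (1 : ℝ)) = 1 := by
      rw [Complex.exp_eq_one_iff]
      exact ⟨-k, by push_cast; ring⟩
    rw [h7]
    simp

lemma starAbs_le_one_add_abs (η : ℝ) (k : ℤ) :
    ((max |k - ⌊η⌋| 1 : ℤ) : ℝ) ≤ 1 + |η - k| := by
  push_cast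
  refine max_le ?_ (by linarith [abs_nonneg (η - k)])
  have h1 := Int.floor_le η
  have h2 := (Int.lt_floor_add_one η).le
  have h3 := le_abs_self (η - k)
  have h4 := neg_le_abs (η - k)
  rw [abs_le]
  constructor <;> linarith

lemma one_add_abs_le_mul (η : ℝ) (k : ℤ) :
    1 + |η| ≤ 2 * ((max |k| 1 : ℤ) : ℝ) * (1 + |η - k|) := by
  have h1 := one_le_starAbs k
  have h2 : |(k : ℝ)| ≤ ((max |k| 1 : ℤ) : ℝ) := by
    push_cast
    exact le_max_left _ _
  have h3 : |η| ≤ |η - k| + |(k : ℝ)| := by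
    have := abs_add_le (η - k) k
    rwa [sub_add_cancel] at this
  nlinarith [abs_nonneg (η - k), abs_nonneg η]

/-- The weight at `k` is compared with the weight at `η` at the price of `(1 + |η - k|)^s`, which
the decay of the window transform absorbs, leaving a summable `(1 + |η - k|)^{-2}`. -/
lemma exists_tsum_windowFourier_le {s : ℝ} (hs : 0 ≤ s) :
    ∃ C : ℝ, 0 < C ∧ ∀ η : ℝ,
      ∑' k : ℤ, ENNReal.ofReal (((max |k| 1 : ℤ) : ℝ) ^ (-s) * ‖windowFourier (η - k)‖ ^ 2) ≤
        ENNReal.ofReal (C * (1 + |η|) ^ (-s)) := by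
  -- The transform enters squared, so the available decay `2p` exceeds the needed `s + 2`.
  obtain ⟨p, hp⟩ := exists_nat_ge (s + 2)
  obtain ⟨C, hC, hdecay⟩ := exists_windowFourier_le p
  have hsum := summable_starAbs_rpow (s := 2) (by norm_num)
  have hpos : ∀ k : ℤ, 0 < ((max |k| 1 : ℤ) : ℝ) := fun k =>
    zero_lt_one.trans_le (one_le_starAbs k)
  have hS : 0 ≤ ∑' k : ℤ, ((max |k| 1 : ℤ) : ℝ) ^ (-2 : ℝ) := tsum_nonneg fun k =>
    (Real.rpow_pos_of_pos (hpos k) _).le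
  set S := ∑' k : ℤ, ((max |k| 1 : ℤ) : ℝ) ^ (-2 : ℝ) with hSdef
  refine ⟨2 ^ s * C ^ 2 * (S + 1), by positivity, fun η => ?_⟩
  have hterm : ∀ k : ℤ, ((max |k| 1 : ℤ) : ℝ) ^ (-s) * ‖windowFourier (η - k)‖ ^ 2 ≤
      2 ^ s * C ^ 2 * (1 + |η|) ^ (-s) * ((max |k - ⌊η⌋| 1 : ℤ) : ℝ) ^ (-2 : ℝ) := by
    intro k
    have hx : 1 ≤ 1 + |η - k| := by linarith [abs_nonneg (η - k)]
    have hx0 : 0 < 1 + |η - k| := by linarith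
    have hη0 : 0 < 1 + |η| := by positivity
    have h1 : ((max |k| 1 : ℤ) : ℝ) ^ (-s) ≤ 2 ^ s * (1 + |η|) ^ (-s) * (1 + |η - k|) ^ s := by
      have h2 := Real.rpow_le_rpow hη0.le (one_add_abs_le_mul η k) hs
      rw [Real.mul_rpow (by have := hpos k; positivity) hx0.le,
        Real.mul_rpow (by norm_num) (hpos k).le] at h2
      rw [Real.rpow_neg (hpos k).le, Real.rpow_neg hη0.le]
      have h3 : 0 < ((max |k| 1 : ℤ) : ℝ) ^ s := Real.rpow_pos_of_pos (hpos k) s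
      have h4 : 0 < (1 + |η|) ^ s := by positivity
      rw [inv_eq_one_div, div_le_iff₀ h3]
      calc (1 : ℝ) = ((1 + |η|) ^ s)⁻¹ * (1 + |η|) ^ s := by field_simp
        _ ≤ ((1 + |η|) ^ s)⁻¹ * (2 ^ s * ((max |k| 1 : ℤ) : ℝ) ^ s * (1 + |η - k|) ^ s) :=
            mul_le_mul_of_nonneg_left h2 (by positivity)
        _ = _ := by ring
    have h5 : ‖windowFourier (η - k)‖ ^ 2 ≤ C ^ 2 * (1 + |η - k|) ^ (-(s + 2)) := by
      have h6 := pow_le_pow_left₀ (norm_nonneg _) (hdecay (η - k)) 2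
      refine h6.trans ?_
      rw [mul_pow]
      refine mul_le_mul_of_nonneg_left ?_ (by positivity)
      rw [inv_pow, ← pow_mul, Real.rpow_neg hx0.le]
      refine inv_anti₀ (by positivity) ?_
      rw [← Real.rpow_natCast]
      refine Real.rpow_le_rpow_of_exponent_le hx ?_
      push_cast
      linarith
    have h7 : (1 + |η - k|) ^ (-2 : ℝ) ≤ ((max |k - ⌊η⌋| 1 : ℤ) : ℝ) ^ (-2 : ℝ) :=
      Real.rpow_le_rpow_of_nonpos (hpos _) (starAbs_le_one_add_abs η k) (by norm_num)
    calc _ ≤ (2 ^ s * (1 + |η|) ^ (-s) * (1 + |η - k|) ^ s) *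
          (C ^ 2 * (1 + |η - k|) ^ (-(s + 2))) :=
          mul_le_mul h1 h5 (sq_nonneg _) (by positivity)
      _ = 2 ^ s * C ^ 2 * (1 + |η|) ^ (-s) * (1 + |η - k|) ^ (-2 : ℝ) := by
          have : (1 + |η - k|) ^ (-2 : ℝ) = (1 + |η - k|) ^ s * (1 + |η - k|) ^ (-(s + 2)) := by
            rw [← Real.rpow_add hx0]; congr 1; ring
          rw [this]; ring
      _ ≤ _ := mul_le_mul_of_nonneg_left h7 (by positivity)
  have hshift : Summable fun k : ℤ => ((max |k - ⌊η⌋| 1 : ℤ) : ℝ) ^ (-2 : ℝ) :=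
    (Equiv.subRight ⌊η⌋).summable_iff.mpr hsum
  have hshiftsum : ∑' k : ℤ, ((max |k - ⌊η⌋| 1 : ℤ) : ℝ) ^ (-2 : ℝ) = S :=
    (Equiv.subRight ⌊η⌋).tsum_eq fun k : ℤ => ((max |k| 1 : ℤ) : ℝ) ^ (-2 : ℝ)
  refine (ENNReal.tsum_le_tsum fun k => ENNReal.ofReal_le_ofReal (hterm k)).trans ?_
  rw [← ENNReal.ofReal_tsum_of_nonneg (fun k => mul_nonneg (by positivity)
    (Real.rpow_pos_of_pos (hpos _) _).le) (hshift.mul_left _), tsum_mul_left, hshiftsum]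
  refine ENNReal.ofReal_le_ofReal ?_
  have : 0 ≤ 2 ^ s * C ^ 2 * (1 + |η|) ^ (-s) := by positivity
  nlinarith

/-! ### Periodization of a function with bounded support -/

/-- The integer points of `[-K, K]^d`. -/
def integerBox (d K : ℕ) : Finset (Fin d → ℤ) :=
  Fintype.piFinset fun _ => Finset.Icc (-(K : ℤ)) K

lemma card_integerBox (d K : ℕ) : (integerBox d K).card = (2 * K + 1) ^ d := by
  rw [integerBox, Fintype.card_piFinset_const, Int.card_Icc]
  congr 1
  omega

/-- The sum of the translates of `f` by the integer points of `[-K, K]^d`, on the torus. -/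
def periodize {d : ℕ} (K : ℕ) (f : (Fin d → ℝ) → ℂ) (t : UnitAddTorus (Fin d)) : ℂ :=
  ∑ z ∈ integerBox d K, f (unitRep t + fun j => (z j : ℝ))

lemma mFourier_coe {d : ℕ} (h : Fin d → ℤ) (x : Fin d → ℝ) :
    UnitAddTorus.mFourier h (fun j => ((x j : ℝ) : UnitAddCircle)) =
      Complex.exp (2 * Real.pi * Complex.I * (∑ j, (h j : ℝ) * x j : ℝ)) := by
  simp only [UnitAddTorus.mFourier, ContinuousMap.coe_mk, fourier_coe_apply]
  rw [← Complex.exp_sum]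
  congr 1
  push_cast
  rw [Finset.mul_sum]
  refine Finset.sum_congr rfl fun j _ => ?_
  simp
  ring

lemma mFourier_unitRep {d : ℕ} (h : Fin d → ℤ) (t : UnitAddTorus (Fin d)) (z : Fin d → ℤ) :
    UnitAddTorus.mFourier h t =
      Complex.exp (2 * Real.pi * Complex.I *
        (∑ j, (h j : ℝ) * (unitRep t + fun j => (z j : ℝ)) j : ℝ)) := by
  rw [← mFourier_coe]
  congr 1
  funext j
  conv_lhs => rw [← coe_unitRep t]
  simp

lemma measurePreserving_unitRep_integral {d : ℕ} (f : (Fin d → ℝ) → ℂ) :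
    ∫ t : UnitAddTorus (Fin d), f (unitRep t) =
      ∫ x in {x : Fin d → ℝ | ∀ i, x i ∈ Set.Ioc (0 : ℝ) 1}, f x := by
  have hemb : MeasurableEmbedding (unitRep (d := d)) :=
    (MeasurableEmbedding.subtype_coe (MeasurableSet.univ_pi' (fun i => measurableSet_Ioc))).comp
      (UnitAddTorus.measurableEquivPiIoc (fun _ => (0 : ℝ))).measurableEmbedding
  exact measurePreserving_unitRep.integral_comp hemb f

/-- Unfolding: the exponential is invariant under integer shifts, and the half-open unit cubes at
the points of `[-K, K]^d` are disjoint and cover the support of `f`. -/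
lemma mFourierCoeff_periodize {d : ℕ} {K : ℕ} {f : (Fin d → ℝ) → ℂ} (hf : Continuous f)
    (hsupp : ∀ x : Fin d → ℝ, (∃ j, (K : ℝ) ≤ |x j|) → f x = 0) (h : Fin d → ℤ) :
    UnitAddTorus.mFourierCoeff (periodize K f) h =
      ∫ x, f x * Complex.exp (-(2 * Real.pi * Complex.I * (∑ j, (h j : ℝ) * x j : ℝ))) := by
  set F : (Fin d → ℝ) → ℂ := fun x =>
    f x * Complex.exp (-(2 * Real.pi * Complex.I * (∑ j, (h j : ℝ) * x j : ℝ))) with hF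
  have hFc : Continuous F := by
    rw [hF]
    fun_prop
  set Q : Set (Fin d → ℝ) := {x | ∀ i, x i ∈ Set.Ioc (0 : ℝ) 1} with hQ
  have hQm : MeasurableSet Q := MeasurableSet.univ_pi' fun i => measurableSet_Ioc
  have hFi : Integrable F := by
    refine hFc.integrable_of_hasCompactSupport (HasCompactSupport.intro
      (isCompact_Icc (a := fun _ : Fin d => -(K : ℝ)) (b := fun _ => (K : ℝ))) fun x hx => ?_)
    simp only [hF]
    rw [hsupp x, zero_mul]
    by_contra! hcon
    exact hx ⟨fun j => (abs_lt.mp (hcon j)).1.le, fun j => (abs_lt.mp (hcon j)).2.le⟩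
  have hcast : ∀ z : Fin d → ℤ, MeasurePreserving (fun x : Fin d → ℝ => x + fun j => (z j : ℝ)) :=
    fun z => measurePreserving_add_right volume _
  have hcemb : ∀ z : Fin d → ℤ, MeasurableEmbedding (fun x : Fin d → ℝ => x + fun j => (z j : ℝ)) :=
    fun z => measurableEmbedding_addRight _
  let U : (Fin d → ℤ) → Set (Fin d → ℝ) := fun z => {x | ∀ i, x i ∈ Set.Ioc (z i : ℝ) (z i + 1)}
  have hUm : ∀ z, MeasurableSet (U z) := fun z => MeasurableSet.univ_pi' fun i => measurableSet_Ioc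
  have hpre : ∀ z, (fun x : Fin d → ℝ => x + fun j => (z j : ℝ)) ⁻¹' U z = Q := fun z => by
    ext x
    simp only [U, hQ, Set.mem_preimage, Set.mem_ofPred_eq, Pi.add_apply, Set.mem_Ioc]
    refine forall_congr' fun i => and_congr ?_ ?_
    · constructor <;> intro h <;> linarith
    · constructor <;> intro h <;> linarith
  have hdisj : Pairwise (Function.onFun Disjoint U) := fun z z' hzz' => by
    rw [Function.onFun, Set.disjoint_left]
    intro x hx hx'
    refine hzz' (funext fun i => ?_)
    have e1 : ⌈x i⌉ = z i + 1 := by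
      rw [Int.ceil_eq_iff]
      push_cast
      exact ⟨by linarith [(hx i).1], (hx i).2⟩
    have e2 : ⌈x i⌉ = z' i + 1 := by
      rw [Int.ceil_eq_iff]
      push_cast
      exact ⟨by linarith [(hx' i).1], (hx' i).2⟩
    omega
  have h1 : UnitAddTorus.mFourierCoeff (periodize K f) h =
      ∑ z ∈ integerBox d K, ∫ x in Q, F (x + fun j => (z j : ℝ)) := by
    rw [UnitAddTorus.mFourierCoeff]
    have h2 : ∀ t : UnitAddTorus (Fin d), UnitAddTorus.mFourier (-h) t • periodize K f t =
        ∑ z ∈ integerBox d K, F (unitRep t + fun j => (z j : ℝ)) := fun t => by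
      rw [periodize, smul_eq_mul, Finset.mul_sum]
      refine Finset.sum_congr rfl fun z _ => ?_
      rw [mFourier_unitRep (-h) t z, hF, mul_comm]
      congr 2
      push_cast
      simp
    simp_rw [h2]
    rw [measurePreserving_unitRep_integral fun x => ∑ z ∈ integerBox d K, F (x + fun j => (z j : ℝ)),
      integral_finsetSum]
    intro z _
    exact ((hcast z).integrable_comp_of_integrable hFi).integrableOn
  have h3 : ∀ z, ∫ x in Q, F (x + fun j => (z j : ℝ)) = ∫ x in U z, F x := fun z => by
    rw [← hpre z]
    exact (hcast z).setIntegral_preimage_emb (hcemb z) F (U z)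
  rw [h1, Finset.sum_congr rfl fun z _ => h3 z,
    ← integral_biUnion_finset _ (fun z _ => hUm z) (hdisj.set_pairwise _)
      fun z _ => hFi.integrableOn]
  refine setIntegral_eq_integral_of_forall_compl_eq_zero fun x hx => ?_
  simp only [hF]
  rw [hsupp x, zero_mul]
  by_contra! hcon
  -- The cubes are open on the left and closed on the right, hence the ceiling minus one.
  refine hx (Set.mem_biUnion (x := fun i => ⌈x i⌉ - 1) ?_ ?_)
  · rw [Finset.mem_coe, integerBox, Fintype.mem_piFinset]
    intro i
    have hi := abs_lt.mp (hcon i)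
    have c1 : ⌈x i⌉ ≤ (K : ℤ) := Int.ceil_le.mpr (by exact_mod_cast hi.2.le)
    have c2 : -(K : ℤ) < ⌈x i⌉ := Int.lt_ceil.mpr (by push_cast; exact hi.1)
    rw [Finset.mem_Icc]
    omega
  · intro i
    have c1 := Int.le_ceil (x i)
    have c2 := Int.ceil_lt_add_one (x i)
    push_cast
    constructor <;> linarith

lemma memLp_periodize {d : ℕ} (K : ℕ) {f : (Fin d → ℝ) → ℂ} (hf : Continuous f) {R : ℝ}
    (hR : ∀ x, ‖f x‖ ≤ R) (a : ℂ) :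
    MemLp (fun t => periodize K f t - a) 2 (volume : Measure (UnitAddTorus (Fin d))) := by
  have hm : Measurable (periodize (d := d) K f) :=
    Finset.measurable_sum _ fun z _ => hf.measurable.comp (measurable_unitRep.add_const _)
  refine MemLp.of_bound (hm.sub_const a).aestronglyMeasurable ((integerBox d K).card * R + ‖a‖)
    (Filter.Eventually.of_forall fun t => ?_)
  refine (norm_sub_le _ _).trans (add_le_add_left ?_ _)
  refine (norm_sum_le _ _).trans ((Finset.sum_le_card_nsmul _ _ R fun z _ => hR _).trans_eq ?_)
  rw [nsmul_eq_mul]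

/-- **Parseval's identity** for the deviation of a periodization from its mean. -/
lemma lintegral_periodize_sub_mean {d : ℕ} {K : ℕ} {f : (Fin d → ℝ) → ℂ} (hf : Continuous f)
    {R : ℝ} (hR : ∀ x, ‖f x‖ ≤ R) (a : ℂ)
    (ha : UnitAddTorus.mFourierCoeff (periodize K f) 0 = a) :
    ∫⁻ t : UnitAddTorus (Fin d), ENNReal.ofReal (‖periodize K f t - a‖ ^ 2) =
      ∑' h : Fin d → ℤ, if h = 0 then 0 else
        ENNReal.ofReal (‖UnitAddTorus.mFourierCoeff (periodize K f) h‖ ^ 2) := by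
  have hL := memLp_periodize K hf hR a
  have hL0 := memLp_periodize K hf hR 0
  simp only [sub_zero] at hL0
  have hsum := hasSum_sq_mFourierCoeff_of_memLp hL
  have hint : Integrable (fun t : UnitAddTorus (Fin d) => ‖periodize K f t - a‖ ^ 2) volume :=
    hL.integrable_norm_pow (by norm_num)
  rw [← ofReal_integral_eq_lintegral_ofReal hint (Filter.Eventually.of_forall fun t => sq_nonneg _),
    ← hsum.tsum_eq, ENNReal.ofReal_tsum_of_nonneg (fun _ => sq_nonneg _) hsum.summable]
  refine tsum_congr fun h => ?_
  have hconst : UnitAddTorus.mFourierCoeff (fun _ : UnitAddTorus (Fin d) => a) h =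
      if h = 0 then a else 0 := by
    have h1 := (orthonormal_iff_ite.mp (UnitAddTorus.orthonormal_mFourier (d := Fin d))) h 0
    simp only [ContinuousMap.inner_toLp, UnitAddTorus.mFourier_zero] at h1
    simp only [UnitAddTorus.mFourierCoeff, smul_eq_mul, integral_mul_const]
    have h2 : ∫ t : UnitAddTorus (Fin d), UnitAddTorus.mFourier (-h) t = if h = 0 then 1 else 0 := by
      rw [← h1]
      refine integral_congr_ae (Filter.Eventually.of_forall fun t => ?_)
      simp [UnitAddTorus.mFourier_neg]
    rw [h2]
    split_ifs <;> simp
  have hsub : UnitAddTorus.mFourierCoeff (fun t => periodize K f t - a) h =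
      UnitAddTorus.mFourierCoeff (periodize K f) h - if h = 0 then a else 0 := by
    rw [← hconst]
    simp only [UnitAddTorus.mFourierCoeff, smul_eq_mul, mul_sub]
    exact integral_sub (integrable_mFourier_mul (hL0.integrable (by norm_num)) _)
      (integrable_mFourier_mul (integrable_const a) _)
  rw [hsub]
  split_ifs with hh
  · rw [hh, ha]
    simp
  · simp

/-! ### Cubature formulas of Frolov type -/

/-- The windowed exponential of frequency `k`, in the coordinates given by the matrix `A`. -/
def latticeWindow {d : ℕ} (A : Matrix (Fin d) (Fin d) ℝ) (k : Fin d → ℤ) (x : Fin d → ℝ) : ℂ :=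
  ((|A.det| * ∏ j, window (A.mulVec x j) : ℝ) : ℂ) *
    Complex.exp (2 * Real.pi * Complex.I * (∑ j, (k j : ℝ) * A.mulVec x j : ℝ))

lemma continuous_mulVec_apply {d : ℕ} (A : Matrix (Fin d) (Fin d) ℝ) (j : Fin d) :
    Continuous fun x : Fin d → ℝ => A.mulVec x j := by
  unfold Matrix.mulVec dotProduct
  fun_prop

lemma continuous_latticeWindow {d : ℕ} (A : Matrix (Fin d) (Fin d) ℝ) (k : Fin d → ℤ) :
    Continuous (latticeWindow A k) := by
  have h := continuous_mulVec_apply A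
  have hw := continuous_window
  unfold latticeWindow
  fun_prop

lemma norm_latticeWindow_le {d : ℕ} (A : Matrix (Fin d) (Fin d) ℝ) (k : Fin d → ℤ)
    (x : Fin d → ℝ) : ‖latticeWindow A k x‖ ≤ |A.det| := by
  have h1 : 0 ≤ ∏ j, window (A.mulVec x j) := Finset.prod_nonneg fun j _ => window_nonneg _
  have h2 : ∏ j, window (A.mulVec x j) ≤ 1 :=
    Finset.prod_le_one (fun j _ => window_nonneg _) fun j _ => window_le_one _
  have h3 : ‖Complex.exp (2 * Real.pi * Complex.I * (∑ j, (k j : ℝ) * A.mulVec x j : ℝ))‖ = 1 := by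
    rw [Complex.norm_exp]
    simp
  rw [latticeWindow, norm_mul, h3, mul_one, Complex.norm_real,
    Real.norm_of_nonneg (mul_nonneg (abs_nonneg _) h1)]
  exact mul_le_of_le_one_right (abs_nonneg _) h2

lemma integral_comp_mulVec {d : ℕ} {A : Matrix (Fin d) (Fin d) ℝ} (hA : A.det ≠ 0)
    {G : (Fin d → ℝ) → ℂ} (hG : Continuous G) :
    ((|A.det| : ℝ) : ℂ) * ∫ x, G (A.mulVec x) = ∫ y, G y := by
  have h := Real.map_matrix_volume_pi_eq_smul_volume_pi hA
  have h1 : ∫ y, G y ∂(Measure.map (Matrix.toLin' A) volume) = ∫ x, G (A.mulVec x) := by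
    rw [integral_map (LinearMap.continuous_of_finiteDimensional _).aemeasurable
      hG.aestronglyMeasurable]
    simp only [Matrix.toLin'_apply]
  rw [h, integral_smul_measure, ENNReal.toReal_ofReal (abs_nonneg _)] at h1
  rw [← h1, Complex.real_smul, ← mul_assoc, ← Complex.ofReal_mul, ← abs_mul, mul_inv_cancel₀ hA]
  simp

/-- In the coordinates `y = A x` the frequency `h` becomes `D h`, because `Dᵀ A = 1`; the integrand
is then a product of one-variable functions, and `|det A|` is the Jacobian. -/
lemma integral_latticeWindow {d : ℕ} {A D : Matrix (Fin d) (Fin d) ℝ} (hA : A.det ≠ 0)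
    (hDA : D.transpose * A = 1) (k h : Fin d → ℤ) :
    ∫ x, latticeWindow A k x *
        Complex.exp (-(2 * Real.pi * Complex.I * (∑ j, (h j : ℝ) * x j : ℝ))) =
      ∏ j, windowFourier (D.mulVec (fun i => (h i : ℝ)) j - k j) := by
  set G : (Fin d → ℝ) → ℂ := fun y => ∏ j, ((window (y j) : ℂ) * Complex.exp
    (-(2 * Real.pi * Complex.I * ((D.mulVec (fun i => (h i : ℝ)) j - k j) * y j : ℝ)))) with hG
  have hGc : Continuous G := by
    have hw := continuous_window
    rw [hG]
    fun_prop
  have h1 : ∀ x, latticeWindow A k x *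
      Complex.exp (-(2 * Real.pi * Complex.I * (∑ j, (h j : ℝ) * x j : ℝ))) =
      ((|A.det| : ℝ) : ℂ) * G (A.mulVec x) := fun x => by
    have hx : ∑ j, (h j : ℝ) * x j = ∑ j, D.mulVec (fun i => (h i : ℝ)) j * A.mulVec x j := by
      have e1 : x = D.transpose.mulVec (A.mulVec x) := by
        rw [Matrix.mulVec_mulVec, hDA, Matrix.one_mulVec]
      have e2 : (fun i => (h i : ℝ)) ⬝ᵥ x = D.mulVec (fun i => (h i : ℝ)) ⬝ᵥ A.mulVec x := by
        conv_lhs => rw [e1]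
        rw [Matrix.dotProduct_mulVec, Matrix.vecMul_transpose]
      exact e2
    simp only [hG, latticeWindow]
    rw [hx, Finset.prod_mul_distrib, ← Complex.exp_sum, mul_assoc, ← Complex.exp_add]
    push_cast
    rw [mul_assoc]
    congr 3
    rw [Finset.mul_sum, Finset.mul_sum, ← Finset.sum_neg_distrib, ← Finset.sum_add_distrib]
    refine Finset.sum_congr rfl fun j _ => ?_
    ring
  simp_rw [h1]
  rw [integral_const_mul, integral_comp_mulVec hA hGc, hG]
  exact integral_fintype_prod_volume_eq_prod fun j (y : ℝ) => (window y : ℂ) * Complex.exp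
    (-(2 * Real.pi * Complex.I * ((D.mulVec (fun i => (h i : ℝ)) j - k j) * y : ℝ)))

lemma latticeWindow_eq_zero {d : ℕ} {A D : Matrix (Fin d) (Fin d) ℝ} (hDA : D.transpose * A = 1)
    {K : ℝ} (hD : ∀ j, ∑ i, |D i j| < K) (k : Fin d → ℤ) (x : Fin d → ℝ)
    (hx : ∃ j, K ≤ |x j|) : latticeWindow A k x = 0 := by
  obtain ⟨j, hj⟩ := hx
  have hex : ∃ i, 1 ≤ |A.mulVec x i| := by
    by_contra! hcon
    have e1 : x = D.transpose.mulVec (A.mulVec x) := by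
      rw [Matrix.mulVec_mulVec, hDA, Matrix.one_mulVec]
    have e2 : |x j| ≤ ∑ i, |D i j| := by
      conv_lhs => rw [e1]
      rw [Matrix.mulVec, dotProduct]
      refine (Finset.abs_sum_le_sum_abs _ _).trans (Finset.sum_le_sum fun i _ => ?_)
      rw [abs_mul, Matrix.transpose_apply]
      exact mul_le_of_le_one_right (abs_nonneg _) (hcon i).le
    linarith [hD j]
  obtain ⟨i, hi⟩ := hex
  rw [latticeWindow, Finset.prod_eq_zero (Finset.mem_univ i) (window_eq_zero hi)]
  simp

lemma exists_tsum_mixedWeight_windowFourier_le (d : ℕ) {s : ℝ} (hs : 0 ≤ s) :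
    ∃ C : ℝ, 0 < C ∧ ∀ η : Fin d → ℝ,
      ∑' k : Fin d → ℤ, ENNReal.ofReal (mixedWeight (-s) k) *
        ENNReal.ofReal (‖∏ j, windowFourier (η j - k j)‖ ^ 2) ≤
      ENNReal.ofReal (C * ∏ j, (1 + |η j|) ^ (-s)) := by
  obtain ⟨C, hC, h⟩ := exists_tsum_windowFourier_le hs
  refine ⟨C ^ d, by positivity, fun η => ?_⟩
  have hpos : ∀ k : ℤ, 0 ≤ ((max |k| 1 : ℤ) : ℝ) ^ (-s) := fun k =>
    (Real.rpow_pos_of_pos (zero_lt_one.trans_le (one_le_starAbs _)) _).le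
  have h1 : ∀ k : Fin d → ℤ, ENNReal.ofReal (mixedWeight (-s) k) *
      ENNReal.ofReal (‖∏ j, windowFourier (η j - k j)‖ ^ 2) =
      ∏ j, ENNReal.ofReal (((max |k j| 1 : ℤ) : ℝ) ^ (-s) * ‖windowFourier (η j - k j)‖ ^ 2) :=
    fun k => by
    rw [← ENNReal.ofReal_mul (mixedWeight_pos _ _).le, ← ENNReal.ofReal_prod_of_nonneg fun j _ =>
      mul_nonneg (hpos _) (sq_nonneg _), Finset.prod_mul_distrib, norm_prod, Finset.prod_pow]
    rfl
  simp_rw [h1]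
  rw [tsum_pi_prod fun (j : Fin d) (a : ℤ) => ENNReal.ofReal (((max |a| 1 : ℤ) : ℝ) ^ (-s) *
    ‖windowFourier (η j - a)‖ ^ 2)]
  refine (Finset.prod_le_prod' fun j _ => h (η j)).trans_eq ?_
  rw [← ENNReal.ofReal_prod_of_nonneg fun j _ => by positivity, Finset.prod_mul_distrib]
  simp

/-- The left side is the squared norm of the error functional on the class. The nodes are `A (t +
z)` with window weights, so for each `k` the sum over the nodes is the periodization of
`latticeWindow A k` at `t`. Averaging over `t` removes the mean, which is exact, and leaves the dual
lattice points `L h`, `h ≠ 0`. -/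
theorem exists_cubature (e : ℕ) {r : ℝ} (hr : 1 / 2 < r) :
    ∃ (C : ℝ) (K₀ : ℕ), 0 < C ∧ 1 ≤ K₀ ∧ ∀ K : ℕ, K₀ ≤ K →
      ∃ (ξ : integerBox (e + 1) K → cube (e + 1)) (lam : integerBox (e + 1) K → ℝ),
        ∑' k : Fin (e + 1) → ℤ, ENNReal.ofReal (mixedWeight (-(2 * r)) k) *
          ENNReal.ofReal (‖(∑ z, (lam z : ℂ) * character k (ξ z)) - if k = 0 then 1 else 0‖ ^ 2) ≤
        ENNReal.ofReal (C * ((K : ℝ) ^ (-(2 * r * (e + 1))) * (1 + Real.log K) ^ e)) := by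
  classical
  obtain ⟨B, hBdet, hB⟩ := exists_frolov_matrix (d := e + 1) (by omega)
  -- With the dilation `a = K / κ`, every column sum of `|D|` is below `K`, so the window is
  -- supported inside `[-K, K]^d` and the `(2K + 1)^d` translates suffice.
  obtain ⟨κ, hκ⟩ := exists_nat_gt (∑ j, ∑ i, |B i j| + 1)
  have hBnn : 0 ≤ ∑ j, ∑ i, |B i j| :=
    Finset.sum_nonneg fun j _ => Finset.sum_nonneg fun i _ => abs_nonneg _
  have hκ1 : (1 : ℝ) < κ := by linarith
  have hκ0 : (0 : ℝ) < κ := by linarith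
  obtain ⟨C₁, hC₁, hwin⟩ := exists_tsum_mixedWeight_windowFourier_le (e + 1)
    (s := 2 * r) (by linarith)
  obtain ⟨C₂, hC₂, hlat⟩ := exists_lattice_sum_le e (β := 2 * r) (by linarith)
  refine ⟨C₁ * C₂ * ((κ : ℝ) ^ (2 * r * (e + 1)) * (e + 1) ^ e), κ, by positivity,
    by exact_mod_cast hκ1.le, fun K hK => ?_⟩
  have hKκ : (κ : ℝ) ≤ K := by exact_mod_cast hK
  have hK0 : (0 : ℝ) < K := by linarith
  set a : ℝ := K / κ with ha
  have ha1 : 1 ≤ a := (one_le_div hκ0).mpr hKκ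
  have ha0 : 0 < a := by linarith
  set D : Matrix (Fin (e + 1)) (Fin (e + 1)) ℝ := a • B with hD
  have hDdet : D.transpose.det ≠ 0 := by
    rw [Matrix.det_transpose, hD, Matrix.det_smul]
    exact mul_ne_zero (pow_ne_zero _ ha0.ne') hBdet
  set A := D.transpose⁻¹ with hA
  have hDA : D.transpose * A = 1 := Matrix.mul_nonsing_inv _ (isUnit_iff_ne_zero.mpr hDdet)
  have hAdet : A.det ≠ 0 := by
    intro h0
    have := congrArg Matrix.det hDA
    rw [Matrix.det_mul, h0, mul_zero, Matrix.det_one] at this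
    exact zero_ne_one this
  let L : (Fin (e + 1) → ℤ) →+ (Fin (e + 1) → ℝ) :=
    AddMonoidHom.mk' (fun h => D.mulVec fun i => (h i : ℝ)) fun h h' => by
      rw [← Matrix.mulVec_add]
      congr 1
      funext i
      simp
  have hLapp : ∀ h j, L h j = D.mulVec (fun i => (h i : ℝ)) j := fun h j => rfl
  set M : ℝ := a ^ (e + 1) with hM
  have hM1 : 1 ≤ M := one_le_pow₀ ha1
  have hM0 : 0 < M := by linarith
  have hL : ∀ h, h ≠ 0 → M ≤ ∏ j, |L h j| := fun h hh => by
    have h1 : ∏ j, |L h j| = M * ∏ j, |B.mulVec (fun i => (h i : ℝ)) j| := by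
      simp only [hLapp, hD, Matrix.smul_mulVec, Pi.smul_apply, smul_eq_mul, abs_mul,
        Finset.prod_mul_distrib, abs_of_pos ha0]
      simp [hM]
    rw [h1]
    exact le_mul_of_one_le_right hM0.le (hB h hh)
  have hsupp : ∀ (k : Fin (e + 1) → ℤ) (x : Fin (e + 1) → ℝ), (∃ j, (K : ℝ) ≤ |x j|) →
      latticeWindow A k x = 0 := fun k x hx => by
    refine latticeWindow_eq_zero hDA (fun j => ?_) k x hx
    have h1 : ∑ i, |D i j| = a * ∑ i, |B i j| := by
      simp [hD, abs_mul, abs_of_pos ha0, Finset.mul_sum]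
    have h2 : ∑ i, |B i j| ≤ ∑ j, ∑ i, |B i j| :=
      Finset.single_le_sum (f := fun j => ∑ i, |B i j|)
        (fun j _ => Finset.sum_nonneg fun i _ => abs_nonneg _) (Finset.mem_univ j)
    rw [h1, ha, div_mul_eq_mul_div, div_lt_iff₀ hκ0]
    exact mul_lt_mul_of_pos_left (by linarith) hK0
  have hcoef : ∀ k h, UnitAddTorus.mFourierCoeff (periodize K (latticeWindow A k)) h =
      ∏ j, windowFourier (L h j - k j) := fun k h => by
    rw [mFourierCoeff_periodize (continuous_latticeWindow A k) (hsupp k) h,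
      integral_latticeWindow hAdet hDA]
    rfl
  have hmean : ∀ k : Fin (e + 1) → ℤ,
      UnitAddTorus.mFourierCoeff (periodize K (latticeWindow A k)) 0 = if k = 0 then 1 else 0 :=
    fun k => by
    have h1 : ∀ j, windowFourier (L 0 j - k j) = if k j = 0 then 1 else 0 := fun j => by
      rw [map_zero, Pi.zero_apply, zero_sub, ← Int.cast_neg, windowFourier_intCast]
      simp
    rw [hcoef]
    simp_rw [h1]
    split_ifs with hk
    · simp [hk]
    · obtain ⟨j, hj⟩ := Function.ne_iff.mp hk
      exact Finset.prod_eq_zero (Finset.mem_univ j) (if_neg hj)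
  set E : (Fin (e + 1) → ℤ) → UnitAddTorus (Fin (e + 1)) → ℝ≥0∞ := fun k t =>
    ENNReal.ofReal (mixedWeight (-(2 * r)) k) * ENNReal.ofReal
      (‖periodize K (latticeWindow A k) t - if k = 0 then 1 else 0‖ ^ 2) with hE
  have hEm : ∀ k, Measurable (E k) := fun k => by
    have hm : Measurable (periodize K (latticeWindow A k)) :=
      Finset.measurable_sum _ fun z _ => (continuous_latticeWindow A k).measurable.comp
        (measurable_unitRep.add_const _)
    exact ((hm.sub_const _).norm.pow_const 2).ennreal_ofReal.const_mul _
  have hmain : ∫⁻ t : UnitAddTorus (Fin (e + 1)), ∑' k, E k t ≤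
      ENNReal.ofReal (C₁ * (C₂ * (M ^ (-(2 * r)) * (1 + Real.log M) ^ e))) := by
    have h1 : ∀ k, ∫⁻ t : UnitAddTorus (Fin (e + 1)), E k t =
        ∑' h : Fin (e + 1) → ℤ, if h = 0 then 0 else ENNReal.ofReal (mixedWeight (-(2 * r)) k) *
          ENNReal.ofReal (‖∏ j, windowFourier (L h j - k j)‖ ^ 2) := fun k => by
      have hm : Measurable (periodize K (latticeWindow A k)) :=
        Finset.measurable_sum _ fun z _ => (continuous_latticeWindow A k).measurable.comp
          (measurable_unitRep.add_const _)
      simp only [hE]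
      rw [lintegral_const_mul _ ((hm.sub_const _).norm.pow_const 2).ennreal_ofReal,
        lintegral_periodize_sub_mean (continuous_latticeWindow A k) (norm_latticeWindow_le A k) _
          (hmean k), ← ENNReal.tsum_mul_left]
      refine tsum_congr fun h => ?_
      rw [hcoef]
      split_ifs <;> simp
    rw [lintegral_tsum fun k => (hEm k).aemeasurable]
    simp_rw [h1]
    -- For fixed `h` the sum over `k` is a weighted window sum centred at `L h`; only then is the
    -- sum over the lattice taken.
    rw [ENNReal.tsum_comm]
    calc _ ≤ ∑' h : Fin (e + 1) → ℤ, ENNReal.ofReal C₁ * (if h = 0 then 0 else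
          ENNReal.ofReal (∏ j, (1 + |L h j|) ^ (-(2 * r)))) := by
          refine ENNReal.tsum_le_tsum fun h => ?_
          split_ifs with hh
          · simp
          · rw [← ENNReal.ofReal_mul hC₁.le]
            exact hwin (L h)
      _ ≤ ENNReal.ofReal C₁ * ENNReal.ofReal (C₂ * (M ^ (-(2 * r)) * (1 + Real.log M) ^ e)) := by
          rw [ENNReal.tsum_mul_left]
          exact mul_le_mul_right (hlat L M hM1 hL) _
      _ = _ := (ENNReal.ofReal_mul hC₁.le).symm
  -- The torus has total mass one, so some shift is no worse than the average, simultaneously for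
  -- all `k` because the weighted errors were summed first.
  obtain ⟨t₀, ht₀⟩ := exists_le_lintegral (μ := (volume : Measure (UnitAddTorus (Fin (e + 1)))))
    (f := fun t => ∑' k, E k t) (Measurable.tsum hEm).aemeasurable
  let node : (Fin (e + 1) → ℤ) → Fin (e + 1) → ℝ := fun z =>
    A.mulVec (unitRep t₀ + fun j => (z j : ℝ))
  have hcube : ∀ t : UnitAddTorus (Fin (e + 1)), fromTorus t ∈ cube (e + 1) := fun t => by
    have h1 := unitRep_mem t
    refine ⟨fun j => ?_, fun j => ?_⟩
    · exact mul_nonneg (by positivity) (h1 j).1.le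
    · exact mul_le_of_le_one_right (by positivity) (h1 j).2
  -- The nodes are reduced modulo `2π` into the cube, which changes no character value.
  refine ⟨fun z => ⟨fromTorus (toTorus ((2 * Real.pi) • node z)), hcube _⟩,
    fun z => |A.det| * ∏ j, window (node z j), ?_⟩
  have hper : ∀ k, ∑ z : integerBox (e + 1) K, ((|A.det| * ∏ j, window (node z j) : ℝ) : ℂ) *
      character k (fromTorus (toTorus ((2 * Real.pi) • node z))) =
      periodize K (latticeWindow A k) t₀ := fun k => by
    rw [periodize]
    refine (Finset.sum_congr rfl fun z _ => ?_).trans (Finset.sum_coe_sort (integerBox (e + 1) K)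
      fun z => latticeWindow A k (unitRep t₀ + fun j => (z j : ℝ)))
    rw [latticeWindow, ← mFourier_toTorus, toTorus_fromTorus, mFourier_toTorus, character]
    congr 2
    simp only [Pi.smul_apply, smul_eq_mul, node]
    push_cast
    rw [Finset.mul_sum, Finset.mul_sum]
    refine Finset.sum_congr rfl fun j _ => ?_
    ring
  simp only [hper]
  refine (ht₀.trans hmain).trans (ENNReal.ofReal_le_ofReal ?_)
  have hlogK : 0 ≤ Real.log K := Real.log_nonneg (by linarith)
  have hMr : M ^ (-(2 * r)) = (κ : ℝ) ^ (2 * r * (e + 1)) * (K : ℝ) ^ (-(2 * r * (e + 1))) := by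
    have e1 : M = a ^ ((e : ℝ) + 1) := by
      rw [hM, ← Real.rpow_natCast]; push_cast; rfl
    rw [e1, ← Real.rpow_mul ha0.le, ha, Real.div_rpow hK0.le hκ0.le,
      show ((e : ℝ) + 1) * -(2 * r) = -(2 * r * (e + 1)) by ring, Real.rpow_neg hκ0.le,
      div_inv_eq_mul, mul_comm]
  have hlogM : 1 + Real.log M ≤ (e + 1) * (1 + Real.log K) := by
    rw [hM, Real.log_pow, ha, Real.log_div hK0.ne' hκ0.ne']
    have := Real.log_nonneg hκ1.le
    push_cast
    nlinarith [Nat.cast_nonneg (α := ℝ) e]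
  have hlogM0 : 0 ≤ 1 + Real.log M := by linarith [Real.log_nonneg hM1]
  calc _ ≤ C₁ * (C₂ * (M ^ (-(2 * r)) * ((e + 1) * (1 + Real.log K)) ^ e)) := by gcongr
    _ = _ := by rw [hMr, mul_pow]; ring

/-! ### The upper bound -/

/-- Surplus nodes are placed at the origin with weight zero. -/
lemma optimalError_le_of_card_le {d m : ℕ} {ι : Type*} [Fintype ι] (hι : Fintype.card ι ≤ m)
    {W : Set ((Fin d → ℝ) → ℂ)} {q : ℝ} {B : ℝ≥0∞} (ξ : ι → cube d) (lam : ι → ℝ)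
    (h : ∀ f ∈ W, ENNReal.ofReal
      |(∫ x, ‖f x‖ ^ q ∂(cubeMeasure d)) - ∑ i, lam i * ‖f (ξ i)‖ ^ q| ≤ B) :
    optimalError m W q ≤ B := by
  obtain ⟨g⟩ : Nonempty (ι ↪ Fin m) :=
    Function.Embedding.nonempty_of_card_le (by rwa [Fintype.card_fin])
  have h0 : (fun _ => 0 : Fin d → ℝ) ∈ cube d := ⟨fun _ => le_rfl, fun _ => by positivity⟩
  refine iInf₂_le_of_le (Function.extend g ξ fun _ => ⟨_, h0⟩) (Function.extend g lam 0)
    (iSup₂_le fun f hf => ?_)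
  rw [weightedError, ← Fintype.sum_of_injective g g.injective
    (fun i => lam i * ‖f (ξ i)‖ ^ q) _ (fun j hj => ?_) fun i => ?_]
  · exact h f hf
  · rw [Function.extend_apply' _ _ _ hj, Pi.zero_apply, zero_mul]
  · rw [g.injective.extend_apply, g.injective.extend_apply]

/-- The cubature error is `∑ c_k w(k)^{-r} E_k`, with `E_k` the error on the character of frequency
`k`; Cauchy–Schwarz gives the bound. -/
lemma abs_integral_sub_sum_le {d : ℕ} {r R Q : ℝ} (hr : 1 / 2 < r) (hQ : 0 ≤ Q)
    {g : (Fin d → ℝ) → ℝ} (hg : HasMixedSeries r R fun x => (g x : ℂ)) {ι : Type*} [Fintype ι]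
    (ξ : ι → cube d) (lam : ι → ℝ)
    (h : ∑' k : Fin d → ℤ, ENNReal.ofReal (mixedWeight (-(2 * r)) k) * ENNReal.ofReal
      (‖(∑ z, (lam z : ℂ) * character k (ξ z)) - if k = 0 then 1 else 0‖ ^ 2) ≤
        ENNReal.ofReal Q) :
    |(∫ x, g x ∂(cubeMeasure d)) - ∑ z, lam z * g (ξ z)| ≤ √(R * Q) := by
  obtain ⟨c, hc, hcR, hsum⟩ := hg
  set E : (Fin d → ℤ) → ℂ := fun k =>
    (∑ z, (lam z : ℂ) * character k (ξ z)) - if k = 0 then 1 else 0 with hE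
  set v : (Fin d → ℤ) → ℝ := fun k => mixedWeight (-r) k * ‖E k‖ with hv
  have hv2 : ∀ k, ENNReal.ofReal (v k ^ 2) =
      ENNReal.ofReal (mixedWeight (-(2 * r)) k) * ENNReal.ofReal (‖E k‖ ^ 2) := fun k => by
    rw [← ENNReal.ofReal_mul (mixedWeight_pos _ _).le, hv, mul_pow, mixedWeight_sq, mul_neg]
  have h' : ∑' k, ENNReal.ofReal (v k ^ 2) ≤ ENNReal.ofReal Q := by simpa only [hv2] using h
  have hvs : Summable fun k => v k ^ 2 := by
    have := ENNReal.summable_toReal (ne_top_of_le_ne_top ENNReal.ofReal_ne_top h')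
    simpa only [ENNReal.toReal_ofReal (sq_nonneg _)] using this
  have hvQ : ∑' k, v k ^ 2 ≤ Q := by
    rw [← ENNReal.ofReal_tsum_of_nonneg (fun k => sq_nonneg _) hvs] at h'
    exact (ENNReal.ofReal_le_ofReal_iff hQ).mp h'
  have hint : ((∫ x, g x ∂(cubeMeasure d) : ℝ) : ℂ) = c 0 := by
    rw [← integral_complex_ofReal,
      hasSum_integral_mixedSeries (summable_norm_mixedSeries hr hc) hsum, mixedWeight_zero]
    simp
  have h1 : HasSum (fun k => c k * (mixedWeight (-r) k : ℂ) * E k)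
      ((∑ z, (lam z : ℂ) * (g (ξ z) : ℂ)) - c 0) := by
    have e1 := hasSum_sum (s := Finset.univ) fun z _ => (hsum (ξ z)).mul_left (lam z : ℂ)
    have e2 : HasSum (fun k : Fin d → ℤ => if k = 0 then c 0 else 0) (c 0) :=
      hasSum_ite_eq 0 (c 0)
    suffices e3 : (fun k => c k * (mixedWeight (-r) k : ℂ) * E k) = fun k =>
        (∑ z, (lam z : ℂ) * (c k * (mixedWeight (-r) k : ℂ) * character k (ξ z))) -
          if k = 0 then c 0 else 0 by
      rw [e3]
      exact e1.sub e2
    funext k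
    rw [hE, mul_sub, Finset.mul_sum]
    congr 1
    · exact Finset.sum_congr rfl fun z _ => by ring
    · split_ifs with hk
      · rw [hk, mixedWeight_zero]; simp
      · simp
  have h2 : ∀ k, ‖c k * (mixedWeight (-r) k : ℂ) * E k‖ = ‖c k‖ * v k := fun k => by
    rw [norm_mul, norm_mul, Complex.norm_real, Real.norm_of_nonneg (mixedWeight_pos _ _).le,
      mul_assoc]
  have h3 : |(∫ x, g x ∂(cubeMeasure d)) - ∑ z, lam z * g (ξ z)| ≤ ∑' k, ‖c k‖ * v k := by
    rw [abs_sub_comm, ← Real.norm_eq_abs, ← Complex.norm_real]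
    push_cast
    rw [hint, ← h1.tsum_eq]
    simp_rw [← h2]
    refine norm_tsum_le_tsum_norm ?_
    simp_rw [h2]
    exact summable_mul_of_sq hc hvs
  refine h3.trans (Real.le_sqrt_of_sq_le ?_)
  exact (sq_tsum_mul_le hc hvs).trans
    (mul_le_mul hcR hvQ (tsum_nonneg fun _ => sq_nonneg _)
      ((tsum_nonneg fun _ => sq_nonneg _).trans hcR))

lemma rate_pos (d : ℕ) (r : ℝ) {m : ℕ} (hm : 2 ≤ m) : 0 < rate d r m := by
  have h2 : (2 : ℝ) ≤ m := by exact_mod_cast hm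
  exact mul_pos (Real.rpow_pos_of_pos (by linarith) _)
    (Real.rpow_pos_of_pos (Real.log_pos (by linarith)) _)

lemma exists_frolov_rate_le (e : ℕ) {r : ℝ} (hr : 0 < r) :
    ∃ C : ℝ, 0 < C ∧ ∀ m K : ℕ, 2 ≤ m → 1 ≤ K → K ≤ m → m < (2 * K + 3) ^ (e + 1) →
      (K : ℝ) ^ (-(2 * r * (e + 1))) * (1 + Real.log K) ^ e ≤ C * rate (e + 1) r m ^ 2 := by
  have hl2 : 0 < Real.log 2 := Real.log_pos one_lt_two
  refine ⟨5 ^ (2 * r * (e + 1)) * (1 / Real.log 2 + 1) ^ e, by positivity,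
    fun m K hm hK hKm hmK => ?_⟩
  have hm2 : (2 : ℝ) ≤ m := by exact_mod_cast hm
  have hm0 : (0 : ℝ) < m := by linarith
  have hK1 : (1 : ℝ) ≤ K := by exact_mod_cast hK
  have hK0 : (0 : ℝ) < K := by linarith
  have hlogK : 0 ≤ Real.log K := Real.log_nonneg hK1
  have hlog2 : Real.log 2 ≤ Real.log m := Real.log_le_log two_pos hm2
  have hlogKm : Real.log K ≤ Real.log m := Real.log_le_log hK0 (by exact_mod_cast hKm)
  have hm5 : (m : ℝ) ≤ (5 * K) ^ ((e : ℝ) + 1) := by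
    -- `2K + 3 ≤ 5K` because `K ≥ 1`.
    have h1 : m ≤ (5 * K) ^ (e + 1) := hmK.le.trans (Nat.pow_le_pow_left (by omega) _)
    have h2 : (m : ℝ) ≤ ((5 * K : ℕ) : ℝ) ^ (e + 1) := by exact_mod_cast h1
    rw [← Real.rpow_natCast] at h2
    simpa using h2
  have hpow : (K : ℝ) ^ (-(2 * r * (e + 1))) ≤ 5 ^ (2 * r * (e + 1)) * (m : ℝ) ^ (-(2 * r)) := by
    have h1 : ((5 * K : ℝ) ^ ((e : ℝ) + 1)) ^ (-(2 * r)) ≤ (m : ℝ) ^ (-(2 * r)) :=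
      Real.rpow_le_rpow_of_nonpos hm0 hm5 (by linarith)
    rw [← Real.rpow_mul (by positivity), Real.mul_rpow (by norm_num) hK0.le,
      show ((e : ℝ) + 1) * -(2 * r) = -(2 * r * (e + 1)) by ring] at h1
    calc (K : ℝ) ^ (-(2 * r * (e + 1))) = 5 ^ (2 * r * (e + 1)) *
          ((5 : ℝ) ^ (-(2 * r * (e + 1))) * (K : ℝ) ^ (-(2 * r * (e + 1)))) := by
          rw [← mul_assoc, ← Real.rpow_add (by norm_num), add_neg_cancel, Real.rpow_zero, one_mul]
      _ ≤ _ := by gcongr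
  have hlog : 1 + Real.log K ≤ (1 / Real.log 2 + 1) * Real.log m := by
    have : 1 ≤ 1 / Real.log 2 * Real.log m := by
      rw [one_div, inv_mul_eq_div]; exact (one_le_div hl2).mpr hlog2
    linarith
  have hrate : rate (e + 1) r m ^ 2 = (m : ℝ) ^ (-(2 * r)) * Real.log m ^ e := by
    rw [rate, mul_pow, ← Real.rpow_natCast, ← Real.rpow_natCast, ← Real.rpow_mul hm0.le,
      ← Real.rpow_mul (by linarith), ← Real.rpow_natCast (Real.log m) e]
    push_cast
    congr 2 <;> ring
  calc _ ≤ (5 ^ (2 * r * (e + 1)) * (m : ℝ) ^ (-(2 * r))) *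
        ((1 / Real.log 2 + 1) * Real.log m) ^ e := by gcongr
    _ = _ := by rw [hrate, mul_pow]; ring

theorem exists_optimalError_le (d : ℕ) (hd : 1 ≤ d) {r : ℝ} (hr : 1 / 2 < r) (n : ℕ) :
    ∃ C : ℝ, 0 < C ∧ ∀ m : ℕ, 2 ≤ m →
      optimalError m (mixedClass d r) ((2 * n : ℕ) : ℝ) ≤ ENNReal.ofReal (C * rate d r m) := by
  obtain ⟨e, rfl⟩ : ∃ e, d = e + 1 := ⟨d - 1, by omega⟩
  obtain ⟨R, hR, hpow⟩ := exists_hasMixedSeries_norm_pow (e + 1) hr n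
  obtain ⟨C₁, K₀, hC₁, hK₀, hcub⟩ := exists_cubature e hr
  obtain ⟨C₂, hC₂, hrate⟩ := exists_frolov_rate_le e (r := r) (by linarith)
  -- The cubature needs `K ≥ K₀`; the finitely many smaller `m` are absorbed into the constant,
  -- using the rule without nodes.
  obtain ⟨C₃, hC₃, hsmall⟩ : ∃ C₃ : ℝ, 0 < C₃ ∧
      ∀ m : ℕ, 2 ≤ m → m < (2 * K₀ + 1) ^ (e + 1) → √R ≤ C₃ * rate (e + 1) r m := by
    refine ⟨∑ m ∈ Finset.Icc 2 ((2 * K₀ + 1) ^ (e + 1)), √R / rate (e + 1) r m + 1, ?_,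
      fun m hm hmK => ?_⟩
    · have := Finset.sum_nonneg (s := Finset.Icc 2 ((2 * K₀ + 1) ^ (e + 1)))
        (f := fun m => √R / rate (e + 1) r m) fun m hm =>
          div_nonneg (Real.sqrt_nonneg _) (rate_pos _ _ (Finset.mem_Icc.mp hm).1).le
      linarith
    · have := Finset.single_le_sum (s := Finset.Icc 2 ((2 * K₀ + 1) ^ (e + 1)))
        (f := fun m => √R / rate (e + 1) r m) (fun m hm =>
          div_nonneg (Real.sqrt_nonneg _) (rate_pos _ _ (Finset.mem_Icc.mp hm).1).le)
        (Finset.mem_Icc.mpr ⟨hm, hmK.le⟩)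
      rw [← div_le_iff₀ (rate_pos _ _ hm)]
      linarith
  refine ⟨√(R * (C₁ * C₂)) + C₃, by positivity, fun m hm => ?_⟩
  have hm0 := rate_pos (e + 1) r hm
  -- The largest `K` for which the `(2K + 1)^d` nodes fit into the budget `m`; maximality gives `m <
  -- (2K + 3)^d`.
  set K := Nat.findGreatest (fun K => (2 * K + 1) ^ (e + 1) ≤ m) m with hK
  have hKm : (2 * K + 1) ^ (e + 1) ≤ m :=
    Nat.findGreatest_spec (P := fun K => (2 * K + 1) ^ (e + 1) ≤ m) (Nat.zero_le m)
      (by simpa using (by omega : 1 ≤ m))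
  have hKle : K ≤ m := Nat.findGreatest_le m
  have hmK : m < (2 * K + 3) ^ (e + 1) := by
    by_contra! hcon
    have h1 : K + 1 ≤ m := by
      have := (Nat.le_self_pow (Nat.succ_ne_zero e) (2 * K + 3)).trans hcon
      omega
    have h2 : K + 1 ≤ K := Nat.le_findGreatest (P := fun K => (2 * K + 1) ^ (e + 1) ≤ m) h1 hcon
    omega
  rcases le_or_gt K₀ K with hle | hlt
  · obtain ⟨ξ, lam, hξ⟩ := hcub K hle
    refine optimalError_le_of_card_le (by rwa [Fintype.card_coe, card_integerBox]) ξ lam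
      fun f hf => ENNReal.ofReal_le_ofReal ?_
    simp_rw [Real.rpow_natCast]
    have hlogK : 0 ≤ Real.log K := Real.log_natCast_nonneg K
    refine (abs_integral_sub_sum_le hr (by positivity)
      (hpow f (hasMixedSeries_of_mem_mixedClass hr hf)) ξ lam hξ).trans ?_
    calc _ ≤ √(R * (C₁ * C₂) * rate (e + 1) r m ^ 2) := by
          refine Real.sqrt_le_sqrt ?_
          have := mul_le_mul_of_nonneg_left (hrate m K hm (hK₀.trans hle) hKle hmK)
            (mul_pos hR hC₁).le
          linarith
      _ = √(R * (C₁ * C₂)) * rate (e + 1) r m := by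
          rw [Real.sqrt_mul (by positivity), Real.sqrt_sq hm0.le]
      _ ≤ _ := mul_le_mul_of_nonneg_right (by linarith) hm0.le
  · refine optimalError_le_of_card_le (ι := Empty) (by simp) Empty.elim Empty.elim
      fun f hf => ENNReal.ofReal_le_ofReal ?_
    simp_rw [Real.rpow_natCast]
    -- Without nodes only `k = 0` contributes, so the squared norm of the error functional is `1`.
    have hQ : ∑' k : Fin (e + 1) → ℤ, ENNReal.ofReal (mixedWeight (-(2 * r)) k) * ENNReal.ofReal
        (‖(∑ z : Empty, ((Empty.elim z : ℝ) : ℂ) * character k (Empty.elim z : cube (e + 1))) -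
          if k = 0 then 1 else 0‖ ^ 2) ≤ ENNReal.ofReal 1 := by
      rw [tsum_eq_single 0 fun k hk => by simp [hk]]
      simp [mixedWeight_zero]
    refine (abs_integral_sub_sum_le hr zero_le_one
      (hpow f (hasMixedSeries_of_mem_mixedClass hr hf)) Empty.elim Empty.elim hQ).trans ?_
    rw [mul_one]
    refine (hsmall m hm (hmK.trans_le (Nat.pow_le_pow_left (by omega) _))).trans
      (mul_le_mul_of_nonneg_right ?_ hm0.le)
    linarith [Real.sqrt_nonneg (R * (C₁ * C₂))]

lemma optimalError_mono {d m : ℕ} {V W : Set ((Fin d → ℝ) → ℂ)} (h : V ⊆ W) (q : ℝ) :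
    optimalError m V q ≤ optimalError m W q :=
  iInf₂_mono fun _ _ => biSup_mono fun _ hf => h hf

end SamplingDiscretization

end

theorem mainTheorem5 (d : ℕ) (hd : 1 ≤ d) (r : ℝ) (hr : 1 / 2 < r) (n : ℕ) (hn : 1 ≤ n) :
    ∃ c C : ℝ, 0 < c ∧ 0 < C ∧ ∀ m : ℕ, 2 ≤ m →
      (ENNReal.ofReal (c * SamplingDiscretization.rate d r m) ≤
          SamplingDiscretization.optimalError m
            (SamplingDiscretization.mixedClass d r) ((2 * n : ℕ) : ℝ) ∧
        SamplingDiscretization.optimalError m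
            (SamplingDiscretization.mixedClass d r) ((2 * n : ℕ) : ℝ) ≤
          ENNReal.ofReal (C * SamplingDiscretization.rate d r m)) ∧
      (ENNReal.ofReal (c * SamplingDiscretization.rate d r m) ≤
          SamplingDiscretization.optimalError m
            (SamplingDiscretization.realMixedClass d r) ((2 * n : ℕ) : ℝ) ∧
        SamplingDiscretization.optimalError m
            (SamplingDiscretization.realMixedClass d r) ((2 * n : ℕ) : ℝ) ≤
          ENNReal.ofReal (C * SamplingDiscretization.rate d r m)) := by
  obtain ⟨c, hc, hlow⟩ := SamplingDiscretization.exists_le_optimalError d hd hr n hn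
  obtain ⟨C, hC, hupp⟩ := SamplingDiscretization.exists_optimalError_le d hd hr n
  refine ⟨c, C, hc, hC, fun m hm => ?_⟩
  -- The lower bound is proved on the smaller real class and the upper bound on the larger complex
  -- one, so inclusion gives the other two inequalities.
  have hmono := SamplingDiscretization.optimalError_mono (m := m) (V :=
    SamplingDiscretization.realMixedClass d r) (W := SamplingDiscretization.mixedClass d r)
    (fun f hf => hf.1) ((2 * n : ℕ) : ℝ)
  exact ⟨⟨(hlow m hm).trans hmono, hupp m hm⟩, hlow m hm, hmono.trans (hupp m hm)⟩
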